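/- For $p\in(0,1]$ let $(\varphi_1,\varphi_2)=(\varphi_1^{p},\varphi_2^{p})$ denote the solution on $\mathbb R$ of $$\varphi_1''=(1-2\varphi_1^2-8\varphi_2^2)\,\varphi_1,\qquad \varphi_2''=(4-2\varphi_1^2-8\varphi_2^2)\,\varphi_2,$$ $$\varphi_1(0)=0,\quad \varphi_2(0)=p,\quad \varphi_1'(0)=2p,\quad \varphi_2'(0)=0$$ (it exists and is unique). Call a function $f$ on $\mathbb R$ periodic if it has a period $T>0$, and quasi-periodic if $f(y)=F(\omega_1y,\omega_2y)$ for a continuous function $F$ on the torus $(\mathbb R/\mathbb Z)^2$ and two real numbers $\omega_1,\omega_2$ that are linearly independent over $\mathbb Q$. Say that a pair $(\varphi_1,\varphi_2)$ satisfies the zero conditions if it has a least period $T>0$, $\varphi_1$ has exactly two zeros in $[a,a+T)$ for every $a\in\mathbb R$, and $\varphi_2>0$ everywhere. Then: 1. For all $p\in(0,1]$ with $p\neq\sqrt3/2$, the pair $(\varphi_1,\varphi_2)$ is periodic or quasi-periodic. 2. For $p=\sqrt3/2$, $(\varphi_1(y),\varphi_2(y))\to(0,0)$ as $y\to+\infty$,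 and $(\varphi_1,\varphi_2)$ is not periodic. 3. For all $p\in(\sqrt3/2,1]$, $\varphi_2$ vanishes somewhere, and it vanishes at least once in each period: if $T>0$ is a period of $\varphi_2$, then $\varphi_2$ has a zero in $[a,a+T)$ for every $a$. Hence the zero conditions are not satisfied. 4. For $0<p<\sqrt3/2$ put $P_p(s)=s(1-2s)(3+2s)(2p^2+s)(3-4p^2+2s)$, let $a_0(p)\le a_1(p)$ be the numbers $2p^2-\tfrac32$ and $-2p^2$ in increasing order, and set $$T_u(p)=2\int_0^{1/2}\frac{ds}{\sqrt{P_p(s)}},\qquad T_v(p)=2\int_{a_0(p)}^{a_1(p)}\frac{ds}{\sqrt{P_p(s)}}\quad(p\neq\sqrt{3/8});$$ these integrals converge. There is a countable set $\mathcal P\subset(0,\sqrt3/2)$, dense in $(0,\sqrt3/2)$ and with $\sqrt{3/8}\in\mathcal P$, such that, for $p\in(0,\sqrt3/2)$ with $p\neq\sqrt{3/8}$, one has $p\in\mathcal P$ if and only if $T_v(p)/T_u(p)\in\mathbb Q$, and such that, for all $p\in(0,\sqrt3/2)$, the pair $(\varphi_1,\varphi_2)$ is periodic if and only if $p\in\mathcal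 P$. 5. For $p=\sqrt{3/8}$, $(\varphi_1,\varphi_2)$ satisfies the zero conditions. For every $p\in\mathcal P$ with $p\neq\sqrt{3/8}$, $\varphi_1$ has at least $6$ zeros in each period: if $T>0$ is a period of $(\varphi_1,\varphi_2)$, then $\varphi_1$ has at least $6$ zeros in $[a,a+T)$ for every $a\in\mathbb R$. -/

import Mathlib

/-- `(φ₁, φ₂)` is a solution, on the whole real line, of the second order system
`φ₁'' = (1 - 2 φ₁² - 8 φ₂²) φ₁`, `φ₂'' = (4 - 2 φ₁² - 8 φ₂²) φ₂` with initial conditions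
`φ₁(0) = 0`, `φ₂(0) = p`, `φ₁'(0) = 2 p`, `φ₂'(0) = 0`. -/
structure IsSolution (p : ℝ) (φ₁ φ₂ : ℝ → ℝ) : Prop where
  differentiable_fst : Differentiable ℝ φ₁
  differentiable_snd : Differentiable ℝ φ₂
  eq_fst : ∀ y, HasDerivAt (deriv φ₁) ((1 - 2 * φ₁ y ^ 2 - 8 * φ₂ y ^ 2) * φ₁ y) y
  eq_snd : ∀ y, HasDerivAt (deriv φ₂) ((4 - 2 * φ₁ y ^ 2 - 8 * φ₂ y ^ 2) * φ₂ y) y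
  fst_zero : φ₁ 0 = 0
  snd_zero : φ₂ 0 = p
  deriv_fst_zero : deriv φ₁ 0 = 2 * p
  deriv_snd_zero : deriv φ₂ 0 = 0

/-- `T` is a (positive, not necessarily minimal) period of `f`. -/
def IsPeriod {E : Type*} (f : ℝ → E) (T : ℝ) : Prop :=
  0 < T ∧ Function.Periodic f T

/-- `f` is periodic: it has a positive period. -/
def IsPeriodic {E : Type*} (f : ℝ → E) : Prop :=
  ∃ T, IsPeriod f T

/-- `f` is quasi-periodic with two frequencies: it is a continuous function on the torus
`(ℝ / ℤ)²` evaluated along a linear motion `y ↦ (ω₀ y, ω₁ y)` with rationally independent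
frequencies. -/
def IsQuasiPeriodic {E : Type*} [TopologicalSpace E] (f : ℝ → E) : Prop :=
  ∃ ω : Fin 2 → ℝ, LinearIndependent ℚ ω ∧
    ∃ F : C(Fin 2 → UnitAddCircle, E), ∀ y, f y = F (fun i => ((ω i * y : ℝ) : UnitAddCircle))

/-- The pair of functions as one function into the plane. -/
def pairFun (φ₁ φ₂ : ℝ → ℝ) : ℝ → ℝ × ℝ := fun y => (φ₁ y, φ₂ y)

/-- The zeros of `f` in the half-open interval `[a, a + T)`. -/
def zerosIn (f : ℝ → ℝ) (a T : ℝ) : Set ℝ :=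
  {y | y ∈ Set.Ico a (a + T) ∧ f y = 0}

/-- The zero conditions on a periodic pair: `φ₁` has exactly two zeros in a period (in any
half-open interval whose length is the least period of the pair) and `φ₂` is positive
everywhere. -/
def ZeroCondition (φ₁ φ₂ : ℝ → ℝ) : Prop :=
  (∃ T, IsLeast {T | IsPeriod (pairFun φ₁ φ₂) T} T ∧ ∀ a, (zerosIn φ₁ a T).encard = 2) ∧
    ∀ y, 0 < φ₂ y

/-- The quintic polynomial under the square root in the hyperelliptic integrals. -/
noncomputable def quintic (p s : ℝ) : ℝ :=
  s * (1 - 2 * s) * (3 + 2 * s) * (2 * p ^ 2 + s) * (3 - 4 * p ^ 2 + 2 * s)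

/-- The smaller one of the two roots `2 p² - 3/2` and `-2 p²`. -/
noncomputable def lowerRoot (p : ℝ) : ℝ := min (2 * p ^ 2 - 3 / 2) (-2 * p ^ 2)

/-- The larger one of the two roots `2 p² - 3/2` and `-2 p²`. -/
noncomputable def upperRoot (p : ℝ) : ℝ := max (2 * p ^ 2 - 3 / 2) (-2 * p ^ 2)

/-- The hyperelliptic period `T_u(p)`, for `0 < p < √3 / 2`. -/
noncomputable def periodU (p : ℝ) : ℝ :=
  2 * ∫ s in (0 : ℝ)..(1 / 2), 1 / Real.sqrt (quintic p s)

/-- The hyperelliptic period `T_v(p)`, for `0 < p < √3 / 2` and `p ≠ √(3/8)`. -/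
noncomputable def periodV (p : ℝ) : ℝ :=
  2 * ∫ s in (lowerRoot p)..(upperRoot p), 1 / Real.sqrt (quintic p s)

/-! The system is integrable and separates in elliptic coordinates `u < v` given by `3 φ₁² = (1 -
u)(v - 1)` and `12 φ₂² = (4 - u)(4 - v)`. In the time `s` with `dt = (v - u) ds`, both coordinates
satisfy the same equation `x'² = 4 x (x - 1)(x - 4)(x - (4 - 4p²))(x - (4p² + 1))`, each between two
neighbouring roots. Writing each coordinate as `m + ρ cos` of an angle turns these oscillations into
strictly increasing angles, and the half-angle formulas provide the smooth signed square roots that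
make up `φ₁` and `φ₂` (`IsFactor.mul`, `isSolution_of_isFactor`).

For `p² > 3/4` the range of `v` is `[1, 4]`, so `φ₂` carries a factor `cos (χ / 2)` and vanishes. At
`p² = 3/4` two pairs of roots collide and the solution is elementary in hyperbolic functions. For
`p² < 3/4` the range of `u` is `[0, 1]` and `v` stays inside `(1, 4)`, so `φ₂ > 0`, and `φ₁`
vanishes exactly when `ϑ` is a multiple of `2π`. For `p² = 3/8` the coordinate `v` is constant and
only `ϑ` matters.

In the time `s` the motion is a straight line on a torus. The clock `v - u` is a function of one
angle minus a function of the other, so the return to the time `t` is an explicit change of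
coordinates on the torus. Hence the motion is periodic or quasi-periodic according to whether the
two angle periods are commensurable (`time_change_dichotomy`).

With `x = 1 - 2 s` the angle periods become the hyperelliptic ones. A period of the pair gives `2 n
T_u = m T_v`, and `φ₁` then has `2 n` zeros. The bound `4/3 < T_v / T_u < 2` (`period_bounds`) gives
`2 m < 3 n` and `n < m`, hence `n ≥ 3`. To prove the bound, Cauchy's theorem in the upper half plane
writes `T_v - T_u` as an integral over `(-∞, -3/2)` (`integral_inv_sqrt_quintic_relation`). The
substitution `s + 3/4 = ± (3/4) / x` then brings both integrals to the form `∫ w(x) / √(1 - κ x²)`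
with `w` independent of `p`. The kernel increases in `x` and each relevant difference of weights
changes sign once, so everything reduces to `κ = 0`.

The set of periodic parameters is countable and dense because the ratio is continuous and takes each
value only countably often. Indeed a linear combination of the two integrals is analytic in `κ`, and
it is not identically zero because its first three even moments cannot all vanish
(`exists_moment_ne_zero`). -/

/-! ### Time changes, flows on the circle and linear motion on the torus. -/

theorem intervalIntegral_zero_add_period {f : ℝ → ℝ} {T : ℝ} (hf : Continuous f)
    (hT : Function.Periodic f T) (x : ℝ) :
    ∫ s in (0 : ℝ)..(x + T), f s = (∫ s in (0 : ℝ)..x, f s) + ∫ s in (0 : ℝ)..T, f s := by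
  have h := hT.intervalIntegral_add_eq x 0
  rw [zero_add] at h
  rw [← h, intervalIntegral.integral_add_adjacent_intervals (hf.intervalIntegrable _ _)
      (hf.intervalIntegrable _ _)]

/-- A differentiable function on the line whose derivative is bounded below by a positive constant
has a global differentiable inverse. -/
theorem exists_inverse_of_le_deriv {F f : ℝ → ℝ} {m : ℝ} (hm : 0 < m) (hmf : ∀ x, m ≤ f x)
    (hF : ∀ x, HasDerivAt F (f x) x) :
    ∃ σ : ℝ → ℝ, (∀ x, σ (F x) = x) ∧ (∀ t, F (σ t) = t) ∧ StrictMono σ ∧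
      ∀ t, HasDerivAt σ (f (σ t))⁻¹ t := by
  have hmono : StrictMono F := strictMono_of_hasDerivAt_pos hF fun x => hm.trans_le (hmf x)
  have hcont : Continuous F := continuous_iff_continuousAt.2 fun x => (hF x).continuousAt
  have hlin : Monotone fun x => F x - m * x := by
    refine monotone_of_hasDerivAt_nonneg
      (fun x => (hF x).sub ((hasDerivAt_id x).const_mul m)) fun x => ?_
    simpa using hmf x
  have htop : Filter.Tendsto F Filter.atTop Filter.atTop := by
    refine Filter.tendsto_atTop_mono' _ (f₁ := fun x => F 0 + m * x) ?_
      (Filter.tendsto_atTop_add_const_left _ _ (Filter.tendsto_id.const_mul_atTop hm))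
    filter_upwards [Filter.eventually_ge_atTop 0] with x hx
    have := hlin hx
    simp only at this
    linarith
  have hbot : Filter.Tendsto F Filter.atBot Filter.atBot := by
    refine Filter.tendsto_atBot_mono' _ ?_
      (Filter.tendsto_atBot_add_const_left _ (F 0) (Filter.tendsto_id.const_mul_atBot hm))
    filter_upwards [Filter.eventually_le_atBot 0] with x hx
    have := hlin hx
    simp only [id] at this ⊢
    linarith
  let e := hmono.orderIsoOfSurjective F (hcont.surjective htop hbot)
  have hl : ∀ x, e.symm (F x) = x := fun x => e.symm_apply_apply x
  have hr : ∀ t, F (e.symm t) = t := fun t => e.apply_symm_apply t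
  refine ⟨e.symm, hl, hr, e.symm.strictMono, fun t => ?_⟩
  exact HasDerivAt.of_local_left_inverse e.symm.continuous.continuousAt (hF _)
    (hm.trans_le (hmf _)).ne' (Filter.Eventually.of_forall hr)

/-- The flow of a positive periodic vector field on the line. -/
theorem exists_flow {A : ℝ → ℝ} {m C L : ℝ} (hA : Continuous A) (hm : 0 < m) (hmA : ∀ x, m ≤ A x)
    (hAC : ∀ x, A x ≤ C) (hL : 0 < L) (hper : Function.Periodic A L) :
    ∃ ϑ : ℝ → ℝ, ϑ 0 = 0 ∧ StrictMono ϑ ∧ Function.Surjective ϑ ∧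
      (∀ s, HasDerivAt ϑ (A (ϑ s)) s) ∧ 0 < (∫ x in (0 : ℝ)..L, (A x)⁻¹) ∧
      ∀ s, ϑ (s + ∫ x in (0 : ℝ)..L, (A x)⁻¹) = ϑ s + L := by
  have hpos : ∀ x, 0 < A x := fun x => hm.trans_le (hmA x)
  have hcont : Continuous fun x => (A x)⁻¹ := hA.inv₀ fun x => (hpos x).ne'
  have hC : 0 < C := (hpos 0).trans_le (hAC 0)
  obtain ⟨ϑ, h1, h2, h3, h4⟩ := exists_inverse_of_le_deriv (f := fun x => (A x)⁻¹)
    (F := fun y => ∫ x in (0 : ℝ)..y, (A x)⁻¹) (inv_pos.2 hC)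
    (fun x => inv_anti₀ (hpos x) (hAC x)) fun x => hcont.integral_hasStrictDerivAt 0 x |>.hasDerivAt
  refine ⟨ϑ, by simpa using h1 0, h3, fun x => ⟨_, h1 x⟩, fun s => by simpa using h4 s,
    intervalIntegral.intervalIntegral_pos_of_pos (hcont.intervalIntegrable _ _)
      (fun x => inv_pos.2 (hpos x)) hL, fun s => ?_⟩
  conv_lhs => rw [← h2 s]
  rw [← intervalIntegral_zero_add_period hcont (fun x => by simp only [hper x]), h1]

theorem isOpenQuotientMap_pi_unitAddCircle :
    IsOpenQuotientMap (fun (x : Fin 2 → ℝ) (i : Fin 2) => ((x i : ℝ) : UnitAddCircle)) := by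
  have := IsOpenQuotientMap.piMap (f := fun (_ : Fin 2) (x : ℝ) => (x : UnitAddCircle))
    fun _ => QuotientAddGroup.isOpenQuotientMap_mk
  exact this

/-- A continuous function on the plane with periods in both coordinates descends to the torus. -/
theorem exists_torus_of_periodic {E : Type*} [TopologicalSpace E] {G : ℝ × ℝ → E}
    (hG : Continuous G) {T₁ T₂ : ℝ} (h₁ : ∀ x y, G (x + T₁, y) = G (x, y))
    (h₂ : ∀ x y, G (x, y + T₂) = G (x, y)) :
    ∃ F : C(Fin 2 → UnitAddCircle, E), ∀ x : Fin 2 → ℝ,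
      F (fun i => (x i : UnitAddCircle)) = G (T₁ * x 0, T₂ * x 1) := by
  let g : C(Fin 2 → ℝ, E) := ⟨fun x => G (T₁ * x 0, T₂ * x 1), by fun_prop⟩
  let π : C(Fin 2 → ℝ, Fin 2 → UnitAddCircle) :=
    ⟨fun x i => (x i : UnitAddCircle), isOpenQuotientMap_pi_unitAddCircle.continuous⟩
  have hz₁ : ∀ (n : ℤ) x y, G (x + n * T₁, y) = G (x, y) := fun n x y =>
    (show Function.Periodic (fun x => G (x, y)) T₁ from fun x => h₁ x y).int_mul n x
  have hz₂ : ∀ (n : ℤ) x y, G (x, y + n * T₂) = G (x, y) := fun n x y =>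
    (show Function.Periodic (fun y => G (x, y)) T₂ from fun y => h₂ x y).int_mul n y
  have hfac : Function.FactorsThrough g π := by
    intro x y hxy
    have hx : ∀ i, ∃ n : ℤ, y i = x i + n := fun i => by
      obtain ⟨n, hn⟩ := QuotientAddGroup.leftRel_apply.1 (Quotient.exact (congrFun hxy i))
      exact ⟨n, by simpa [eq_neg_add_iff_add_eq, eq_comm] using hn⟩
    obtain ⟨n, hn⟩ := hx 0
    obtain ⟨k, hk⟩ := hx 1
    change G _ = G _
    rw [hn, hk, mul_add, mul_add, mul_comm T₁ n, mul_comm T₂ k, hz₁, hz₂]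
  have hq : Topology.IsQuotientMap π := isOpenQuotientMap_pi_unitAddCircle.isQuotientMap
  refine ⟨hq.lift g hfac, fun x => ?_⟩
  exact DFunLike.congr_fun (hq.lift_comp g hfac) x

/-- Commensurable periods have a common multiple `n T₁ = k T₂`. The clock `w` has this period as
well, so advancing the old time by it costs the same amount of new time wherever one starts. -/
theorem isPeriodic_time_change {E : Type*} {G : ℝ × ℝ → E} {w σ : ℝ → ℝ} {T₁ T₂ m : ℝ}
    (h₁ : ∀ x y, G (x + T₁, y) = G (x, y)) (h₂ : ∀ x y, G (x, y + T₂) = G (x, y))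
    (hT₁ : 0 < T₁) (hT₂ : 0 < T₂) (hw : Continuous w) (hm : 0 < m) (hmw : ∀ x, m ≤ w x)
    (hper : ∀ n k : ℕ, n * T₁ = k * T₂ → Function.Periodic w (n * T₁))
    (hσ : ∀ t, ∫ s in (0 : ℝ)..(σ t), w s = t) (hσ' : ∀ x, σ (∫ s in (0 : ℝ)..x, w s) = x)
    (hr : ∃ r : ℚ, T₁ = r * T₂) : IsPeriodic fun t => G (σ t, σ t) := by
  obtain ⟨r, hr⟩ := hr
  have hr0 : 0 < r := by
    have : (0 : ℝ) < r := by
      by_contra h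
      have := mul_nonpos_of_nonpos_of_nonneg (not_lt.1 h) hT₂.le
      linarith
    exact_mod_cast this
  obtain ⟨n, hn, k, hk, hnk⟩ : ∃ n : ℕ, 0 < n ∧ ∃ k : ℕ, 0 < k ∧ n * T₁ = k * T₂ := by
    refine ⟨r.den, r.den_pos, r.num.toNat, by simpa using hr0, ?_⟩
    have h3 : ((r.num.toNat : ℕ) : ℝ) = r.num := by
      have : ((r.num.toNat : ℕ) : ℤ) = r.num := Int.toNat_of_nonneg (by simpa using hr0.le)
      exact_mod_cast this
    have h4 : (r.den : ℝ) * r = r.num := by exact_mod_cast Rat.den_mul_eq_num r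
    rw [hr, h3, ← h4]
    ring
  have hw' := hper n k hnk
  have hpos : 0 < n * T₁ := by positivity
  refine ⟨∫ s in (0 : ℝ)..(n * T₁), w s, intervalIntegral.intervalIntegral_pos_of_pos
    (hw.intervalIntegrable _ _) (fun x => hm.trans_le (hmw x)) hpos, fun t => ?_⟩
  have hs : σ (t + ∫ s in (0 : ℝ)..(n * T₁), w s) = σ t + n * T₁ := by
    conv_lhs => rw [← hσ t]
    rw [← intervalIntegral_zero_add_period hw hw', hσ']
  have e₁ : ∀ y, Function.Periodic (fun x => G (x, y)) T₁ := fun y x => h₁ x y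
  have e₂ : ∀ x, Function.Periodic (fun y => G (x, y)) T₂ := fun x y => h₂ x y
  have i₁ := (e₁ (σ t + n * T₁)).nat_mul n (σ t)
  have i₂ := (e₂ (σ t)).nat_mul k (σ t)
  simp only [hs] at i₁ i₂ ⊢
  rw [i₁, hnk, i₂]

/-- A time change of a linear flow need not be conjugate to a linear flow in general. Here the clock
splits as `v y - u x`, so its oscillating part is the derivative along the flow of an explicit
periodic function, and no small divisors appear. Sliding each point along its orbit by that function
makes the flow linear in `t`. -/
theorem isQuasiPeriodic_time_change {E : Type*} [TopologicalSpace E] {G : ℝ × ℝ → E}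
    {u v σ : ℝ → ℝ} {T₁ T₂ m : ℝ} (hG : Continuous G)
    (h₁ : ∀ x y, G (x + T₁, y) = G (x, y)) (h₂ : ∀ x y, G (x, y + T₂) = G (x, y))
    (hT₁ : 0 < T₁) (hT₂ : 0 < T₂) (hu : Continuous u) (hv : Continuous v)
    (hu' : Function.Periodic u T₁) (hv' : Function.Periodic v T₂) (hm : 0 < m)
    (hmw : ∀ x y, m ≤ v y - u x)
    (hσ : ∀ t, ∫ s in (0 : ℝ)..(σ t), (v s - u s) = t)
    (hr : ¬ ∃ r : ℚ, T₁ = r * T₂) : IsQuasiPeriodic fun t => G (σ t, σ t) := by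
  set U : ℝ → ℝ := fun y => ∫ s in (0 : ℝ)..y, u s with hU
  set V : ℝ → ℝ := fun y => ∫ s in (0 : ℝ)..y, v s with hV
  have hUd : ∀ x, HasDerivAt U (u x) x := fun x => (hu.integral_hasStrictDerivAt 0 x).hasDerivAt
  have hVd : ∀ x, HasDerivAt V (v x) x := fun x => (hv.integral_hasStrictDerivAt 0 x).hasDerivAt
  have hUc : Continuous U := continuous_iff_continuousAt.2 fun x => (hUd x).continuousAt
  have hVc : Continuous V := continuous_iff_continuousAt.2 fun x => (hVd x).continuousAt
  have hUT : ∀ x, U (x + T₁) = U x + U T₁ := fun x => intervalIntegral_zero_add_period hu hu' x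
  have hVT : ∀ x, V (x + T₂) = V x + V T₂ := fun x => intervalIntegral_zero_add_period hv hv' x
  obtain ⟨M₁, hM₁⟩ : ∃ M₁, U T₁ = M₁ * T₁ := ⟨U T₁ / T₁, by field_simp⟩
  obtain ⟨M₂, hM₂⟩ : ∃ M₂, V T₂ = M₂ * T₂ := ⟨V T₂ / T₂, by field_simp⟩
  -- Averaging `m ≤ v y - u x` over `y`, and then over `x`, separates the means: `M₁ + m ≤ M₂`. So
  -- the mean speed `M` of the clock is positive.
  have hle : ∀ x, m + u x ≤ M₂ := fun x => by
    have h := intervalIntegral.integral_mono_on hT₂.le (μ := MeasureTheory.volume)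
      (f := fun _ => m + u x) (g := v) (by simp) (hv.intervalIntegrable _ _)
      fun y _ => by linarith [hmw x y]
    rw [intervalIntegral.integral_const, sub_zero, smul_eq_mul] at h
    change _ ≤ V T₂ at h
    rw [hM₂, mul_comm] at h
    exact le_of_mul_le_mul_right h hT₂
  have hle' : M₁ + m ≤ M₂ := by
    have h := intervalIntegral.integral_mono_on hT₁.le (μ := MeasureTheory.volume)
      (f := u) (g := fun _ => M₂ - m) (hu.intervalIntegrable _ _) (by simp)
      fun y _ => by linarith [hle y]
    rw [intervalIntegral.integral_const, sub_zero, smul_eq_mul] at h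
    change U T₁ ≤ _ at h
    rw [hM₁, mul_comm T₁] at h
    linarith [le_of_mul_le_mul_right h hT₁]
  obtain ⟨M, hM⟩ : ∃ M, M = M₂ - M₁ := ⟨_, rfl⟩
  have hM0 : 0 < M := by linarith
  -- The orbit with phase difference `d` is `s ↦ (s, s + d)`, and `K d s` is its corrected first
  -- coordinate. The added term is doubly periodic, since the linear growth of `U` and `V` has been
  -- removed.
  let K : ℝ → ℝ → ℝ := fun d s => s + (V (s + d) - M₂ * (s + d) - (U s - M₁ * s)) / M
  have hKd : ∀ d s, HasDerivAt (K d) ((v (s + d) - u s) / M) s := fun d s => by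
    have h := (hasDerivAt_id s).add (((((hVd (s + d)).comp_add_const s d).sub
      (((hasDerivAt_id s).add_const d).const_mul M₂)).sub
      ((hUd s).sub ((hasDerivAt_id s).const_mul M₁))).div_const M)
    refine HasDerivAt.congr_deriv (f := K d) h ?_
    have : M ≠ 0 := hM0.ne'
    field_simp
    rw [hM]
    ring
  have hKm : ∀ d s, m / M ≤ (v (s + d) - u s) / M := fun d s => by
    gcongr
    exact hmw _ _
  choose ρ hρ₁ hρ₂ hρ₃ hρ₄ using fun d =>
    exists_inverse_of_le_deriv (div_pos hm hM0) (hKm d) (hKd d)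
  -- This expansion bound is uniform in `d`, which makes the inverse `ρ` continuous jointly in both
  -- variables.
  have hlow : ∀ d a b, m / M * |a - b| ≤ |K d a - K d b| := by
    intro d
    have hmon : Monotone fun x => K d x - m / M * x :=
      monotone_of_hasDerivAt_nonneg (fun x => (hKd d x).sub ((hasDerivAt_id x).const_mul _))
        fun x => by simpa using hKm d x
    have key : ∀ a b, b ≤ a → m / M * |a - b| ≤ |K d a - K d b| := fun a b hab => by
      have := hmon hab
      simp only at this
      rw [abs_of_nonneg (sub_nonneg.2 hab)]
      exact le_trans (by linarith) (le_abs_self _)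
    intro a b
    rcases le_total b a with h | h
    · exact key a b h
    · rw [abs_sub_comm, abs_sub_comm (K d a)]
      exact key b a h
  have hρc : Continuous fun z : ℝ × ℝ => ρ z.1 z.2 := by
    rw [continuous_iff_continuousAt]
    rintro ⟨d₀, x₀⟩
    rw [ContinuousAt, tendsto_iff_dist_tendsto_zero]
    have hlim : Filter.Tendsto (fun z : ℝ × ℝ => (M / m) * |z.2 - K z.1 (ρ d₀ x₀)|)
        (nhds (d₀, x₀)) (nhds 0) := by
      have hc : Continuous fun z : ℝ × ℝ => (M / m) * |z.2 - K z.1 (ρ d₀ x₀)| := by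
        simp only [K]
        fun_prop
      have := hc.tendsto (d₀, x₀)
      simpa [hρ₂] using this
    refine squeeze_zero (fun _ => dist_nonneg) (fun z => ?_) hlim
    have h := hlow z.1 (ρ z.1 z.2) (ρ d₀ x₀)
    rw [hρ₂] at h
    rw [Real.dist_eq, div_mul_eq_mul_div, le_div_iff₀ hm]
    rw [div_mul_eq_mul_div, div_le_iff₀ hM0] at h
    linarith
  -- The map `(s, s + d) ↦ (K d s, K d s + d)` of the plane commutes with both lattice translations.
  -- A shift of the first coordinate alone by `T₁` lowers the phase difference by `T₁`.
  have hK₁ : ∀ d s, K (d - T₁) (s + T₁) = K d s + T₁ := fun d s => by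
    simp only [K, hUT, hM₁]
    ring_nf
  have hK₂ : ∀ d s, K (d + T₂) s = K d s := fun d s => by
    simp only [K, ← add_assoc, hVT, hM₂]
    ring_nf
  have hρT₁ : ∀ d x, ρ (d - T₁) (x + T₁) = ρ d x + T₁ := fun d x => by
    rw [← hρ₁ (d - T₁) (ρ d x + T₁), hK₁, hρ₂]
  have hρT₂ : ∀ d x, ρ (d + T₂) x = ρ d x := fun d x => by
    rw [← hρ₁ (d + T₂) (ρ d x), hK₂, hρ₂]
  obtain ⟨F, hF⟩ := exists_torus_of_periodic
    (G := fun z : ℝ × ℝ => G (ρ (z.2 - z.1) z.1, ρ (z.2 - z.1) z.1 + (z.2 - z.1)))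
    (T₁ := T₁) (T₂ := T₂)
    (hG.comp (by
      have : Continuous fun z : ℝ × ℝ => ρ (z.2 - z.1) z.1 :=
        hρc.comp (f := fun z : ℝ × ℝ => (z.2 - z.1, z.1)) (by fun_prop)
      fun_prop))
    (fun x y => by
      simp only [← sub_sub, hρT₁, h₁]
      congr 2
      ring)
    (fun x y => by
      simp only [add_sub_right_comm, hρT₂, ← add_assoc, h₂])
  refine ⟨![1 / (M * T₁), 1 / (M * T₂)], ?_, F, fun t => ?_⟩
  · rw [LinearIndependent.pair_iff]
    intro a b hab
    simp only [Rat.smul_def] at hab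
    have hab' : (a : ℝ) * T₂ + b * T₁ = 0 := by
      field_simp at hab
      linarith
    have hb : b = 0 := by
      by_contra hb
      have hb' : (b : ℝ) ≠ 0 := by exact_mod_cast hb
      refine hr ⟨-a / b, ?_⟩
      push_cast
      field_simp
      linarith
    subst hb
    refine ⟨?_, rfl⟩
    simpa [hT₂.ne'] using hab'
  · rw [hF]
    -- On the actual orbit `d = 0`, and `V - U` at `σ t` is `t`. The linear terms cancel and the
    -- corrected coordinate is exactly `t / M`.
    have ht : ρ 0 (t / M) = σ t := by
      rw [← hρ₁ 0 (σ t)]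
      congr 1
      have h : V (σ t) - U (σ t) = t := by
        rw [← intervalIntegral.integral_sub (hv.intervalIntegrable _ _)
          (hu.intervalIntegrable _ _)]
        exact hσ t
      simp only [K, add_zero]
      have : M ≠ 0 := hM0.ne'
      field_simp
      rw [hM]
      linarith
    have e₁ : T₁ * (1 / (M * T₁) * t) = t / M := by field_simp
    have e₂ : T₂ * (1 / (M * T₂) * t) = t / M := by field_simp
    simp only [Matrix.cons_val_zero, Matrix.cons_val_one, e₁, e₂, sub_self, ht, add_zero]

/-! ### Separation of variables in elliptic coordinates. -/

/-- The quartic factor `R_a` of the quintic `(x - a) R_a(x)`, `a ∈ {1, 4}`, that governs the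
separated motion. -/
def quarticFactor (a k x : ℝ) : ℝ := 4 * x * (x - (5 - a)) * (x ^ 2 - 5 * x + k)

/-- The derivative of `quarticFactor`. -/
def quarticFactorDeriv (a k x : ℝ) : ℝ :=
  4 * ((x - (5 - a)) * (x ^ 2 - 5 * x + k) + x * (x ^ 2 - 5 * x + k) +
    x * (x - (5 - a)) * (2 * x - 5))

/-- `X` is a smooth square root of `ε (x - a)` along a solution `x` of the separated equation. -/
structure IsFactor (a ε k : ℝ) (x X X' : ℝ → ℝ) : Prop where
  eq : ∀ s, x s = a + ε * X s ^ 2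
  hasDerivAt : ∀ s, HasDerivAt X (X' s) s
  hasDerivAt_deriv : ∀ s, HasDerivAt X' (quarticFactorDeriv a k (x s) / 4 * X s) s
  sq_deriv : ∀ s, X' s ^ 2 = ε * quarticFactor a k (x s) / 4

/-- Put `w = v - u = ε Y² + X²` and let `R` be the quartic factor. In the second `t`-derivative the
terms with `X' Y'` cancel. The first integrals then leave `X Y / w³` times `w (R'(u) + R'(v)) / 4 -
(R(v) - R(u)) / 2`. This is the error of the trapezoidal rule for a quartic, namely `w³ R'''((u + v)
/ 2) / 24`, and it depends only on the two leading coefficients of `R`. -/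
theorem IsFactor.mul {a ε k : ℝ} {u v X X' Y Y' σ : ℝ → ℝ} (hε : ε = 1 ∨ ε = -1)
    (hX : IsFactor a (-1) k u X X') (hY : IsFactor a ε k v Y Y') (hw : ∀ s, u s < v s)
    (hσ : ∀ t, HasDerivAt σ (v (σ t) - u (σ t))⁻¹ t) :
    (∀ t, HasDerivAt (fun t => X (σ t) * Y (σ t))
      ((X' (σ t) * Y (σ t) + X (σ t) * Y' (σ t)) / (v (σ t) - u (σ t))) t) ∧
    ∀ t, HasDerivAt
      (fun t => (X' (σ t) * Y (σ t) + X (σ t) * Y' (σ t)) / (v (σ t) - u (σ t)))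
      ((a - 10 + 2 * u (σ t) + 2 * v (σ t)) * (X (σ t) * Y (σ t))) t := by
  have hw' : ∀ s, v s - u s ≠ 0 := fun s => (sub_pos.2 (hw s)).ne'
  refine ⟨fun t => ?_, fun t => ?_⟩
  · refine (((hX.hasDerivAt _).comp t (hσ t)).mul ((hY.hasDerivAt _).comp t (hσ t))).congr_deriv ?_
    have := hw' (σ t)
    simp only [Function.comp]
    field_simp
  · have hx := (hX.hasDerivAt _).comp t (hσ t)
    have hx' := (hX.hasDerivAt_deriv _).comp t (hσ t)
    have hy := (hY.hasDerivAt _).comp t (hσ t)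
    have hy' := (hY.hasDerivAt_deriv _).comp t (hσ t)
    have hwd : HasDerivAt (fun t => v (σ t) - u (σ t))
        ((2 * ε * Y (σ t) * Y' (σ t) + 2 * X (σ t) * X' (σ t)) * (v (σ t) - u (σ t))⁻¹) t := by
      have h := ((hy.pow 2).const_mul ε).add (hx.pow 2)
      have e : (fun t => v (σ t) - u (σ t)) =
          fun t => ε * (Y ∘ σ) t ^ 2 + (X ∘ σ) t ^ 2 := by
        funext t
        rw [hX.eq, hY.eq]
        simp only [Function.comp]
        ring
      rw [e]
      refine h.congr_deriv ?_
      simp only [Function.comp]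
      push_cast
      ring
    refine (((hx'.mul hy).add (hx.mul hy')).div hwd (hw' _)).congr_deriv ?_
    have h0 := hw' (σ t)
    simp only [Function.comp, Pi.mul_apply, Pi.add_apply]
    have hxs := hX.sq_deriv (σ t)
    have hys := hY.sq_deriv (σ t)
    have hu := hX.eq (σ t)
    have hv := hY.eq (σ t)
    generalize X (σ t) = x at *
    generalize X' (σ t) = x' at *
    generalize Y (σ t) = y at *
    generalize Y' (σ t) = y' at *
    generalize u (σ t) = U at *
    generalize v (σ t) = V at *
    rw [div_eq_iff (pow_ne_zero 2 h0)]
    field_simp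
    simp only [quarticFactor, quarticFactorDeriv] at *
    rcases hε with rfl | rfl
    · have e1 : V - U = y ^ 2 + x ^ 2 := by rw [hu, hv]; ring
      linear_combination (-8 * x * y) * hxs + 8 * x' * y' * e1 - 8 * x * y * hys
    · have e1 : V - U = x ^ 2 - y ^ 2 := by rw [hu, hv]; ring
      linear_combination (-8 * x * y) * hxs + 8 * x' * y' * e1 + 8 * x * y * hys

/-- Substituting `x = m + ρ cos ϑ` into `x'² = (ρ² - (x - m)²) h(x)` gives `ϑ'² = h(x)`, whose right
side never vanishes. Unlike `x`, the angle has no turning points. The case `ρ = 0` of a constant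
coordinate is included. -/
theorem exists_angle {m ρ : ℝ} {h h' : ℝ → ℝ} (hh : ∀ x, HasDerivAt h (h' x) x)
    (hpos : ∀ x, |x - m| ≤ |ρ| → 0 < h x) :
    ∃ ϑ : ℝ → ℝ, ϑ 0 = 0 ∧ StrictMono ϑ ∧ Function.Surjective ϑ ∧
      (∀ s, HasDerivAt ϑ √(h (m + ρ * Real.cos (ϑ s))) s) ∧
      0 < (∫ x in (0 : ℝ)..(2 * Real.pi), (√(h (m + ρ * Real.cos x)))⁻¹) ∧
      ∀ s, ϑ (s + ∫ x in (0 : ℝ)..(2 * Real.pi), (√(h (m + ρ * Real.cos x)))⁻¹) =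
        ϑ s + 2 * Real.pi := by
  have hhc : Continuous h := continuous_iff_continuousAt.2 fun x => (hh x).continuousAt
  have hA : Continuous fun x => √(h (m + ρ * Real.cos x)) := by fun_prop
  have hK : IsCompact (Set.Icc (0 : ℝ) (2 * Real.pi)) := isCompact_Icc
  have hne : (Set.Icc (0 : ℝ) (2 * Real.pi)).Nonempty := ⟨0, by simp [Real.pi_pos.le]⟩
  have hper : Function.Periodic (fun x => √(h (m + ρ * Real.cos x))) (2 * Real.pi) := fun x => by
    simp
  obtain ⟨a, -, hmin⟩ := hK.exists_isMinOn hne hA.continuousOn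
  obtain ⟨b, -, hmax⟩ := hK.exists_isMaxOn hne hA.continuousOn
  have hred : ∀ x, ∃ y ∈ Set.Icc (0 : ℝ) (2 * Real.pi),
      √(h (m + ρ * Real.cos x)) = √(h (m + ρ * Real.cos y)) := fun x => by
    obtain ⟨y, hy, hxy⟩ := hper.exists_mem_Ico₀ Real.two_pi_pos x
    exact ⟨y, Set.Ico_subset_Icc_self hy, hxy⟩
  refine exists_flow hA (m := √(h (m + ρ * Real.cos a))) (C := √(h (m + ρ * Real.cos b)))
    (Real.sqrt_pos.2 (hpos _ ?_)) (fun x => ?_) (fun x => ?_) Real.two_pi_pos hper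
  · rw [add_sub_cancel_left, abs_mul]
    exact mul_le_of_le_one_right (abs_nonneg _) (Real.abs_cos_le_one _)
  · obtain ⟨y, hy, hxy⟩ := hred x
    rw [hxy]
    exact hmin hy
  · obtain ⟨y, hy, hxy⟩ := hred x
    rw [hxy]
    exact hmax hy

theorem hasDerivAt_quarticFactor (a k x : ℝ) :
    HasDerivAt (quarticFactor a k) (quarticFactorDeriv a k x) x := by
  have h : HasDerivAt (fun x : ℝ => 4 * x * (x - (5 - a)) * (x ^ 2 - 5 * x + k)) _ x :=
    ((((hasDerivAt_id x).const_mul 4).mul ((hasDerivAt_id x).sub_const (5 - a))).mul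
      ((((hasDerivAt_id x).pow 2).sub ((hasDerivAt_id x).const_mul 5)).add_const k))
  refine h.congr_deriv ?_
  simp only [quarticFactorDeriv, id, Pi.mul_apply]
  push_cast
  ring

/-- Half-angle factor at the turning point `a = m + ρ`. -/
theorem isFactor_sin {a ε k m ρ c : ℝ} {h h' : ℝ → ℝ} {ϑ : ℝ → ℝ}
    (hh : ∀ x, HasDerivAt h (h' x) x) (hpos : ∀ x, |x - m| ≤ |ρ| → 0 < h x)
    (hϑ : ∀ s, HasDerivAt ϑ √(h (m + ρ * Real.cos (ϑ s))) s)
    (ha : a = m + ρ) (hε : ε = 1 ∨ ε = -1) (hc : ε * c ^ 2 = -2 * ρ)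
    (hR : ∀ x, quarticFactor a k x = -(x - m + ρ) * h x) :
    IsFactor a ε k (fun s => m + ρ * Real.cos (ϑ s)) (fun s => c * Real.sin (ϑ s / 2))
      (fun s => c / 2 * Real.cos (ϑ s / 2) * √(h (m + ρ * Real.cos (ϑ s)))) := by
  have hx : ∀ s, 0 < h (m + ρ * Real.cos (ϑ s)) := fun s => hpos _ (by
    rw [add_sub_cancel_left, abs_mul]
    exact mul_le_of_le_one_right (abs_nonneg _) (Real.abs_cos_le_one _))
  have hcos : ∀ s, Real.cos (ϑ s) = 1 - 2 * Real.sin (ϑ s / 2) ^ 2 := fun s => by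
    rw [← Real.cos_two_mul_eq_one_sub]
    ring_nf
  have hsin : ∀ s, Real.sin (ϑ s) = 2 * Real.sin (ϑ s / 2) * Real.cos (ϑ s / 2) := fun s => by
    rw [← Real.sin_two_mul]
    ring_nf
  -- Both sides are the derivative of the same function, by `hR` and uniqueness of derivatives.
  have hR' : ∀ x, quarticFactorDeriv a k x = -h x - (x - m + ρ) * h' x := fun x => by
    have h1 := hasDerivAt_quarticFactor a k x
    have h2 := (((hasDerivAt_id x).sub_const m).add_const ρ).neg.mul (hh x)
    have h3 := h2.congr_of_eventuallyEq (f₁ := quarticFactor a k)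
      (Filter.Eventually.of_forall hR)
    rw [h1.unique h3]
    simp
    ring
  constructor
  · intro s
    simp only [hcos, ha]
    linear_combination (-Real.sin (ϑ s / 2) ^ 2) * hc
  · intro s
    refine ((((hϑ s).div_const 2).sin).const_mul c).congr_deriv ?_
    ring
  · intro s
    have h1 := ((hϑ s).div_const 2).cos
    have h2 := ((hh (m + ρ * Real.cos (ϑ s))).comp s
      (((hϑ s).cos.const_mul ρ).const_add m)).sqrt (hx s).ne'
    refine ((h1.const_mul (c / 2)).mul h2).congr_deriv ?_
    have hsq := Real.sq_sqrt (hx s).le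
    have hs0 := (Real.sqrt_pos.2 (hx s)).ne'
    simp only [Function.comp] at *
    rw [hR', hsin s]
    generalize hq : √(h (m + ρ * Real.cos (ϑ s))) = q at *
    field_simp
    have h3 := hcos s
    have h4 := Real.sin_sq_add_cos_sq (ϑ s / 2)
    generalize Real.sin (ϑ s / 2) = S at *
    generalize Real.cos (ϑ s / 2) = C at *
    rw [← hsq]
    generalize h' _ = H
    rw [h3]
    have h5 : C ^ 2 = 1 - S ^ 2 := by linarith
    linear_combination (-8 * c * S * ρ * H) * h5
  · intro s
    have hsq := Real.sq_sqrt (hx s).le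
    rw [mul_pow, hsq, hR]
    have h3 := hcos s
    have h4 := Real.sin_sq_add_cos_sq (ϑ s / 2)
    rw [show (c / 2 * Real.cos (ϑ s / 2)) ^ 2 = c ^ 2 / 4 * (1 - Real.sin (ϑ s / 2) ^ 2) by
      rw [← h4]; ring]
    have h6 : c ^ 2 = -2 * ρ * ε := by
      rcases hε with rfl | rfl <;> linarith
    rw [h6, h3]
    ring

/-- The square root factor at a root that is not reached. -/
theorem isFactor_sqrt {a ε k : ℝ} {x d : ℝ → ℝ} (hε : ε = 1 ∨ ε = -1)
    (hpos : ∀ s, 0 < ε * (x s - a)) (hx : ∀ s, HasDerivAt x (d s) s)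
    (hd : ∀ s, HasDerivAt d
      ((quarticFactor a k (x s) + (x s - a) * quarticFactorDeriv a k (x s)) / 2) s)
    (hsq : ∀ s, d s ^ 2 = (x s - a) * quarticFactor a k (x s)) :
    IsFactor a ε k x (fun s => √(ε * (x s - a))) (fun s => ε * d s / (2 * √(ε * (x s - a)))) := by
  have h1 : ∀ s, HasDerivAt (fun s => √(ε * (x s - a))) (ε * d s / (2 * √(ε * (x s - a)))) s :=
    fun s => (((hx s).sub_const a).const_mul ε).sqrt (hpos s).ne'
  have hε2 : ε * ε = 1 := by rcases hε with rfl | rfl <;> norm_num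
  refine ⟨fun s => ?_, h1, fun s => ?_, fun s => ?_⟩
  · simp only [Real.sq_sqrt (hpos s).le]
    linear_combination (a - x s) * hε2
  · have hq := Real.sq_sqrt (hpos s).le
    have hq0 := (Real.sqrt_pos.2 (hpos s)).ne'
    refine (((hd s).const_mul ε).div ((h1 s).const_mul 2) (by positivity)).congr_deriv ?_
    generalize √(ε * (x s - a)) = q at *
    have e : x s - a = ε * q ^ 2 := by rw [hq]; linear_combination (a - x s) * hε2
    have h2 := hsq s
    rw [e] at h2 ⊢
    field_simp
    rcases hε with rfl | rfl <;> linear_combination (-4) * h2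
  · have hq := Real.sq_sqrt (hpos s).le
    have hq0 := (Real.sqrt_pos.2 (hpos s)).ne'
    generalize √(ε * (x s - a)) = q at *
    have e : x s - a = ε * q ^ 2 := by rw [hq]; linear_combination (a - x s) * hε2
    have h2 := hsq s
    rw [e] at h2
    rw [div_pow, mul_pow, h2]
    field_simp
    rcases hε with rfl | rfl <;> ring

/-- The opposite turning point is reached by shifting the angle by `π` and replacing `ρ` by `-ρ`,
which turns the half-angle sine into a cosine. -/
theorem isFactor_cos {a ε k m ρ c : ℝ} {h h' : ℝ → ℝ} {ϑ : ℝ → ℝ}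
    (hh : ∀ x, HasDerivAt h (h' x) x) (hpos : ∀ x, |x - m| ≤ |ρ| → 0 < h x)
    (hϑ : ∀ s, HasDerivAt ϑ √(h (m + ρ * Real.cos (ϑ s))) s)
    (ha : a = m - ρ) (hε : ε = 1 ∨ ε = -1) (hc : ε * c ^ 2 = 2 * ρ)
    (hR : ∀ x, quarticFactor a k x = -(x - m - ρ) * h x) :
    IsFactor a ε k (fun s => m + ρ * Real.cos (ϑ s)) (fun s => c * Real.cos (ϑ s / 2))
      (fun s => -(c / 2) * Real.sin (ϑ s / 2) * √(h (m + ρ * Real.cos (ϑ s)))) := by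
  have e : ∀ s, m + -ρ * Real.cos (ϑ s + Real.pi) = m + ρ * Real.cos (ϑ s) := fun s => by
    rw [Real.cos_add_pi]
    ring
  have e₁ : ∀ s, Real.sin ((ϑ s + Real.pi) / 2) = Real.cos (ϑ s / 2) := fun s => by
    rw [add_div, Real.sin_add_pi_div_two]
  have e₂ : ∀ s, Real.cos ((ϑ s + Real.pi) / 2) = -Real.sin (ϑ s / 2) := fun s => by
    rw [add_div, Real.cos_add_pi_div_two]
  have := isFactor_sin (a := a) (m := m) (ρ := -ρ) (ϑ := fun s => ϑ s + Real.pi) hh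
    (by simpa using hpos) (fun s => by simpa only [e] using (hϑ s).add_const Real.pi)
    (by rw [ha]; ring) hε (c := c) (by rw [hc]; ring) (by simpa [sub_eq_add_neg] using hR)
  simp only [e, e₁, e₂] at this
  convert this using 3
  ring

/-- Here the root `a` lies outside the range of the coordinate, so the ordinary square root stays
positive and is smooth. -/
theorem isFactor_sqrt_angle {a ε k m ρ : ℝ} {h h' : ℝ → ℝ} {ϑ : ℝ → ℝ}
    (hh : ∀ x, HasDerivAt h (h' x) x) (hpos : ∀ x, |x - m| ≤ |ρ| → 0 < h x)
    (hϑ : ∀ s, HasDerivAt ϑ √(h (m + ρ * Real.cos (ϑ s))) s) (hε : ε = 1 ∨ ε = -1)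
    (hεx : ∀ x, |x - m| ≤ |ρ| → 0 < ε * (x - a))
    (hR : ∀ x, (x - a) * quarticFactor a k x = (ρ ^ 2 - (x - m) ^ 2) * h x) :
    IsFactor a ε k (fun s => m + ρ * Real.cos (ϑ s))
      (fun s => √(ε * (m + ρ * Real.cos (ϑ s) - a)))
      (fun s => ε * (ρ * (-Real.sin (ϑ s) * √(h (m + ρ * Real.cos (ϑ s))))) /
        (2 * √(ε * (m + ρ * Real.cos (ϑ s) - a)))) := by
  have hmem : ∀ s, |m + ρ * Real.cos (ϑ s) - m| ≤ |ρ| := fun s => by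
    rw [add_sub_cancel_left, abs_mul]
    exact mul_le_of_le_one_right (abs_nonneg _) (Real.abs_cos_le_one _)
  have hx : ∀ s, HasDerivAt (fun s => m + ρ * Real.cos (ϑ s))
      (ρ * (-Real.sin (ϑ s) * √(h (m + ρ * Real.cos (ϑ s))))) s := fun s =>
    (((hϑ s).cos.const_mul ρ).const_add m)
  refine isFactor_sqrt hε (fun s => hεx _ (hmem s)) hx (fun s => ?_) fun s => ?_
  · have h0 := hpos _ (hmem s)
    have h2 := ((hh (m + ρ * Real.cos (ϑ s))).comp s (hx s)).sqrt h0.ne'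
    refine (((hϑ s).sin.neg.mul h2).const_mul ρ).congr_deriv ?_
    have hs0 := (Real.sqrt_pos.2 h0).ne'
    have hsq := Real.sq_sqrt h0.le
    have hd : ∀ x, quarticFactor a k x + (x - a) * quarticFactorDeriv a k x =
        -2 * (x - m) * h x + (ρ ^ 2 - (x - m) ^ 2) * h' x := fun x => by
      have h3 := ((hasDerivAt_id x).sub_const a).mul (hasDerivAt_quarticFactor a k x)
      have h4 := (((((hasDerivAt_id x).sub_const m).pow 2).const_sub (ρ ^ 2)).mul
        (hh x)).congr_of_eventuallyEq (Filter.Eventually.of_forall hR)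
      have h5 := h3.unique h4
      simp at h5
      linarith
    rw [hd]
    have h6 := Real.sin_sq_add_cos_sq (ϑ s)
    simp only [Function.comp] at *
    generalize √(h (m + ρ * Real.cos (ϑ s))) = q at *
    generalize h' _ = H at *
    rw [← hsq]
    simp
    field_simp
    have h7 : Real.sin (ϑ s) ^ 2 = 1 - Real.cos (ϑ s) ^ 2 := by linarith
    rw [h7]
    ring
  · have h0 := hpos _ (hmem s)
    rw [hR, mul_pow, mul_pow, neg_sq, Real.sq_sqrt h0.le, Real.sin_sq]
    ring

theorem exists_time_change {u v : ℝ → ℝ} {m : ℝ} (hu : Continuous u) (hv : Continuous v)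
    (hm : 0 < m) (hmw : ∀ x, m ≤ v x - u x) :
    ∃ σ : ℝ → ℝ, σ 0 = 0 ∧ StrictMono σ ∧ (∀ t, ∫ s in (0 : ℝ)..(σ t), (v s - u s) = t) ∧
      (∀ x, σ (∫ s in (0 : ℝ)..x, (v s - u s)) = x) ∧
      ∀ t, HasDerivAt σ (v (σ t) - u (σ t))⁻¹ t := by
  obtain ⟨σ, h1, h2, h3, h4⟩ := exists_inverse_of_le_deriv hm hmw
    (F := fun x => ∫ s in (0 : ℝ)..x, (v s - u s)) fun x =>
      ((hv.sub hu).integral_hasStrictDerivAt 0 x).hasDerivAt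
  exact ⟨σ, by simpa using h1 0, h3, h2, h1, h4⟩

/-- The products at the roots `1` and `4` satisfy linear equations with potentials `a - 10 + 2 u + 2
v`. The normalisations `√3` and `2 √3` make these potentials the nonlinear terms of the system. -/
theorem isSolution_of_isFactor {p k : ℝ} {u v X X' Y Y' Z Z' W W' σ : ℝ → ℝ}
    (hX : IsFactor 1 (-1) k u X X') (hY : IsFactor 1 1 k v Y Y')
    (hZ : IsFactor 4 (-1) k u Z Z') (hW : IsFactor 4 (-1) k v W W') (hw : ∀ s, u s < v s)
    (hσ : ∀ t, HasDerivAt σ (v (σ t) - u (σ t))⁻¹ t) (hσ0 : σ 0 = 0)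
    (h₁ : X 0 * Y 0 = 0) (h₂ : Z 0 * W 0 = 2 * √3 * p)
    (h₃ : X' 0 * Y 0 + X 0 * Y' 0 = 2 * √3 * p * (v 0 - u 0))
    (h₄ : Z' 0 * W 0 + Z 0 * W' 0 = 0) :
    IsSolution p (fun t => X (σ t) * Y (σ t) / √3) (fun t => Z (σ t) * W (σ t) / (2 * √3)) := by
  obtain ⟨a₁, a₂⟩ := hX.mul (Or.inl rfl) hY hw hσ
  obtain ⟨b₁, b₂⟩ := hZ.mul (Or.inr rfl) hW hw hσ
  have h3 : √3 ^ 2 = (3 : ℝ) := Real.sq_sqrt (by norm_num)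
  have h30 : √3 ≠ (0 : ℝ) := by positivity
  have hw0 : v 0 - u 0 ≠ 0 := (sub_pos.2 (hw 0)).ne'
  have d₁ := fun t => (a₁ t).div_const √3
  have d₂ := fun t => (b₁ t).div_const (2 * √3)
  -- The `u v` terms of `(1 - u)(v - 1)` and `(4 - u)(4 - v)` cancel, so `φ₁² + 4 φ₂² = 5 - u - v`.
  -- This closes the system.
  have hN : ∀ s, 2 * (X s * Y s / √3) ^ 2 + 8 * (Z s * W s / (2 * √3)) ^ 2 =
      2 * (5 - u s - v s) := fun s => by
    have e1 := hX.eq s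
    have e2 := hY.eq s
    have e3 := hZ.eq s
    have e4 := hW.eq s
    have e5 : X s ^ 2 = 1 - u s := by linarith
    have e6 : Y s ^ 2 = v s - 1 := by linarith
    have e7 : Z s ^ 2 = 4 - u s := by linarith
    have e8 : W s ^ 2 = 4 - v s := by linarith
    simp only [div_pow, mul_pow, h3, e5, e6, e7, e8]
    ring
  refine ⟨fun t => (d₁ t).differentiableAt, fun t => (d₂ t).differentiableAt, fun t => ?_,
    fun t => ?_, ?_, ?_, ?_, ?_⟩
  · rw [show deriv _ = _ from funext fun t => (d₁ t).deriv]
    refine ((a₂ t).div_const √3).congr_deriv ?_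
    rw [sub_sub, hN]
    ring
  · rw [show deriv _ = _ from funext fun t => (d₂ t).deriv]
    refine ((b₂ t).div_const (2 * √3)).congr_deriv ?_
    rw [sub_sub, hN]
    ring
  · simp [hσ0, h₁]
  · simp only [hσ0, h₂]
    field_simp
  · rw [(d₁ 0).deriv, hσ0, h₃]
    field_simp
  · rw [(d₂ 0).deriv, hσ0, h₄]
    simp

/-- The vector field is polynomial, hence Lipschitz on a ball that contains both trajectories over a
given bounded interval. Uniqueness transfers the properties of the explicit solutions to an
arbitrary one. -/
theorem IsSolution.unique {p : ℝ} {φ₁ φ₂ ψ₁ ψ₂ : ℝ → ℝ} (hφ : IsSolution p φ₁ φ₂)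
    (hψ : IsSolution p ψ₁ ψ₂) : φ₁ = ψ₁ ∧ φ₂ = ψ₂ := by
  let V : ℝ × ℝ × ℝ × ℝ → ℝ × ℝ × ℝ × ℝ := fun z =>
    (z.2.2.1, z.2.2.2, (1 - 2 * z.1 ^ 2 - 8 * z.2.1 ^ 2) * z.1,
      (4 - 2 * z.1 ^ 2 - 8 * z.2.1 ^ 2) * z.2.1)
  have hV : ContDiff ℝ 1 V := by
    fun_prop
  let lift : (ℝ → ℝ) → (ℝ → ℝ) → ℝ → ℝ × ℝ × ℝ × ℝ := fun f g t => (f t, g t, deriv f t, deriv g t)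
  have hlift : ∀ f g, IsSolution p f g → ∀ t, HasDerivAt (lift f g) (V (lift f g t)) t :=
    fun f g h t => (h.differentiable_fst t).hasDerivAt.prodMk
      ((h.differentiable_snd t).hasDerivAt.prodMk ((h.eq_fst t).prodMk (h.eq_snd t)))
  have hcont : ∀ f g, IsSolution p f g → Continuous (lift f g) := fun f g h =>
    continuous_iff_continuousAt.2 fun t => (hlift f g h t).continuousAt
  have key : lift φ₁ φ₂ = lift ψ₁ ψ₂ := by
    funext t
    obtain ⟨A, hA, hA0⟩ : ∃ A, t ∈ Set.Ioo (-A) A ∧ (0 : ℝ) ∈ Set.Ioo (-A) A :=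
      ⟨|t| + 1, ⟨by linarith [neg_abs_le t], by linarith [le_abs_self t]⟩,
        by constructor <;> linarith [abs_nonneg t]⟩
    have hb := ((isCompact_Icc (a := -A) (b := A)).image (hcont _ _ hφ)).isBounded.union
      ((isCompact_Icc (a := -A) (b := A)).image (hcont _ _ hψ)).isBounded
    obtain ⟨R, hR⟩ := hb.subset_closedBall 0
    obtain ⟨K, hK⟩ := hV.contDiffOn.exists_lipschitzOnWith one_ne_zero
      (convex_closedBall (0 : ℝ × ℝ × ℝ × ℝ) R) (isCompact_closedBall _ _)
    refine ODE_solution_unique_of_mem_Ioo (v := fun _ => V) (K := K)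
      (s := fun _ => Metric.closedBall 0 R) (fun _ _ => hK) hA0
      (fun s hs => ⟨hlift _ _ hφ s, hR (Or.inl ⟨s, Set.Ioo_subset_Icc_self hs, rfl⟩)⟩)
      (fun s hs => ⟨hlift _ _ hψ s, hR (Or.inr ⟨s, Set.Ioo_subset_Icc_self hs, rfl⟩)⟩) ?_ hA
    simp only [lift, hφ.fst_zero, hφ.snd_zero, hφ.deriv_fst_zero, hφ.deriv_snd_zero,
      hψ.fst_zero, hψ.snd_zero, hψ.deriv_fst_zero, hψ.deriv_snd_zero]
  exact ⟨funext fun t => congrArg Prod.fst (congrFun key t),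
    funext fun t => congrArg (fun z => z.2.1) (congrFun key t)⟩

/-! ### Explicit solutions below, above and at the homoclinic value. -/

/-- The factor `h` in `u'² = u (1 - u) h(u)`. -/
def angularU (p x : ℝ) : ℝ := 4 * (4 - x) * (x ^ 2 - 5 * x + (4 - 4 * p ^ 2) * (4 * p ^ 2 + 1))

/-- The factor `h` in `v'² = (v - α) (β - v) h(v)`. -/
def angularV (x : ℝ) : ℝ := 4 * x * (x - 1) * (4 - x)

/-- The period of the coordinate `u`. -/
noncomputable def angleTimeU (p : ℝ) : ℝ :=
  ∫ x in (0 : ℝ)..(2 * Real.pi), (√(angularU p (1 / 2 + 1 / 2 * Real.cos x)))⁻¹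

/-- The period of the coordinate `v`. -/
noncomputable def angleTimeV (p : ℝ) : ℝ :=
  ∫ x in (0 : ℝ)..(2 * Real.pi), (√(angularV (5 / 2 + (3 / 2 - 4 * p ^ 2) * Real.cos x)))⁻¹

theorem hasDerivAt_angularU (p x : ℝ) : HasDerivAt (angularU p)
    (4 * (-(x ^ 2 - 5 * x + (4 - 4 * p ^ 2) * (4 * p ^ 2 + 1)) + (4 - x) * (2 * x - 5))) x := by
  have h : HasDerivAt (fun x : ℝ => 4 * (4 - x) * (x ^ 2 - 5 * x + (4 - 4 * p ^ 2) * (4 * p ^ 2 + 1))) _ x :=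
    ((((hasDerivAt_id x).const_sub 4).const_mul 4).mul
      ((((hasDerivAt_id x).pow 2).sub ((hasDerivAt_id x).const_mul 5)).add_const _))
  refine h.congr_deriv ?_
  simp
  ring

theorem hasDerivAt_angularV (x : ℝ) : HasDerivAt angularV
    (4 * ((x - 1) * (4 - x) + x * (4 - x) - x * (x - 1))) x := by
  have h : HasDerivAt (fun x : ℝ => 4 * x * (x - 1) * (4 - x)) _ x :=
    ((((hasDerivAt_id x).const_mul 4).mul ((hasDerivAt_id x).sub_const 1)).mul
      ((hasDerivAt_id x).const_sub 4))
  refine h.congr_deriv ?_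
  simp
  ring

theorem angularU_pos {p x : ℝ} (hp : 0 < p) (hp' : p ^ 2 < 3 / 4) (hx : x ≤ 1) :
    0 < angularU p x := by
  have : 0 < p ^ 2 := by positivity
  have h : x ^ 2 - 5 * x + (4 - 4 * p ^ 2) * (4 * p ^ 2 + 1) =
      (4 - 4 * p ^ 2 - x) * (4 * p ^ 2 + 1 - x) := by ring
  rw [angularU, h]
  have h1 : 0 < 4 - x := by linarith
  have h2 : 0 < 4 - 4 * p ^ 2 - x := by linarith
  have h3 : 0 < 4 * p ^ 2 + 1 - x := by linarith
  positivity

theorem angularV_pos {x : ℝ} (h1 : 1 < x) (h4 : x < 4) : 0 < angularV x := by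
  have h2 : 0 < 4 - x := by linarith
  have h3 : 0 < x - 1 := by linarith
  have h5 : 0 < x := by linarith
  rw [angularV]
  positivity

/-- Below the homoclinic value the solution is given by two angles. -/
theorem exists_angles_of_lt {p : ℝ} (hp : 0 < p) (hp' : p ^ 2 < 3 / 4) :
    ∃ ϑ χ σ : ℝ → ℝ,
      (ϑ 0 = 0 ∧ StrictMono ϑ ∧ Function.Surjective ϑ ∧ Continuous ϑ ∧ 0 < angleTimeU p ∧
        ∀ s, ϑ (s + angleTimeU p) = ϑ s + 2 * Real.pi) ∧
      (χ 0 = 0 ∧ StrictMono χ ∧ Function.Surjective χ ∧ Continuous χ ∧ 0 < angleTimeV p ∧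
        ∀ s, χ (s + angleTimeV p) = χ s + 2 * Real.pi) ∧
      (σ 0 = 0 ∧ StrictMono σ ∧
        (∀ t, ∫ s in (0 : ℝ)..(σ t), (5 / 2 + (3 / 2 - 4 * p ^ 2) * Real.cos (χ s) -
          (1 / 2 + 1 / 2 * Real.cos (ϑ s))) = t) ∧
        (∀ x, σ (∫ s in (0 : ℝ)..x, (5 / 2 + (3 / 2 - 4 * p ^ 2) * Real.cos (χ s) -
          (1 / 2 + 1 / 2 * Real.cos (ϑ s)))) = x)) ∧
      IsSolution p
        (fun t => Real.sin (ϑ (σ t) / 2) *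
          √(5 / 2 + (3 / 2 - 4 * p ^ 2) * Real.cos (χ (σ t)) - 1) / √3)
        (fun t => √(4 - (1 / 2 + 1 / 2 * Real.cos (ϑ (σ t)))) *
          √(4 - (5 / 2 + (3 / 2 - 4 * p ^ 2) * Real.cos (χ (σ t)))) / (2 * √3)) := by
  have hp0 : 0 < p ^ 2 := by positivity
  have hρ : |3 / 2 - 4 * p ^ 2| < 3 / 2 := by rw [abs_lt]; constructor <;> linarith
  have hU : ∀ x, |x - 1 / 2| ≤ |(1 / 2 : ℝ)| → 0 < angularU p x := fun x hx => by
    rw [abs_of_pos (by norm_num : (0 : ℝ) < 1 / 2), abs_le] at hx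
    exact angularU_pos hp hp' (by linarith [hx.2])
  have hVm : ∀ x, |x - 5 / 2| ≤ |3 / 2 - 4 * p ^ 2| → 1 < x ∧ x < 4 := fun x hx => by
    have := abs_lt.1 (hx.trans_lt hρ)
    constructor <;> linarith [this.1, this.2]
  have hV : ∀ x, |x - 5 / 2| ≤ |3 / 2 - 4 * p ^ 2| → 0 < angularV x := fun x hx =>
    angularV_pos (hVm x hx).1 (hVm x hx).2
  obtain ⟨ϑ, t1, t2, t3, t4, t5, t6⟩ := exists_angle (hasDerivAt_angularU p) hU
  obtain ⟨χ, c1, c2, c3, c4, c5, c6⟩ := exists_angle hasDerivAt_angularV hV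
  have hϑc : Continuous ϑ := continuous_iff_continuousAt.2 fun x => (t4 x).continuousAt
  have hχc : Continuous χ := continuous_iff_continuousAt.2 fun x => (c4 x).continuousAt
  have hcos : ∀ x, |(3 / 2 - 4 * p ^ 2) * Real.cos x| ≤ |3 / 2 - 4 * p ^ 2| := fun x => by
    rw [abs_mul]
    exact mul_le_of_le_one_right (abs_nonneg _) (Real.abs_cos_le_one _)
  have hw : ∀ s, 3 / 2 - |3 / 2 - 4 * p ^ 2| ≤ 5 / 2 + (3 / 2 - 4 * p ^ 2) * Real.cos (χ s) -
      (1 / 2 + 1 / 2 * Real.cos (ϑ s)) := fun s => by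
    have h1 := (abs_le.1 (hcos (χ s))).1
    have h2 := Real.cos_le_one (ϑ s)
    linarith
  obtain ⟨σ, s1, s2, s3, s4, s5⟩ := exists_time_change
    (u := fun s => 1 / 2 + 1 / 2 * Real.cos (ϑ s))
    (v := fun s => 5 / 2 + (3 / 2 - 4 * p ^ 2) * Real.cos (χ s)) (by fun_prop) (by fun_prop)
    (sub_pos.2 hρ) hw
  refine ⟨ϑ, χ, σ, ⟨t1, t2, t3, hϑc, t5, t6⟩, ⟨c1, c2, c3, hχc, c5, c6⟩, ⟨s1, s2, s3, s4⟩, ?_⟩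
  have hX := isFactor_sin (a := 1) (ε := -1) (k := (4 - 4 * p ^ 2) * (4 * p ^ 2 + 1)) (c := 1)
    (hasDerivAt_angularU p) hU t4 (by norm_num) (Or.inr rfl) (by norm_num) fun x => by
      simp only [quarticFactor, angularU]
      ring
  have hZ := isFactor_sqrt_angle (a := 4) (ε := -1) (k := (4 - 4 * p ^ 2) * (4 * p ^ 2 + 1))
    (hasDerivAt_angularU p) hU t4 (Or.inr rfl) (fun x hx => by
      rw [abs_of_pos (by norm_num : (0 : ℝ) < 1 / 2), abs_le] at hx
      linarith [hx.2]) fun x => by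
      simp only [quarticFactor, angularU]
      ring
  have hY := isFactor_sqrt_angle (a := 1) (ε := 1) (k := (4 - 4 * p ^ 2) * (4 * p ^ 2 + 1))
    hasDerivAt_angularV hV c4 (Or.inl rfl) (fun x hx => by
      linarith [(hVm x hx).1]) fun x => by
      simp only [quarticFactor, angularV]
      ring
  have hW := isFactor_sqrt_angle (a := 4) (ε := -1) (k := (4 - 4 * p ^ 2) * (4 * p ^ 2 + 1))
    hasDerivAt_angularV hV c4 (Or.inr rfl) (fun x hx => by
      linarith [(hVm x hx).2]) fun x => by
      simp only [quarticFactor, angularV]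
      ring
  have e₁ : √(angularU p (1 / 2 + 1 / 2 * 1)) * √(5 / 2 + (3 / 2 - 4 * p ^ 2) * 1 - 1) =
      4 * √3 * p * (5 / 2 + (3 / 2 - 4 * p ^ 2) - 1) := by
    have h1 : (5 / 2 + (3 / 2 - 4 * p ^ 2) * 1 - 1) = 3 - 4 * p ^ 2 := by ring
    rw [h1, show angularU p (1 / 2 + 1 / 2 * 1) = (4 * p) ^ 2 * 3 * (3 - 4 * p ^ 2) by
      simp only [angularU]; ring, Real.sqrt_mul (by positivity), Real.sqrt_mul (by positivity),
      Real.sqrt_sq (by positivity), mul_assoc, Real.mul_self_sqrt (by linarith)]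
    ring
  have e₂ : √3 * √(4 * p ^ 2) = 2 * √3 * p := by
    rw [show 4 * p ^ 2 = (2 * p) ^ 2 by ring, Real.sqrt_sq (by positivity)]
    ring
  have hsol := isSolution_of_isFactor (p := p) hX hY hZ hW
    (fun s => sub_pos.1 ((sub_pos.2 hρ).trans_le (hw s))) s5 s1 (by simp [t1])
    (by
      simp only [t1, c1, Real.cos_zero]
      rw [← e₂]
      congr 2 <;> ring)
    (by
      simp only [t1, c1, Real.cos_zero, zero_div, Real.sin_zero, one_mul, mul_zero, zero_mul,
        add_zero, mul_one] at e₁ ⊢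
      rw [mul_assoc, e₁]
      ring)
    (by simp [t1, c1])
  convert hsol using 2 with t t
  · simp
  · congr 3 <;> ring

theorem time_change_dichotomy {E : Type*} [TopologicalSpace E] {G : ℝ × ℝ → E}
    {u v σ : ℝ → ℝ} {T₁ T₂ m : ℝ} (hG : Continuous G)
    (h₁ : ∀ x y, G (x + T₁, y) = G (x, y)) (h₂ : ∀ x y, G (x, y + T₂) = G (x, y))
    (hT₁ : 0 < T₁) (hT₂ : 0 < T₂) (hu : Continuous u) (hv : Continuous v)
    (hu' : Function.Periodic u T₁) (hv' : Function.Periodic v T₂) (hm : 0 < m)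
    (hmw : ∀ x y, m ≤ v y - u x)
    (hσ : ∀ t, ∫ s in (0 : ℝ)..(σ t), (v s - u s) = t)
    (hσ' : ∀ x, σ (∫ s in (0 : ℝ)..x, (v s - u s)) = x) :
    ((∃ r : ℚ, T₁ = r * T₂) → IsPeriodic fun t => G (σ t, σ t)) ∧
      ((¬ ∃ r : ℚ, T₁ = r * T₂) → IsQuasiPeriodic fun t => G (σ t, σ t)) :=
  ⟨isPeriodic_time_change h₁ h₂ hT₁ hT₂ (hv.sub hu) hm (fun x => hmw x x)
    (fun n k hnk x => by
      have i₁ := hu'.nat_mul n x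
      have i₂ := hv'.nat_mul k x
      change v _ - u _ = v x - u x
      rw [i₁, hnk, i₂]) hσ hσ',
    isQuasiPeriodic_time_change hG h₁ h₂ hT₁ hT₂ hu hv hu' hv' hm hmw hσ⟩

/-- Above the homoclinic value the solution is periodic or quasi-periodic, and its second component
vanishes somewhere. -/
theorem exists_solution_of_gt {p : ℝ} (hp : 0 < p) (hp' : 3 / 4 < p ^ 2) (hp1 : p ≤ 1) :
    ∃ φ₁ φ₂, IsSolution p φ₁ φ₂ ∧
      (IsPeriodic (pairFun φ₁ φ₂) ∨ IsQuasiPeriodic (pairFun φ₁ φ₂)) ∧ ∃ y, φ₂ y = 0 := by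
  have hp2 : p ^ 2 ≤ 1 := by nlinarith
  have hUd : ∀ x, HasDerivAt (fun x => 4 * (1 - x) * (4 - x) * (4 * p ^ 2 + 1 - x))
      (-4 * ((4 - x) * (4 * p ^ 2 + 1 - x) + (1 - x) * (4 * p ^ 2 + 1 - x) +
        (1 - x) * (4 - x))) x := fun x => by
    have h := ((((hasDerivAt_id x).const_sub 1).const_mul 4).mul
      ((hasDerivAt_id x).const_sub 4)).mul ((hasDerivAt_id x).const_sub (4 * p ^ 2 + 1))
    refine HasDerivAt.congr_deriv (f := fun x => 4 * (1 - x) * (4 - x) * (4 * p ^ 2 + 1 - x)) h ?_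
    simp
    ring
  have hVd : ∀ x, HasDerivAt
      (fun x => 4 * x * (x - (4 - 4 * p ^ 2)) * (4 * p ^ 2 + 1 - x))
      (4 * ((x - (4 - 4 * p ^ 2)) * (4 * p ^ 2 + 1 - x) + x * (4 * p ^ 2 + 1 - x) -
        x * (x - (4 - 4 * p ^ 2)))) x := fun x => by
    have h := (((hasDerivAt_id x).const_mul 4).mul
      ((hasDerivAt_id x).sub_const (4 - 4 * p ^ 2))).mul
        ((hasDerivAt_id x).const_sub (4 * p ^ 2 + 1))
    refine HasDerivAt.congr_deriv
      (f := fun x => 4 * x * (x - (4 - 4 * p ^ 2)) * (4 * p ^ 2 + 1 - x)) h ?_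
    simp
    ring
  -- Now `4 - 4p² < 1` and `4p² + 1 > 4`, so `u` oscillates in `[0, 4 - 4p²]` and `v` in `[1, 4]`.
  -- For `p = 1` the first interval is a point.
  have hUm : ∀ x, |x - (2 - 2 * p ^ 2)| ≤ |2 - 2 * p ^ 2| → x ≤ 4 - 4 * p ^ 2 := fun x hx => by
    rw [abs_of_nonneg (by linarith : 0 ≤ 2 - 2 * p ^ 2), abs_le] at hx
    linarith [hx.2]
  have hVm : ∀ x, |x - 5 / 2| ≤ |(-(3 / 2) : ℝ)| → 1 ≤ x ∧ x ≤ 4 := fun x hx => by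
    rw [abs_of_neg (by norm_num : (-(3 / 2) : ℝ) < 0), abs_le] at hx
    constructor <;> linarith [hx.1, hx.2]
  have hU : ∀ x, |x - (2 - 2 * p ^ 2)| ≤ |2 - 2 * p ^ 2| →
      0 < 4 * (1 - x) * (4 - x) * (4 * p ^ 2 + 1 - x) := fun x hx => by
    have := hUm x hx
    have h1 : 0 < 1 - x := by linarith
    have h2 : 0 < 4 - x := by linarith
    have h3 : 0 < 4 * p ^ 2 + 1 - x := by linarith
    positivity
  have hV : ∀ x, |x - 5 / 2| ≤ |(-(3 / 2) : ℝ)| →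
      0 < 4 * x * (x - (4 - 4 * p ^ 2)) * (4 * p ^ 2 + 1 - x) := fun x hx => by
    have := hVm x hx
    have h1 : 0 < x - (4 - 4 * p ^ 2) := by linarith
    have h2 : 0 < x := by linarith
    have h3 : 0 < 4 * p ^ 2 + 1 - x := by linarith
    positivity
  obtain ⟨ϑ, t1, t2, t3, t4, t5, t6⟩ := exists_angle hUd hU
  obtain ⟨χ, c1, c2, c3, c4, c5, c6⟩ := exists_angle hVd hV
  generalize (∫ x in (0 : ℝ)..(2 * Real.pi), (_ : ℝ)) = Tu at t5 t6
  generalize (∫ x in (0 : ℝ)..(2 * Real.pi), (_ : ℝ)) = Tv at c5 c6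
  have hϑc : Continuous ϑ := continuous_iff_continuousAt.2 fun x => (t4 x).continuousAt
  have hχc : Continuous χ := continuous_iff_continuousAt.2 fun x => (c4 x).continuousAt
  have hmemu : ∀ s, |2 - 2 * p ^ 2 + (2 - 2 * p ^ 2) * Real.cos s - (2 - 2 * p ^ 2)| ≤
      |2 - 2 * p ^ 2| := fun s => by
    rw [add_sub_cancel_left, abs_mul]
    exact mul_le_of_le_one_right (abs_nonneg _) (Real.abs_cos_le_one _)
  have hmemv : ∀ s, |5 / 2 + -(3 / 2) * Real.cos s - 5 / 2| ≤ |(-(3 / 2) : ℝ)| := fun s => by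
    rw [add_sub_cancel_left, abs_mul]
    exact mul_le_of_le_one_right (abs_nonneg _) (Real.abs_cos_le_one _)
  have hm : 0 < 4 * p ^ 2 - 3 := by linarith
  have hw : ∀ s r, 4 * p ^ 2 - 3 ≤ 5 / 2 + -(3 / 2) * Real.cos (χ r) -
      (2 - 2 * p ^ 2 + (2 - 2 * p ^ 2) * Real.cos (ϑ s)) := fun s r => by
    linarith [hUm _ (hmemu (ϑ s)), (hVm _ (hmemv (χ r))).1]
  -- The amplitude `-3/2` of `v` is taken negative so that the motion starts at `v = 1`, where `φ₁ =
  -- 0`, with both angles equal to `0`.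
  obtain ⟨σ, s1, s2, s3, s4, s5⟩ := exists_time_change
    (u := fun s => 2 - 2 * p ^ 2 + (2 - 2 * p ^ 2) * Real.cos (ϑ s))
    (v := fun s => 5 / 2 + -(3 / 2) * Real.cos (χ s)) (by fun_prop) (by fun_prop)
    hm fun s => hw s s
  have hs3 : √3 ^ 2 = (3 : ℝ) := Real.sq_sqrt (by norm_num)
  have hX := isFactor_sqrt_angle (a := 1) (ε := -1) (k := (4 - 4 * p ^ 2) * (4 * p ^ 2 + 1))
    hUd hU t4 (Or.inr rfl) (fun x hx => by linarith [hUm x hx]) fun x => by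
      simp only [quarticFactor]
      ring
  have hZ := isFactor_sqrt_angle (a := 4) (ε := -1) (k := (4 - 4 * p ^ 2) * (4 * p ^ 2 + 1))
    hUd hU t4 (Or.inr rfl) (fun x hx => by linarith [hUm x hx]) fun x => by
      simp only [quarticFactor]
      ring
  have hY := isFactor_sin (a := 1) (ε := 1) (k := (4 - 4 * p ^ 2) * (4 * p ^ 2 + 1)) (c := √3)
    hVd hV c4 (by norm_num) (Or.inl rfl) (by rw [hs3]; norm_num) fun x => by
      simp only [quarticFactor]
      ring
  have hW := isFactor_cos (a := 4) (ε := -1) (k := (4 - 4 * p ^ 2) * (4 * p ^ 2 + 1)) (c := √3)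
    hVd hV c4 (by norm_num) (Or.inr rfl) (by rw [hs3]; norm_num) fun x => by
      simp only [quarticFactor]
      ring
  have e₁ : √(4 * p ^ 2 - 3) * √(4 * (4 * p ^ 2 - 3) * (4 * p ^ 2)) =
      4 * p * (4 * p ^ 2 - 3) := by
    rw [show 4 * (4 * p ^ 2 - 3) * (4 * p ^ 2) = (4 * p ^ 2 - 3) * (4 * p) ^ 2 by ring,
      Real.sqrt_mul hm.le, Real.sqrt_sq (by positivity), ← mul_assoc, Real.mul_self_sqrt hm.le]
    ring
  have hsol := isSolution_of_isFactor (p := p) hX hY hZ hW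
    (fun s => sub_pos.1 (hm.trans_le (hw s s))) s5 s1 (by simp [c1])
    (by
      simp only [t1, c1, Real.cos_zero, zero_div]
      rw [show (-1 * (2 - 2 * p ^ 2 + (2 - 2 * p ^ 2) * 1 - 4)) = (2 * p) ^ 2 by ring,
        Real.sqrt_sq (by positivity)]
      ring)
    (by
      simp only [t1, c1, Real.cos_zero, zero_div, Real.sin_zero, mul_zero, mul_one, zero_add]
      rw [show (-1 * (2 - 2 * p ^ 2 + (2 - 2 * p ^ 2) - 1)) = 4 * p ^ 2 - 3 by ring,
        show 4 * (5 / 2 + -(3 / 2)) * (5 / 2 + -(3 / 2) - (4 - 4 * p ^ 2)) *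
          (4 * p ^ 2 + 1 - (5 / 2 + -(3 / 2))) = 4 * (4 * p ^ 2 - 3) * (4 * p ^ 2) by ring,
        show 5 / 2 + -(3 / 2) - (2 - 2 * p ^ 2 + (2 - 2 * p ^ 2)) = 4 * p ^ 2 - 3 by ring]
      linear_combination (√3 / 2) * e₁)
    (by simp [t1, c1])
  refine ⟨_, _, hsol, ?_, ?_⟩
  -- The half angle `χ / 2` enters both components, so the period in the second variable is that of
  -- two full turns of `χ`.
  · obtain ⟨d₁, d₂⟩ := time_change_dichotomy (σ := σ) (T₁ := Tu) (T₂ := 2 * Tv)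
      (u := fun s => 2 - 2 * p ^ 2 + (2 - 2 * p ^ 2) * Real.cos (ϑ s))
      (v := fun s => 5 / 2 + -(3 / 2) * Real.cos (χ s))
      (G := fun z : ℝ × ℝ => (√(-1 * (2 - 2 * p ^ 2 + (2 - 2 * p ^ 2) * Real.cos (ϑ z.1) - 1)) *
        (√3 * Real.sin (χ z.2 / 2)) / √3,
        √(-1 * (2 - 2 * p ^ 2 + (2 - 2 * p ^ 2) * Real.cos (ϑ z.1) - 4)) *
          (√3 * Real.cos (χ z.2 / 2)) / (2 * √3)))
      (by fun_prop) (fun x y => by simp [t6])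
      (fun x y => by
        have h : χ (y + 2 * Tv) / 2 = χ y / 2 + 2 * Real.pi := by
          rw [two_mul, ← add_assoc, c6, c6]
          ring
        simp [h])
      t5 (by positivity) (by fun_prop) (by fun_prop) (fun x => by simp [t6])
      (fun x => by simp only [two_mul Tv, ← add_assoc, c6, Real.cos_add_two_pi]) hm hw s3 s4
    by_cases hr : ∃ r : ℚ, Tu = r * (2 * Tv)
    · exact Or.inl (d₁ hr)
    · exact Or.inr (d₂ hr)
  -- When `χ = π` the coordinate `v` reaches `4`, and the factor `cos (χ / 2)` of `φ₂` vanishes.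
  · obtain ⟨x, hx⟩ := c3 Real.pi
    obtain ⟨y, hy⟩ : ∃ y, σ y = x := ⟨_, s4 x⟩
    exact ⟨y, by simp [hy, hx]⟩

/-- At the homoclinic value the solution is a two-soliton. -/
theorem isSolution_soliton : IsSolution (√3 / 2)
    (fun t => √3 * Real.sinh t / Real.cosh t ^ 2) (fun t => √3 / 2 / Real.cosh t ^ 2) := by
  have hs3 : √3 ^ 2 = (3 : ℝ) := Real.sq_sqrt (by norm_num)
  have hc : ∀ t, Real.cosh t ≠ 0 := fun t => (Real.cosh_pos t).ne'
  have d₁ : ∀ t, HasDerivAt (fun t => √3 * Real.sinh t / Real.cosh t ^ 2)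
      (√3 * (2 - Real.cosh t ^ 2) / Real.cosh t ^ 3) t := fun t => by
    refine (((Real.hasDerivAt_sinh t).const_mul √3).div ((Real.hasDerivAt_cosh t).pow 2)
      (pow_ne_zero 2 (hc t))).congr_deriv ?_
    have h := Real.cosh_sq t
    have h0 := hc t
    simp
    field_simp
    linear_combination 2 * h
  have d₁' : ∀ t, HasDerivAt (fun t => √3 * (2 - Real.cosh t ^ 2) / Real.cosh t ^ 3)
      (√3 * Real.sinh t * (Real.cosh t ^ 2 - 6) / Real.cosh t ^ 4) t := fun t => by
    refine (((((Real.hasDerivAt_cosh t).pow 2).const_sub 2).const_mul √3).div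
      ((Real.hasDerivAt_cosh t).pow 3) (pow_ne_zero 3 (hc t))).congr_deriv ?_
    have h0 := hc t
    simp
    field_simp
    ring
  have d₂ : ∀ t, HasDerivAt (fun t => √3 / 2 / Real.cosh t ^ 2)
      (-√3 * Real.sinh t / Real.cosh t ^ 3) t := fun t => by
    refine ((hasDerivAt_const t (√3 / 2)).div ((Real.hasDerivAt_cosh t).pow 2)
      (pow_ne_zero 2 (hc t))).congr_deriv ?_
    have h0 := hc t
    simp
    field_simp
  have d₂' : ∀ t, HasDerivAt (fun t => -√3 * Real.sinh t / Real.cosh t ^ 3)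
      (√3 * (2 * Real.cosh t ^ 2 - 3) / Real.cosh t ^ 4) t := fun t => by
    refine (((Real.hasDerivAt_sinh t).const_mul (-√3)).div
      ((Real.hasDerivAt_cosh t).pow 3) (pow_ne_zero 3 (hc t))).congr_deriv ?_
    have h := Real.cosh_sq t
    have h0 := hc t
    simp
    field_simp
    linear_combination (-3) * h
  refine ⟨fun t => (d₁ t).differentiableAt, fun t => (d₂ t).differentiableAt, fun t => ?_,
    fun t => ?_, by simp, by simp, ?_, ?_⟩
  · rw [show deriv _ = _ from funext fun t => (d₁ t).deriv]
    refine (d₁' t).congr_deriv ?_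
    have h := Real.cosh_sq t
    have h0 := hc t
    simp only [div_pow, mul_pow, hs3]
    field_simp
    linear_combination (-24 * Real.sinh t) * h
  · rw [show deriv _ = _ from funext fun t => (d₂ t).deriv]
    refine (d₂' t).congr_deriv ?_
    have h := Real.cosh_sq t
    have h0 := hc t
    simp only [div_pow, mul_pow, hs3]
    field_simp
    linear_combination (-24) * h
  · rw [(d₁ 0).deriv]
    simp
    ring
  · rw [(d₂ 0).deriv]
    simp

theorem soliton_tendsto : Filter.Tendsto (pairFun (fun t => √3 * Real.sinh t / Real.cosh t ^ 2)
    (fun t => √3 / 2 / Real.cosh t ^ 2)) Filter.atTop (nhds (0, 0)) := by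
  have hcosh : Filter.Tendsto Real.cosh Filter.atTop Filter.atTop := by
    refine Filter.tendsto_atTop_mono (fun x => ?_) (Real.tendsto_exp_atTop.atTop_div_const two_pos)
    rw [Real.cosh_eq]
    have := Real.exp_pos (-x)
    linarith
  have hinv := hcosh.inv_tendsto_atTop
  have h2 : Filter.Tendsto (fun t => √3 / 2 / Real.cosh t ^ 2) Filter.atTop (nhds 0) := by
    have := (hinv.pow 2).const_mul (√3 / 2)
    simpa [div_eq_mul_inv] using this
  refine Filter.Tendsto.prodMk_nhds ?_ h2
  have h3 := hinv.const_mul √3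
  rw [mul_zero] at h3
  refine squeeze_zero_norm (fun t => ?_) h3
  have h0 := Real.cosh_pos t
  have h4 : |Real.sinh t| ≤ Real.cosh t := by
    refine abs_le_of_sq_le_sq ?_ h0.le
    linarith [Real.cosh_sq t]
  rw [Real.norm_eq_abs, abs_div, abs_mul, abs_of_nonneg (Real.sqrt_nonneg 3),
    abs_of_pos (pow_pos h0 2), Pi.inv_apply, ← div_eq_mul_inv, div_le_div_iff₀ (by positivity) h0]
  nlinarith [mul_le_mul_of_nonneg_left h4 (mul_nonneg (Real.sqrt_nonneg 3) h0.le)]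

/-- A periodic function that converges at infinity is constant. -/
theorem eq_of_isPeriodic_of_tendsto {E : Type*} [TopologicalSpace E] [T2Space E] {f : ℝ → E} {l : E}
    (hf : IsPeriodic f) (hl : Filter.Tendsto f Filter.atTop (nhds l)) (x : ℝ) : f x = l := by
  obtain ⟨T, hT, hper⟩ := hf
  have h1 : Filter.Tendsto (fun n : ℕ => x + n * T) Filter.atTop Filter.atTop :=
    Filter.tendsto_atTop_add_const_left _ _ (tendsto_natCast_atTop_atTop.atTop_mul_const hT)
  have h2 := hl.comp h1
  have h3 : f ∘ (fun n : ℕ => x + n * T) = fun _ => f x := funext fun n => hper.nat_mul n x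
  rw [h3] at h2
  exact tendsto_nhds_unique tendsto_const_nhds h2

theorem flow_nat_mul {ϑ : ℝ → ℝ} {T L : ℝ} (h : ∀ s, ϑ (s + T) = ϑ s + L) (n : ℕ) (s : ℝ) :
    ϑ (s + n * T) = ϑ s + n * L := by
  induction n with
  | zero => simp
  | succ n ih =>
    push_cast
    rw [add_mul, add_mul, one_mul, one_mul, ← add_assoc, h, ih]
    ring

/-- The number of integer values of a strictly increasing surjective function on a half-open
interval on which it grows by `n`. -/
theorem encard_integer_values {g : ℝ → ℝ} (hg : StrictMono g) (hs : Function.Surjective g)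
    {a T : ℝ} {n : ℕ} (hn : g (a + T) = g a + n) :
    {y | y ∈ Set.Ico a (a + T) ∧ ∃ j : ℤ, g y = j}.encard = n := by
  have himg : g '' {y | y ∈ Set.Ico a (a + T) ∧ ∃ j : ℤ, g y = j} =
      (fun j : ℤ => (j : ℝ)) '' ↑(Finset.Ico ⌈g a⌉ (⌈g a⌉ + n)) := by
    ext x
    simp only [Set.mem_image, Set.mem_ofPred_eq, Finset.coe_Ico, Set.mem_Ico]
    constructor
    · rintro ⟨y, ⟨⟨h1, h2⟩, j, hj⟩, rfl⟩
      refine ⟨j, ⟨Int.ceil_le.2 (hj ▸ hg.monotone h1), ?_⟩, hj.symm⟩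
      have h3 := hg h2
      rw [hn, hj] at h3
      have h4 : ((j - n : ℤ) : ℝ) < g a := by
        push_cast
        linarith
      have := Int.lt_ceil.2 h4
      linarith
    · rintro ⟨j, ⟨h1, h2⟩, rfl⟩
      obtain ⟨y, hy⟩ := hs j
      refine ⟨y, ⟨⟨hg.le_iff_le.1 (hy ▸ Int.ceil_le.1 h1), hg.lt_iff_lt.1 ?_⟩, j, hy⟩, hy⟩
      have h4 : ((j - n : ℤ) : ℝ) < g a := Int.lt_ceil.1 (by linarith)
      push_cast at h4
      rw [hn, hy]
      linarith
  rw [← hg.injective.encard_image, himg, Function.Injective.encard_image Int.cast_injective,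
    Set.encard_coe_eq_coe_finsetCard, Int.card_Ico]
  simp

/-- The solution below the homoclinic value: periodicity in terms of the two angle periods, and the
zeros of the first component. -/
theorem exists_solution_of_lt {p : ℝ} (hp : 0 < p) (hp' : p ^ 2 < 3 / 4) :
    0 < angleTimeU p ∧ 0 < angleTimeV p ∧ ∃ φ₁ φ₂, IsSolution p φ₁ φ₂ ∧
      ((∃ r : ℚ, angleTimeV p / angleTimeU p = r) → IsPeriodic (pairFun φ₁ φ₂)) ∧
      ((¬ ∃ r : ℚ, angleTimeV p / angleTimeU p = r) → IsQuasiPeriodic (pairFun φ₁ φ₂)) ∧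
      (p ^ 2 ≠ 3 / 8 → ∀ T, IsPeriod (pairFun φ₁ φ₂) T → ∃ n m : ℕ, 0 < n ∧ 0 < m ∧
        (2 * n) * angleTimeU p = m * angleTimeV p ∧
        ∀ a, (zerosIn φ₁ a T).encard = (2 * n : ℕ)) ∧
      (p ^ 2 = 3 / 8 → ZeroCondition φ₁ φ₂) := by
  obtain ⟨ϑ, χ, σ, ⟨t1, t2, t3, t4, t5, t6⟩, ⟨c1, c2, c3, c4, c5, c6⟩, ⟨s1, s2, s3, s4⟩, hsol⟩ :=
    exists_angles_of_lt hp hp'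
  generalize angleTimeU p = Tu at *
  generalize angleTimeV p = Tv at *
  refine ⟨t5, c5, _, _, hsol, ?_⟩
  have hp0 : 0 < p ^ 2 := by positivity
  have hρ : |3 / 2 - 4 * p ^ 2| < 3 / 2 := by rw [abs_lt]; constructor <;> linarith
  have hcos : ∀ x, |(3 / 2 - 4 * p ^ 2) * Real.cos x| ≤ |3 / 2 - 4 * p ^ 2| := fun x => by
    rw [abs_mul]
    exact mul_le_of_le_one_right (abs_nonneg _) (Real.abs_cos_le_one _)
  have hv : ∀ x, 0 < 5 / 2 + (3 / 2 - 4 * p ^ 2) * Real.cos x - 1 ∧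
      0 < 4 - (5 / 2 + (3 / 2 - 4 * p ^ 2) * Real.cos x) := fun x => by
    have h := abs_lt.1 ((hcos x).trans_lt hρ)
    constructor <;> linarith [h.1, h.2]
  have hu : ∀ x, 0 < 4 - (1 / 2 + 1 / 2 * Real.cos x) := fun x => by
    linarith [Real.cos_le_one x]
  have hw : ∀ s r, 3 / 2 - |3 / 2 - 4 * p ^ 2| ≤ 5 / 2 + (3 / 2 - 4 * p ^ 2) * Real.cos (χ r) -
      (1 / 2 + 1 / 2 * Real.cos (ϑ s)) := fun s r => by
    have h1 := (abs_le.1 (hcos (χ r))).1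
    have h2 := Real.cos_le_one (ϑ s)
    linarith
  have hm : 0 < 3 / 2 - |3 / 2 - 4 * p ^ 2| := sub_pos.2 hρ
  have hpos₂ : ∀ y, 0 < √(4 - (1 / 2 + 1 / 2 * Real.cos (ϑ (σ y)))) *
      √(4 - (5 / 2 + (3 / 2 - 4 * p ^ 2) * Real.cos (χ (σ y)))) / (2 * √3) := fun y => by
    have h1 := Real.sqrt_pos.2 (hu (ϑ (σ y)))
    have h2 := Real.sqrt_pos.2 (hv (χ (σ y))).2
    positivity
  have hzero : ∀ y, Real.sin (ϑ (σ y) / 2) *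
      √(5 / 2 + (3 / 2 - 4 * p ^ 2) * Real.cos (χ (σ y)) - 1) / √3 = 0 ↔
        Real.sin (ϑ (σ y) / 2) = 0 := fun y => by
    have h1 := (Real.sqrt_pos.2 (hv (χ (σ y))).1).ne'
    simp [h1]
  have hσsurj : Function.Surjective σ := fun x => ⟨_, s4 x⟩
  -- time shifts
  have hshift : ∀ T : ℝ, Function.Periodic (fun s => 5 / 2 + (3 / 2 - 4 * p ^ 2) * Real.cos (χ s) -
      (1 / 2 + 1 / 2 * Real.cos (ϑ s))) (σ T) → ∀ t, σ (t + T) = σ t + σ T := fun T hT t => by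
    rw [← s4 (σ t + σ T), intervalIntegral_zero_add_period (by fun_prop) hT, s3, s3]
  have hwper : ∀ (n : ℕ) (S : ℝ), S = n * Tu → ((3 / 2 - 4 * p ^ 2 = 0) ∨ ∃ m : ℕ, S = m * Tv) →
      Function.Periodic (fun s => 5 / 2 + (3 / 2 - 4 * p ^ 2) * Real.cos (χ s) -
        (1 / 2 + 1 / 2 * Real.cos (ϑ s))) S := fun n S hS h s => by
    have h1 : Real.cos (ϑ (s + S)) = Real.cos (ϑ s) := by
      rw [hS, flow_nat_mul t6, Real.cos_add_nat_mul_two_pi]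
    rcases h with h | ⟨m, hm⟩
    · simp only [h, h1, zero_mul]
    · have h2 : Real.cos (χ (s + S)) = Real.cos (χ s) := by
        rw [hm, flow_nat_mul c6, Real.cos_add_nat_mul_two_pi]
      simp only [h1, h2]
  -- Zeros of `φ₁` are the times when `ϑ / (2π)` is an integer, and this quantity grows by `n` over
  -- the interval.
  have hcount : ∀ (n : ℕ) (T : ℝ), (∀ t, σ (t + T) = σ t + n * Tu) → ∀ a,
      (zerosIn (fun t => Real.sin (ϑ (σ t) / 2) *
        √(5 / 2 + (3 / 2 - 4 * p ^ 2) * Real.cos (χ (σ t)) - 1) / √3) a T).encard = n := by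
    intro n T hT a
    rw [← encard_integer_values (g := fun y => ϑ (σ y) / (2 * Real.pi)) (a := a) (T := T)]
    · congr 1
      ext y
      simp only [zerosIn, Set.mem_ofPred_eq, hzero, Real.sin_eq_zero_iff]
      refine and_congr_right fun _ => exists_congr fun j => ?_
      rw [div_eq_iff Real.two_pi_pos.ne', eq_div_iff two_ne_zero, eq_comm]
      constructor <;> intro h <;> linarith
    · exact fun x y hxy => div_lt_div_of_pos_right (t2 (s2 hxy)) Real.two_pi_pos
    · intro x
      obtain ⟨y, hy⟩ := t3 (x * (2 * Real.pi))
      obtain ⟨z, hz⟩ := hσsurj y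
      exact ⟨z, by simp only [hz, hy]; field_simp⟩
    · simp only [hT, flow_nat_mul t6]
      field_simp
  have hperiod : ∀ T, IsPeriod (pairFun
      (fun t => Real.sin (ϑ (σ t) / 2) *
          √(5 / 2 + (3 / 2 - 4 * p ^ 2) * Real.cos (χ (σ t)) - 1) / √3)
      (fun t => √(4 - (1 / 2 + 1 / 2 * Real.cos (ϑ (σ t)))) *
          √(4 - (5 / 2 + (3 / 2 - 4 * p ^ 2) * Real.cos (χ (σ t)))) / (2 * √3))) T →
      ∃ n : ℕ, 0 < n ∧ (∀ t, σ (t + T) = σ t + (2 * n : ℕ) * Tu) ∧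
        (3 / 2 - 4 * p ^ 2 = 0 ∨ ∃ m : ℕ, 0 < m ∧ (2 * n : ℕ) * Tu = m * Tv) := by
    rintro T ⟨hT, hper⟩
    have hσT : 0 < σ T := s1 ▸ s2 hT
    have hϑT : 0 < ϑ (σ T) := t1 ▸ t2 hσT
    have hχT : 0 < χ (σ T) := c1 ▸ c2 hσT
    have hper₁ := fun t => congrArg Prod.fst (hper t)
    have hper₂ := fun t => congrArg Prod.snd (hper t)
    simp only [pairFun] at hper₁ hper₂
    have nat_of : ∀ (x : ℝ), 0 < x → ∀ j : ℤ, (j : ℝ) * (2 * Real.pi) = x →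
        ∃ n : ℕ, 0 < n ∧ x = n * (2 * Real.pi) := by
      intro x hx j hj
      have hj0 : 0 < j := by
        have : (0 : ℝ) < j := pos_of_mul_pos_left (hj ▸ hx) Real.two_pi_pos.le
        exact_mod_cast this
      lift j to ℕ using hj0.le
      exact ⟨j, by exact_mod_cast hj0, by rw [← hj]; simp⟩
    -- `φ₁` vanishes at `0`, hence at `T`, and `sin (ϑ / 2)` is its only factor with zeros.
    obtain ⟨N, hN0, hN⟩ : ∃ n : ℕ, 0 < n ∧ ϑ (σ T) = n * (2 * Real.pi) := by
      have h := hper₁ 0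
      rw [zero_add, s1, t1, zero_div, Real.sin_zero, zero_mul, zero_div, hzero,
        Real.sin_eq_zero_iff] at h
      obtain ⟨j, hj⟩ := h
      exact nat_of _ hϑT j (by linarith)
    have hNT : σ T = N * Tu := by
      refine t2.injective ?_
      rw [hN, ← zero_add ((N : ℝ) * Tu), flow_nat_mul t6, t1, zero_add]
    -- At time `T` the coordinate `u` is back at `1`, so equality of `φ₂` at `0` and `T` forces `v`
    -- back to its initial value. Unless `v` is constant, this means that `χ` has made full turns.
    have hM : 3 / 2 - 4 * p ^ 2 = 0 ∨ ∃ m : ℕ, 0 < m ∧ σ T = m * Tv := by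
      refine or_iff_not_imp_left.2 fun h0 => ?_
      have h := hper₂ 0
      rw [zero_add, hN, Real.cos_nat_mul_two_pi, s1, t1, c1, Real.cos_zero] at h
      have h3 : √(4 - (1 / 2 + 1 / 2 * (1 : ℝ))) ≠ 0 := by
        rw [Real.sqrt_ne_zero']
        norm_num
      rw [div_left_inj' (by positivity), mul_right_inj' h3,
        Real.sqrt_inj (hv _).2.le (by linarith [(hv 0).2, Real.cos_zero ▸ (hv 0).2])] at h
      have h4 : Real.cos (χ (σ T)) = 1 := by
        have : (3 / 2 - 4 * p ^ 2) * (Real.cos (χ (σ T)) - 1) = 0 := by linarith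
        rcases mul_eq_zero.1 this with h5 | h5
        · exact absurd h5 h0
        · linarith
      obtain ⟨j, hj⟩ := (Real.cos_eq_one_iff _).1 h4
      obtain ⟨m, hm0, hm⟩ := nat_of _ hχT j hj
      refine ⟨m, hm0, c2.injective ?_⟩
      rw [hm, ← zero_add ((m : ℝ) * Tv), flow_nat_mul c6, c1, zero_add]
    have hshiftT := hshift T (hwper N _ hNT (hM.imp_right fun ⟨m, _, h⟩ => ⟨m, h⟩))
    -- An odd number of turns of `ϑ` flips the sign of `sin (ϑ / 2)`. This is detected at a time
    -- with `ϑ = π`, where that factor equals `1`.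
    have heven : Even N := by
      obtain ⟨x, hx⟩ := t3 Real.pi
      obtain ⟨y, hy⟩ := hσsurj x
      have h := hper₁ y
      have h5 : Real.cos (χ (σ y + σ T)) * (3 / 2 - 4 * p ^ 2) =
          Real.cos (χ (σ y)) * (3 / 2 - 4 * p ^ 2) := by
        rcases hM with h0 | ⟨m, -, hm⟩
        · simp [h0]
        · rw [hm, flow_nat_mul c6, Real.cos_add_nat_mul_two_pi]
      have h6 : ϑ (σ y + σ T) / 2 = Real.pi / 2 + N * Real.pi := by
        rw [hNT, flow_nat_mul t6, hy, hx]
        ring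
      rw [hshiftT, mul_comm _ (Real.cos (χ (σ y + σ T))), h5, h6, Real.sin_add_nat_mul_pi, hy, hx,
        Real.sin_pi_div_two, mul_comm _ (Real.cos (χ x))] at h
      by_contra hodd
      rw [(Nat.not_even_iff_odd.1 hodd).neg_one_pow] at h
      have h7 := Real.sqrt_pos.2 (hv (χ x)).1
      rw [mul_comm (3 / 2 - 4 * p ^ 2)] at h7
      have h8 : 0 < √3 := by positivity
      rw [div_left_inj' h8.ne'] at h
      linarith
    obtain ⟨n, rfl⟩ := heven
    refine ⟨n, by omega, fun t => ?_, hM.imp_right fun ⟨m, h0, h⟩ => ⟨m, h0, ?_⟩⟩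
    · rw [hshiftT, hNT, two_mul]
    · rw [← h, hNT, two_mul]
  -- Only `ϑ` occurs through its half angle, so the first period is doubled and the second is not.
  obtain ⟨d₁, d₂⟩ := time_change_dichotomy (σ := σ) (T₁ := 2 * Tu) (T₂ := Tv)
      (u := fun s => 1 / 2 + 1 / 2 * Real.cos (ϑ s))
      (v := fun s => 5 / 2 + (3 / 2 - 4 * p ^ 2) * Real.cos (χ s))
      (G := fun z : ℝ × ℝ => (Real.sin (ϑ z.1 / 2) *
          √(5 / 2 + (3 / 2 - 4 * p ^ 2) * Real.cos (χ z.2) - 1) / √3,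
        √(4 - (1 / 2 + 1 / 2 * Real.cos (ϑ z.1))) *
          √(4 - (5 / 2 + (3 / 2 - 4 * p ^ 2) * Real.cos (χ z.2))) / (2 * √3)))
      (by fun_prop)
      (fun x y => by
        have h : Real.sin ((ϑ x + 2 * Real.pi + 2 * Real.pi) / 2) = Real.sin (ϑ x / 2) := by
          rw [← Real.sin_add_two_pi (ϑ x / 2)]
          congr 1
          ring
        have h' : ϑ (x + 2 * Tu) = ϑ x + 2 * Real.pi + 2 * Real.pi := by
          rw [two_mul, ← add_assoc, t6, t6]
        simp only [h', h, Real.cos_add_two_pi])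
      (fun x y => by simp [c6])
      (by positivity) c5 (by fun_prop) (by fun_prop)
      (fun x => by simp only [two_mul Tu, ← add_assoc, t6, Real.cos_add_two_pi])
      (fun x => by simp [c6]) hm hw s3 s4
  have hrat : (∃ r : ℚ, Tv / Tu = r) ↔ ∃ r : ℚ, 2 * Tu = r * Tv := by
    constructor
    · rintro ⟨r, hr⟩
      have hr0 : (r : ℝ) ≠ 0 := by rw [← hr]; positivity
      refine ⟨2 / r, ?_⟩
      rw [div_eq_iff t5.ne'] at hr
      push_cast
      rw [hr]
      field_simp
    · rintro ⟨r, hr⟩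
      have hr0 : (r : ℝ) ≠ 0 := fun h => by
        rw [h, zero_mul] at hr
        linarith
      refine ⟨2 / r, ?_⟩
      push_cast
      rw [div_eq_div_iff t5.ne' hr0, hr]
      ring
  refine ⟨fun h => d₁ (hrat.1 h), fun h => d₂ (fun h' => h (hrat.2 h')), fun hne T hT => ?_,
    fun heq => ⟨?_, hpos₂⟩⟩
  · obtain ⟨n, hn, h1, h2⟩ := hperiod T hT
    obtain ⟨m, hm0, hm⟩ := h2.resolve_left fun h => hne (by linarith)
    exact ⟨n, m, hn, hm0, by exact_mod_cast hm, hcount _ T h1⟩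
  -- The coordinate `v` is constant, so the least period is the time in which `ϑ` makes two turns.
  -- Any period corresponds to an even positive number of turns.
  · have h0 : 3 / 2 - 4 * p ^ 2 = 0 := by linarith
    obtain ⟨T, hT⟩ : ∃ T, σ T = (2 : ℕ) * Tu := hσsurj _
    have hsh := hshift T (hwper 2 _ hT (Or.inl h0))
    have hT0 : 0 < T := s2.lt_iff_lt.1 (by rw [s1, hT]; positivity)
    refine ⟨T, ⟨⟨hT0, fun t => ?_⟩, fun T' hT' => ?_⟩, fun a => ?_⟩
    · have h1 : ϑ (σ (t + T)) / 2 = ϑ (σ t) / 2 + 2 * Real.pi := by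
        rw [hsh, hT, flow_nat_mul t6]
        push_cast
        ring
      have h2 : Real.cos (ϑ (σ (t + T))) = Real.cos (ϑ (σ t)) := by
        rw [hsh, hT, flow_nat_mul t6, Real.cos_add_nat_mul_two_pi]
      simp only [pairFun, h0, h1, h2, zero_mul, Real.sin_add_two_pi]
    · obtain ⟨n, hn, h1, -⟩ := hperiod T' hT'
      refine s2.le_iff_le.1 ?_
      have h2 := h1 0
      rw [zero_add, s1, zero_add] at h2
      rw [hT, h2]
      gcongr
      omega
    · exact hcount 2 T (fun t => by rw [hsh, hT]) a

/-! ### Convergence of the period integrals and their trigonometric form. -/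

-- This function, translated to each root, is the majorant for `1 / √|quintic|`. It has an inverse
-- square root singularity at the root and decays fast enough at infinity, with `d` measuring the
-- separation of the roots.
open MeasureTheory in
theorem integrable_inv_sqrt_abs_mul {d : ℝ} (hd : 0 < d) :
    Integrable fun t : ℝ => (√|t|)⁻¹ * (4 / (d + |t|) ^ 2) := by
  have h0 : IntervalIntegrable (fun t : ℝ => (√|t|)⁻¹) volume 0 1 := by
    refine (intervalIntegral.intervalIntegrable_rpow' (r := -(1 / 2)) (by norm_num)).congr ?_
    intro t ht
    rw [Set.uIoc_of_le zero_le_one] at ht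
    simp only [abs_of_pos ht.1]
    rw [Real.rpow_neg ht.1.le, Real.sqrt_eq_rpow]
  have h1 : IntervalIntegrable (fun t : ℝ => (√|t|)⁻¹) volume (-1) 1 := by
    refine IntervalIntegrable.trans (b := 0) ?_ h0
    have := ((IntervalIntegrable.iff_comp_neg (by simp)).1 h0).symm
    simpa using this
  rw [intervalIntegrable_iff_integrableOn_Ioc_of_le (by norm_num)] at h1
  have h2 : Integrable ((Set.Ioc (-1) 1).indicator fun t : ℝ => (√|t|)⁻¹) :=
    (integrable_indicator_iff measurableSet_Ioc).2 h1
  refine ((h2.const_mul (4 / d ^ 2)).add (integrable_inv_one_add_sq.const_mul 8)).mono'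
    (Measurable.aestronglyMeasurable (by fun_prop)) (Filter.Eventually.of_forall fun t => ?_)
  rw [Real.norm_of_nonneg (by positivity)]
  simp only [Pi.add_apply]
  by_cases ht : t ∈ Set.Ioc (-1 : ℝ) 1
  · rw [Set.indicator_of_mem ht]
    have : (√|t|)⁻¹ * (4 / (d + |t|) ^ 2) ≤ (√|t|)⁻¹ * (4 / d ^ 2) := by
      gcongr
      linarith [abs_nonneg t]
    have h8 : 0 ≤ 8 * (1 + t ^ 2)⁻¹ := by positivity
    linarith
  · rw [Set.indicator_of_notMem ht, mul_zero, zero_add]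
    have h3 : 1 ≤ |t| := by
      by_contra h
      exact ht ⟨(abs_lt.1 (not_le.1 h)).1, (abs_lt.1 (not_le.1 h)).2.le⟩
    have h4 : (√|t|)⁻¹ ≤ 1 := inv_le_one_of_one_le₀ (Real.one_le_sqrt.2 h3)
    have h5 : 4 / (d + |t|) ^ 2 ≤ 8 * (1 + t ^ 2)⁻¹ := by
      rw [← div_eq_mul_inv, div_le_div_iff₀ (by positivity) (by positivity), ← sq_abs t]
      nlinarith [abs_nonneg t]
    calc (√|t|)⁻¹ * (4 / (d + |t|) ^ 2) ≤ 1 * (4 / (d + |t|) ^ 2) := by gcongr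
      _ ≤ _ := by rw [one_mul]; exact h5

open MeasureTheory in
/-- `1 / √|quintic|` is integrable on the line if the five real roots are distinct. -/
theorem integrable_inv_sqrt_abs_prod {r : Fin 5 → ℝ} (hr : Function.Injective r) :
    Integrable fun x => (√|∏ j, (x - r j)|)⁻¹ := by
  obtain ⟨d, hd, hrd⟩ : ∃ d > 0, ∀ i j, i ≠ j → 2 * d ≤ |r i - r j| := by
    let S : Finset ℝ := (Finset.univ.filter fun z : Fin 5 × Fin 5 => z.1 ≠ z.2).image
      fun z => |r z.1 - r z.2| / 2
    have hS : S.Nonempty := ⟨_, Finset.mem_image_of_mem _ (by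
      simp : ((0 : Fin 5), (1 : Fin 5)) ∈ _)⟩
    refine ⟨S.min' hS, ?_, fun i j hij => ?_⟩
    · rw [gt_iff_lt, Finset.lt_min'_iff]
      intro y hy
      obtain ⟨z, hz, rfl⟩ := Finset.mem_image.1 hy
      have := abs_pos.2 (sub_ne_zero.2 (hr.ne (Finset.mem_filter.1 hz).2))
      positivity
    · have := S.min'_le (|r i - r j| / 2)
        (Finset.mem_image.2 ⟨(i, j), by simp [hij], rfl⟩)
      linarith
  refine (integrable_finsetSum Finset.univ fun j _ =>
    (integrable_inv_sqrt_abs_mul hd).comp_sub_right (r j)).mono'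
    (Measurable.aestronglyMeasurable (by fun_prop)) (Filter.Eventually.of_forall fun x => ?_)
  -- Let `r j` be the root nearest to `x`. Every other root is at distance at least `|x - r j|`, and
  -- also at least `d` by the triangle inequality, hence at least the mean of the two. Four such
  -- factors give the majorant.
  obtain ⟨j, -, hj⟩ := Finset.exists_min_image Finset.univ (fun j => |x - r j|)
    Finset.univ_nonempty
  rw [Real.norm_of_nonneg (by positivity)]
  refine le_trans ?_ (Finset.single_le_sum (f := fun j => (√|x - r j|)⁻¹ *
    (4 / (d + |x - r j|) ^ 2)) (fun i _ => by positivity) (Finset.mem_univ j))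
  rw [← Finset.mul_prod_erase _ _ (Finset.mem_univ j), abs_mul, Real.sqrt_mul (abs_nonneg _),
    mul_inv]
  gcongr
  have hge : ((d + |x - r j|) / 2) ^ 4 ≤ |∏ i ∈ Finset.univ.erase j, (x - r i)| := by
    rw [Finset.abs_prod]
    have := Finset.prod_le_prod (s := Finset.univ.erase j) (f := fun _ => (d + |x - r j|) / 2)
      (g := fun i => |x - r i|) (fun i _ => by positivity) fun i hi => by
        have h1 := hj i (Finset.mem_univ i)
        have h2 := hrd i j (Finset.ne_of_mem_erase hi)
        have h3 : |r i - r j| ≤ |x - r i| + |x - r j| := by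
          rw [abs_sub_comm x (r i)]
          have := abs_add_le (r i - x) (x - r j)
          simpa using this
        linarith
    simpa [Finset.card_erase_of_mem, div_pow] using this
  have h5 : ((d + |x - r j|) / 2) ^ 2 ≤ √|∏ i ∈ Finset.univ.erase j, (x - r i)| := by
    refine Real.le_sqrt_of_sq_le ?_
    rw [← pow_mul]
    exact hge
  calc (√|∏ i ∈ Finset.univ.erase j, (x - r i)|)⁻¹ ≤ (((d + |x - r j|) / 2) ^ 2)⁻¹ :=
        inv_anti₀ (by positivity) h5
    _ = 4 / (d + |x - r j|) ^ 2 := by field_simp; norm_num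

-- The factor `sin x` from the substitution cancels the inverse square root singularities at both
-- end points when the integrand has simple roots there.
open MeasureTheory in
theorem intervalIntegral_cos_subst (g : ℝ → ℝ) {m r : ℝ} (hr : 0 < r) :
    ∫ s in (m - r)..(m + r), g s =
      ∫ x in (0 : ℝ)..Real.pi, r * Real.sin x * g (m - r * Real.cos x) := by
  have hinj : Set.InjOn (fun x => m - r * Real.cos x) (Set.Icc 0 Real.pi) := fun x hx y hy h =>
    Real.injOn_cos hx hy (by simpa [hr.ne'] using h)
  have himg : (fun x => m - r * Real.cos x) '' Set.Icc 0 Real.pi = Set.Icc (m - r) (m + r) := by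
    have : (fun x => m - r * Real.cos x) '' Set.Icc 0 Real.pi =
        (fun y => m - r * y) '' (Real.cos '' Set.Icc 0 Real.pi) := by
      rw [Set.image_image]
    rw [this, Real.bijOn_cos.image_eq]
    ext y
    simp only [Set.mem_image, Set.mem_Icc]
    constructor
    · rintro ⟨z, ⟨h1, h2⟩, rfl⟩
      constructor <;> nlinarith
    · rintro ⟨h1, h2⟩
      refine ⟨(m - y) / r, ⟨?_, ?_⟩, by field_simp; ring⟩
      · rw [le_div_iff₀ hr]; linarith
      · rw [div_le_iff₀ hr]; linarith
  rw [intervalIntegral.integral_of_le (by linarith), intervalIntegral.integral_of_le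
    Real.pi_pos.le, ← integral_Icc_eq_integral_Ioc, ← integral_Icc_eq_integral_Ioc, ← himg,
    integral_image_eq_integral_abs_deriv_smul (f' := fun x => r * Real.sin x) measurableSet_Icc
      (fun x _ => HasDerivAt.hasDerivWithinAt
        (((Real.hasDerivAt_cos x).const_mul r).const_sub m |>.congr_deriv (by ring))) hinj]
  refine setIntegral_congr_fun measurableSet_Icc fun x hx => ?_
  have := Real.sin_nonneg_of_mem_Icc hx
  simp only [smul_eq_mul]
  rw [abs_of_nonneg (by positivity)]

theorem intervalIntegral_cos_two_pi {H : ℝ → ℝ} (hH : Continuous fun x => H (Real.cos x)) :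
    ∫ x in (0 : ℝ)..(2 * Real.pi), H (Real.cos x) =
      2 * ∫ x in (0 : ℝ)..Real.pi, H (Real.cos x) := by
  have h := intervalIntegral.integral_comp_sub_left (fun x => H (Real.cos x)) (2 * Real.pi)
    (a := Real.pi) (b := 2 * Real.pi)
  simp only [Real.cos_two_pi_sub, sub_self] at h
  rw [show 2 * Real.pi - Real.pi = Real.pi by ring] at h
  rw [← intervalIntegral.integral_add_adjacent_intervals (b := Real.pi)
    (hH.intervalIntegrable _ _) (hH.intervalIntegrable _ _), h, two_mul]

theorem intervalIntegral_cos_neg (H : ℝ → ℝ) :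
    ∫ x in (0 : ℝ)..Real.pi, H (-Real.cos x) = ∫ x in (0 : ℝ)..Real.pi, H (Real.cos x) := by
  have h := intervalIntegral.integral_comp_sub_left (fun x => H (Real.cos x)) Real.pi
    (a := 0) (b := Real.pi)
  simpa only [Real.cos_pi_sub, sub_self, sub_zero] using h

/-- The variable `s` of the quintic and the coordinate `u` are related by `u = 1 - 2 s`, so `[0,
1/2]` is the range of `u`. -/
theorem periodU_eq {p : ℝ} (hp : 0 < p) (hp' : p ^ 2 < 3 / 4) :
    periodU p = 2 * angleTimeU p := by
  have hpos : ∀ x, 0 < angularU p (1 / 2 + 1 / 2 * Real.cos x) := fun x =>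
    angularU_pos hp hp' (by linarith [Real.cos_le_one x])
  have hUc : Continuous (angularU p) :=
    continuous_iff_continuousAt.2 fun x => (hasDerivAt_angularU p x).continuousAt
  have hc : Continuous fun x => (√(angularU p (1 / 2 + 1 / 2 * Real.cos x)))⁻¹ :=
    Continuous.inv₀ (by fun_prop) fun x => (Real.sqrt_pos.2 (hpos x)).ne'
  have h := intervalIntegral_cos_subst (fun s => 1 / √(quintic p s)) (m := 1 / 4) (r := 1 / 4)
    (by norm_num)
  rw [show (1 / 4 - 1 / 4 : ℝ) = 0 by norm_num, show (1 / 4 + 1 / 4 : ℝ) = 1 / 2 by norm_num] at h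
  rw [periodU, h, angleTimeU,
    intervalIntegral_cos_two_pi (H := fun y => (√(angularU p (1 / 2 + 1 / 2 * y)))⁻¹) hc]
  congr 1
  rw [← intervalIntegral.integral_const_mul]
  refine intervalIntegral.integral_congr_Ioo_of_le Real.pi_pos.le fun x hx => ?_
  have hs := Real.sin_pos_of_mem_Ioo hx
  have hq : quintic p (1 / 4 - 1 / 4 * Real.cos x) =
      (Real.sin x / 8) ^ 2 * angularU p (1 / 2 + 1 / 2 * Real.cos x) := by
    rw [div_pow, Real.sin_sq]
    simp only [quintic, angularU]
    ring
  have h0 := Real.sqrt_pos.2 (hpos x)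
  rw [hq, Real.sqrt_mul (by positivity), Real.sqrt_sq (by positivity)]
  field_simp
  norm_num

theorem lowerRoot_eq (p : ℝ) : lowerRoot p = -3 / 4 - |2 * p ^ 2 - 3 / 4| := by
  rw [lowerRoot]
  rcases le_total (2 * p ^ 2) (3 / 4) with h | h
  · rw [abs_of_nonpos (by linarith), min_eq_left (by linarith)]
    ring
  · rw [abs_of_nonneg (by linarith), min_eq_right (by linarith)]
    ring

theorem upperRoot_eq (p : ℝ) : upperRoot p = -3 / 4 + |2 * p ^ 2 - 3 / 4| := by
  rw [upperRoot]
  rcases le_total (2 * p ^ 2) (3 / 4) with h | h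
  · rw [abs_of_nonpos (by linarith), max_eq_right (by linarith)]
    ring
  · rw [abs_of_nonneg (by linarith), max_eq_left (by linarith)]
    ring

/-- Here `v = 1 - 2 s`, with the two roots written as `-3/4 ± δ`. The amplitude `3/2 - 4p²` equals
`2 δ` or `-2 δ` according to the side of `p² = 3/8`, and the reflection `x ↦ π - x` removes the
sign. -/
theorem periodV_eq {p : ℝ} (hp : 0 < p) (hp' : p ^ 2 < 3 / 4) (hne : p ^ 2 ≠ 3 / 8) :
    periodV p = 2 * angleTimeV p := by
  obtain ⟨δ, hδ⟩ : ∃ δ, δ = |2 * p ^ 2 - 3 / 4| := ⟨_, rfl⟩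
  have hp0 : 0 < p ^ 2 := by positivity
  have hδ0 : 0 < δ := hδ ▸ abs_pos.2 fun h => hne (by linarith)
  have hδ1 : δ < 3 / 4 := by rw [hδ, abs_lt]; constructor <;> linarith
  have hδ2 : δ ^ 2 = (2 * p ^ 2 - 3 / 4) ^ 2 := by rw [hδ, sq_abs]
  have hpos : ∀ y, -1 ≤ y → y ≤ 1 → 0 < angularV (5 / 2 + 2 * δ * y) := fun y h1 h2 =>
    angularV_pos (by nlinarith) (by nlinarith)
  have hVc : Continuous angularV :=
    continuous_iff_continuousAt.2 fun x => (hasDerivAt_angularV x).continuousAt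
  have hc : Continuous fun x => (√(angularV (5 / 2 + 2 * δ * Real.cos x)))⁻¹ :=
    Continuous.inv₀ (by fun_prop)
      fun x => (Real.sqrt_pos.2 (hpos _ (Real.neg_one_le_cos x) (Real.cos_le_one x))).ne'
  have hc' : Continuous fun x => (√(angularV (5 / 2 + 2 * δ * -Real.cos x)))⁻¹ :=
    Continuous.inv₀ (by fun_prop) fun x => (Real.sqrt_pos.2 (hpos _
      (by linarith [Real.cos_le_one x]) (by linarith [Real.neg_one_le_cos x]))).ne'
  have hang : angleTimeV p = 2 * ∫ x in (0 : ℝ)..Real.pi,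
      (√(angularV (5 / 2 + 2 * δ * Real.cos x)))⁻¹ := by
    rw [angleTimeV]
    rcases le_total (2 * p ^ 2) (3 / 4) with h | h
    · rw [abs_of_nonpos (by linarith)] at hδ
      rw [show 3 / 2 - 4 * p ^ 2 = 2 * δ by rw [hδ]; ring]
      exact intervalIntegral_cos_two_pi (H := fun y => (√(angularV (5 / 2 + 2 * δ * y)))⁻¹) hc
    · rw [abs_of_nonneg (by linarith)] at hδ
      rw [← intervalIntegral_cos_neg fun y => (√(angularV (5 / 2 + 2 * δ * y)))⁻¹,
        ← intervalIntegral_cos_two_pi (H := fun y => (√(angularV (5 / 2 + 2 * δ * -y)))⁻¹) hc',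
        show 3 / 2 - 4 * p ^ 2 = -(2 * δ) by rw [hδ]; ring]
      simp only [neg_mul, mul_neg]
  rw [periodV, lowerRoot_eq, upperRoot_eq, ← hδ, hang,
    intervalIntegral_cos_subst (fun s => 1 / √(quintic p s)) hδ0]
  congr 1
  rw [← intervalIntegral.integral_const_mul]
  refine intervalIntegral.integral_congr_Ioo_of_le Real.pi_pos.le fun x hx => ?_
  have hs := Real.sin_pos_of_mem_Ioo hx
  have hq : quintic p (-3 / 4 - δ * Real.cos x) =
      (δ * Real.sin x / 2) ^ 2 * angularV (5 / 2 + 2 * δ * Real.cos x) := by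
    have e : (2 * p ^ 2 + (-3 / 4 - δ * Real.cos x)) *
        (3 - 4 * p ^ 2 + 2 * (-3 / 4 - δ * Real.cos x)) =
          -2 * (δ ^ 2 * Real.sin x ^ 2) := by
      rw [Real.sin_sq]
      linear_combination 2 * hδ2
    rw [quintic, mul_assoc, e]
    simp only [angularV]
    ring
  have h0 := Real.sqrt_pos.2 (hpos _ (Real.neg_one_le_cos x) (Real.cos_le_one x))
  rw [hq, Real.sqrt_mul (by positivity), Real.sqrt_sq (by positivity)]
  field_simp

/-! ### Cauchy's theorem for the inverse square root of the quintic. -/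

/-- The inverse square root that is holomorphic on the upper half plane and positive on the
positive half-line. -/
noncomputable def upperInvSqrt (z : ℂ) : ℂ :=
  Complex.exp (-(1 / 2) * Complex.log (-Complex.I * z) - Real.pi / 4 * Complex.I)

/-- Multiplication by `-I` moves the branch cut to the negative imaginary axis. Thus `upperInvSqrt`
is differentiable also at the nonzero real points, where boundary values are needed. -/
theorem neg_I_mul_mem_slitPlane {z : ℂ} (hz : z ≠ 0) (h : 0 ≤ z.im) :
    -Complex.I * z ∈ Complex.slitPlane := by
  rw [Complex.mem_slitPlane_iff]
  rcases h.lt_or_eq with h | h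
  · left
    simpa using h
  · right
    have : z.re ≠ 0 := fun h' => hz (Complex.ext h' h.symm)
    simpa using this

theorem differentiableAt_upperInvSqrt {z : ℂ} (hz : z ≠ 0) (h : 0 ≤ z.im) :
    DifferentiableAt ℂ upperInvSqrt z := by
  have := neg_I_mul_mem_slitPlane hz h
  unfold upperInvSqrt
  fun_prop (disch := assumption)

theorem norm_upperInvSqrt {z : ℂ} (hz : z ≠ 0) : ‖upperInvSqrt z‖ = (√‖z‖)⁻¹ := by
  have h0 : 0 < ‖z‖ := norm_pos_iff.2 hz
  rw [upperInvSqrt, Complex.norm_exp]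
  have : (-(1 / 2) * Complex.log (-Complex.I * z) - Real.pi / 4 * Complex.I).re =
      -(Real.log ‖z‖ / 2) := by
    have h1 : (-(1 / 2) * Complex.log (-Complex.I * z)).re =
        -(1 / 2) * (Complex.log (-Complex.I * z)).re := by
      rw [show (-(1 / 2) : ℂ) = ((-(1 / 2) : ℝ) : ℂ) by push_cast; ring, Complex.re_ofReal_mul]
    have h2 : ((Real.pi : ℂ) / 4 * Complex.I).re = 0 := by
      rw [show (Real.pi : ℂ) / 4 = ((Real.pi / 4 : ℝ) : ℂ) by push_cast; ring,
        Complex.re_ofReal_mul]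
      simp
    rw [Complex.sub_re, h1, h2, Complex.log_re]
    simp
    ring
  rw [this, Real.exp_neg, Real.exp_half, Real.exp_log h0]

/-- In the product over the roots, each root to the right of `x` thus contributes one factor `-I`.
-/
theorem upperInvSqrt_ofReal {x : ℝ} (hx : x ≠ 0) :
    upperInvSqrt x = ((√|x|)⁻¹ : ℝ) * (if x < 0 then -Complex.I else 1) := by
  have key : ∀ y : ℝ, 0 < y → Complex.exp (-(1 / 2) * (Real.log y : ℂ)) = ((√y)⁻¹ : ℝ) := by
    intro y hy
    rw [← Complex.ofReal_one, ← Complex.ofReal_ofNat, ← Complex.ofReal_div, ← Complex.ofReal_neg,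
      ← Complex.ofReal_mul, ← Complex.ofReal_exp,
      show -(1 / 2) * Real.log y = -(Real.log y / 2) by ring, Real.exp_neg, Real.exp_half,
      Real.exp_log hy]
  rcases hx.lt_or_gt with h | h
  · have h1 : -Complex.I * x = ((-x : ℝ) : ℂ) * Complex.I := by push_cast; ring
    rw [upperInvSqrt, h1, Complex.log_ofReal_mul (by linarith) Complex.I_ne_zero, Complex.log_I,
      if_pos h, abs_of_neg h, ← key _ (by linarith), mul_add,
      show -(1 / 2) * (Real.log (-x) : ℂ) + -(1 / 2) * (Real.pi / 2 * Complex.I) -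
        Real.pi / 4 * Complex.I = -(1 / 2) * (Real.log (-x) : ℂ) + -Real.pi / 2 * Complex.I by ring,
      Complex.exp_add]
    congr 1
    rw [show -(Real.pi : ℂ) / 2 * Complex.I = -(Real.pi / 2 * Complex.I) by ring, Complex.exp_neg,
      Complex.exp_pi_div_two_mul_I, Complex.inv_I]
  · have h1 : -Complex.I * x = (x : ℂ) * (-Complex.I) := by ring
    rw [upperInvSqrt, h1, Complex.log_ofReal_mul h (neg_ne_zero.2 Complex.I_ne_zero),
      Complex.log_neg_I, if_neg h.not_gt, abs_of_pos h, ← key _ h, mul_one]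
    congr 1
    ring

section Contour

variable {r : Fin 5 → ℝ}

theorem add_mul_I_sub_ne_zero (x a : ℝ) {y : ℝ} (hy : 0 < y) :
    (x : ℂ) + y * Complex.I - a ≠ 0 := fun h => by
  have := congrArg Complex.im h
  simp at this
  linarith

/-- The integrand is holomorphic above the real axis and of size `|z| ^ (-5/2)` at infinity, so the
other three sides of a large rectangle contribute nothing in the limit. -/
theorem integral_upperInvSqrt_horizontal_eq_zero (hr : Function.Injective r) {y : ℝ} (hy : 0 < y) :
    ∫ x : ℝ, ∏ j, upperInvSqrt (x + y * Complex.I - r j) = 0 := by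
  obtain ⟨C, hC0, hC⟩ : ∃ C : ℝ, 0 < C ∧ ∀ j, |r j| ≤ C :=
    ⟨1 + ∑ j, |r j|, by positivity, fun j => by
      have := Finset.single_le_sum (f := fun j => |r j|) (fun i _ => abs_nonneg _)
        (Finset.mem_univ j)
      linarith⟩
  let G : ℂ → ℂ := fun z => ∏ j, upperInvSqrt (z - r j)
  have hne : ∀ z : ℂ, 0 < z.im → ∀ j, z - r j ≠ 0 := fun z hz j h => by
    have := congrArg Complex.im h
    simp at this
    linarith
  have hG : ∀ z : ℂ, 0 < z.im → DifferentiableAt ℂ G z := fun z hz => by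
    refine DifferentiableAt.fun_finsetProd fun j _ => ?_
    exact (differentiableAt_upperInvSqrt (hne z hz j) (by simpa using hz.le)).comp
      (f := fun z : ℂ => z - r j) z (differentiableAt_id.sub_const _)
  have hGn : ∀ z : ℂ, 0 < z.im → ‖G z‖ = ∏ j, (√‖z - r j‖)⁻¹ := fun z hz => by
    rw [norm_prod]
    exact Finset.prod_congr rfl fun j _ => norm_upperInvSqrt (hne z hz j)
  have hGb : ∀ (R : ℝ) (z : ℂ), 0 < R → 0 < z.im → (∀ j, R ≤ ‖z - r j‖) →
      ‖G z‖ ≤ ((√R)⁻¹) ^ 5 := fun R z hR hz h => by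
    rw [hGn z hz]
    calc ∏ j, (√‖z - r j‖)⁻¹ ≤ ∏ _j : Fin 5, (√R)⁻¹ :=
          Finset.prod_le_prod (fun j _ => by positivity) fun j _ =>
            inv_anti₀ (Real.sqrt_pos.2 hR) (Real.sqrt_le_sqrt (h j))
      _ = _ := by simp
  have hcont : Continuous fun x : ℝ => G (x + y * Complex.I) :=
    continuous_iff_continuousAt.2 fun x =>
      (hG _ (by simpa using hy)).continuousAt.comp (f := fun x : ℝ => (x : ℂ) + y * Complex.I)
        (by fun_prop)
  have hint : MeasureTheory.Integrable fun x : ℝ => G (x + y * Complex.I) := by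
    refine (integrable_inv_sqrt_abs_prod hr).mono' hcont.aestronglyMeasurable ?_
    have : ∀ᵐ x : ℝ, x ∉ Set.range r := (Set.finite_range r).countable.ae_notMem _
    filter_upwards [this] with x hx
    rw [hGn _ (by simpa using hy), Finset.abs_prod, Real.sqrt_prod _ fun _ _ => abs_nonneg _,
      ← Finset.prod_inv_distrib]
    refine Finset.prod_le_prod (fun j _ => by positivity) fun j _ => ?_
    have hx' : x - r j ≠ 0 := fun h => hx ⟨j, by linarith⟩
    refine inv_anti₀ (Real.sqrt_pos.2 (abs_pos.2 hx')) (Real.sqrt_le_sqrt ?_)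
    refine le_trans ?_ (Complex.abs_re_le_norm _)
    simp
  have hlim : Filter.Tendsto (fun R : ℝ => ∫ x in (-R)..R, G (x + y * Complex.I)) Filter.atTop
      (nhds (∫ x : ℝ, G (x + y * Complex.I))) :=
    MeasureTheory.intervalIntegral_tendsto_integral hint Filter.tendsto_neg_atTop_atBot
      Filter.tendsto_id
  refine tendsto_nhds_unique hlim ?_
  -- The three sides have total length `4 R`, and there the integrand is at most `(R / 2) ^ (-5/2)`.
  -- The product is `8 (R / 2) ^ (-3/2)`, so the constant `16` leaves room.
  have hb : Filter.Tendsto (fun R : ℝ => 16 * ((√(R / 2))⁻¹) ^ 3) Filter.atTop (nhds 0) := by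
    have h1 : Filter.Tendsto (fun R : ℝ => (√(R / 2))⁻¹) Filter.atTop (nhds 0) :=
      (Real.tendsto_sqrt_atTop.comp (Filter.tendsto_id.atTop_div_const two_pos)).inv_tendsto_atTop
    simpa using (h1.pow 3).const_mul 16
  refine squeeze_zero_norm' ?_ hb
  filter_upwards [Filter.eventually_ge_atTop (2 * C)] with R hR
  have hR0 : 0 < R := by linarith
  have hrect := Complex.integral_boundary_rect_eq_zero_of_differentiableOn G
    (-R + y * Complex.I) (R + (y + R : ℝ) * Complex.I) (fun z hz => by
      refine (hG z ?_).differentiableWithinAt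
      have := (Complex.mem_reProdIm.1 hz).2
      simp only [Complex.add_im, Complex.neg_im, Complex.ofReal_im, Complex.mul_im,
        Complex.ofReal_re, Complex.I_im, Complex.I_re, mul_one, mul_zero, add_zero, neg_zero,
        zero_add] at this
      rw [Set.uIcc_of_le (by linarith)] at this
      exact hy.trans_le this.1)
  simp only [Complex.add_im, Complex.neg_im, Complex.ofReal_im, Complex.mul_im, Complex.add_re,
    Complex.neg_re, Complex.mul_re,
        Complex.ofReal_re, Complex.I_im, Complex.I_re, mul_one, mul_zero, add_zero, neg_zero,
        zero_add, sub_self] at hrect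
  have hnear : ∀ a : ℝ, R ≤ |a| → ∀ j, R / 2 ≤ |a - r j| := fun a ha j => by
    have h1 := hC j
    have h2 := abs_sub_abs_le_abs_sub a (r j)
    linarith
  have hside : ∀ a : ℝ, R ≤ |a| → ‖∫ t in y..(y + R), G (a + t * Complex.I)‖ ≤
      ((√(R / 2))⁻¹) ^ 5 * R := fun a ha => by
    have := intervalIntegral.norm_integral_le_of_norm_le_const (a := y) (b := y + R)
      (C := ((√(R / 2))⁻¹) ^ 5) (f := fun t : ℝ => G (a + t * Complex.I)) fun t ht => by
        rw [Set.uIoc_of_le (by linarith)] at ht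
        refine hGb _ _ (by linarith) (by simpa using hy.trans ht.1) fun j => ?_
        refine (hnear a ha j).trans (le_trans ?_ (Complex.abs_re_le_norm _))
        simp
    rwa [add_sub_cancel_left, abs_of_pos hR0] at this
  have htop : ‖∫ x in (-R)..R, G (x + (y + R : ℝ) * Complex.I)‖ ≤
      ((√(R / 2))⁻¹) ^ 5 * (2 * R) := by
    have := intervalIntegral.norm_integral_le_of_norm_le_const (a := -R) (b := R)
      (C := ((√(R / 2))⁻¹) ^ 5) (f := fun x : ℝ => G (x + (y + R : ℝ) * Complex.I)) fun t ht => by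
        refine hGb _ _ (by linarith) (by simp; linarith) fun j => ?_
        refine le_trans ?_ (Complex.abs_im_le_norm _)
        simp
        rw [abs_of_pos (by linarith)]
        linarith
    rwa [show R - -R = 2 * R by ring, abs_of_pos (by linarith : 0 < 2 * R)] at this
  have h₁ := hside R (le_abs_self R)
  have h₂ := hside (-R) (by rw [abs_neg]; exact le_abs_self R)
  push_cast at hrect htop h₂ ⊢
  have heq : (∫ x in (-R)..R, G (x + y * Complex.I)) =
      (∫ x in (-R)..R, G (x + (y + R) * Complex.I)) -
        Complex.I * (∫ t in y..(y + R), G (R + t * Complex.I)) +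
        Complex.I * (∫ t in y..(y + R), G (-R + t * Complex.I)) := by
    simp only [smul_eq_mul] at hrect
    linear_combination hrect
  rw [heq]
  have hq : 0 < √(R / 2) := Real.sqrt_pos.2 (by linarith)
  have hq2 : √(R / 2) ^ 2 = R / 2 := Real.sq_sqrt (by linarith)
  calc _ ≤ ((√(R / 2))⁻¹) ^ 5 * (2 * R) + ((√(R / 2))⁻¹) ^ 5 * R + ((√(R / 2))⁻¹) ^ 5 * R := by
        refine (norm_add_le _ _).trans (add_le_add ((norm_sub_le _ _).trans (add_le_add htop ?_)) ?_)
        · simpa using h₁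
        · simpa using h₂
    _ ≤ _ := by
      have : R = 2 * √(R / 2) ^ 2 := by linarith
      generalize √(R / 2) = q at *
      rw [this]
      field_simp
      norm_num

/-- The horizontal line is lowered to the real axis. Moving up from the axis increases the distance
to every real root, so the modulus on the axis is an integrable majorant. -/
theorem integral_upperInvSqrt_eq_zero (hr : Function.Injective r) :
    ∫ x : ℝ, ∏ j, upperInvSqrt ((x - r j : ℝ) : ℂ) = 0 := by
  have hae : ∀ᵐ x : ℝ, x ∉ Set.range r := (Set.finite_range r).countable.ae_notMem _
  have hy : ∀ n : ℕ, (0 : ℝ) < 1 / ((n : ℝ) + 1) := fun n => by positivity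
  have hne : ∀ (n : ℕ) (x : ℝ) (j), (x : ℂ) + (1 / ((n : ℝ) + 1) : ℝ) * Complex.I - r j ≠ 0 :=
    fun n x j => add_mul_I_sub_ne_zero x (r j) (hy n)
  have him : ∀ (n : ℕ) (x : ℝ) (j),
      0 ≤ ((x : ℂ) + (1 / ((n : ℝ) + 1) : ℝ) * Complex.I - r j).im := fun n x j => by
    rw [Complex.sub_im, Complex.add_im, Complex.im_ofReal_mul]
    simpa using (hy n).le
  have hcont : ∀ n : ℕ, Continuous fun x : ℝ =>
      ∏ j, upperInvSqrt (x + (1 / ((n : ℝ) + 1) : ℝ) * Complex.I - r j) := fun n =>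
    continuous_finsetProd _ fun j _ => continuous_iff_continuousAt.2 fun x =>
      ((differentiableAt_upperInvSqrt (hne n x j) (him n x j)).continuousAt).comp
        (f := fun x : ℝ => (x : ℂ) + (1 / ((n : ℝ) + 1) : ℝ) * Complex.I - r j) (by fun_prop)
  have h := MeasureTheory.tendsto_integral_of_dominated_convergence
    (F := fun (n : ℕ) (x : ℝ) => ∏ j, upperInvSqrt (x + (1 / ((n : ℝ) + 1) : ℝ) * Complex.I - r j))
    (f := fun x : ℝ => ∏ j, upperInvSqrt ((x - r j : ℝ) : ℂ))
    (fun x => (√|∏ j, (x - r j)|)⁻¹) (fun n => (hcont n).aestronglyMeasurable)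
    (integrable_inv_sqrt_abs_prod hr) (fun n => by
      filter_upwards [hae] with x hx
      rw [norm_prod, Finset.abs_prod, Real.sqrt_prod _ fun _ _ => abs_nonneg _,
        ← Finset.prod_inv_distrib]
      refine Finset.prod_le_prod (fun j _ => by positivity) fun j _ => ?_
      have hx' : x - r j ≠ 0 := fun h => hx ⟨j, by linarith⟩
      rw [norm_upperInvSqrt (hne n x j)]
      refine inv_anti₀ (Real.sqrt_pos.2 (abs_pos.2 hx')) (Real.sqrt_le_sqrt ?_)
      refine le_trans ?_ (Complex.abs_re_le_norm _)
      simp) (by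
      filter_upwards [hae] with x hx
      refine tendsto_finsetProd _ fun j _ => ?_
      have hx' : x - r j ≠ 0 := fun h => hx ⟨j, by linarith⟩
      have h1 : ContinuousAt upperInvSqrt ((x - r j : ℝ) : ℂ) :=
        (differentiableAt_upperInvSqrt (by exact_mod_cast hx') (by simp)).continuousAt
      refine h1.tendsto.comp ?_
      have h2 : Filter.Tendsto (fun n : ℕ => ((1 / ((n : ℝ) + 1) : ℝ) : ℂ)) Filter.atTop (nhds 0) := by
        have := (Complex.continuous_ofReal.tendsto 0).comp
          (tendsto_one_div_add_atTop_nhds_zero_nat (𝕜 := ℝ))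
        simpa [Function.comp_def] using this
      have h3 := ((h2.mul_const Complex.I).const_add (x : ℂ)).sub_const (r j : ℂ)
      simpa using h3)
  simp only [integral_upperInvSqrt_horizontal_eq_zero hr (hy _)] at h
  exact tendsto_nhds_unique h tendsto_const_nhds

/-- Cauchy's theorem on the upper half plane for `1 / √quintic`: a linear relation between three
real period integrals. -/
theorem integral_inv_sqrt_quintic_relation (hr : StrictMono r) :
    ∫ x in Set.Ioo (r 1) (r 2), (√|∏ j, (x - r j)|)⁻¹ =
      (∫ x in Set.Iio (r 0), (√|∏ j, (x - r j)|)⁻¹) +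
        ∫ x in Set.Ioo (r 3) (r 4), (√|∏ j, (x - r j)|)⁻¹ := by
  have hint := integrable_inv_sqrt_abs_prod hr.injective
  set f : ℝ → ℝ := fun x => (√|∏ j, (x - r j)|)⁻¹ with hf
  have hae : ∀ᵐ x : ℝ, x ∉ Set.range r := (Set.finite_range r).countable.ae_notMem _
  have h01 : r 0 < r 1 := hr (by decide)
  have h12 : r 1 < r 2 := hr (by decide)
  have h23 : r 2 < r 3 := hr (by decide)
  have h34 : r 3 < r 4 := hr (by decide)
  have hG : ∀ᵐ x : ℝ, ∏ j, upperInvSqrt ((x - r j : ℝ) : ℂ) =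
      f x * ∏ j, (if x < r j then -Complex.I else 1) := by
    filter_upwards [hae] with x hx
    have hx' : ∀ j, x - r j ≠ 0 := fun j h => hx ⟨j, by linarith⟩
    rw [hf]
    simp only
    rw [Finset.abs_prod, Real.sqrt_prod _ fun _ _ => abs_nonneg _, ← Finset.prod_inv_distrib,
      Complex.ofReal_prod, ← Finset.prod_mul_distrib]
    exact Finset.prod_congr rfl fun j _ => by simp only [upperInvSqrt_ofReal (hx' j), sub_neg]
  -- From left to right the phases on the six intervals are `-I, 1, I, -1, -I, 1`, so only the
  -- first, third and fifth have an imaginary part.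
  have him : ∀ᵐ x : ℝ, (∏ j, upperInvSqrt ((x - r j : ℝ) : ℂ)).im =
      (Set.Ioo (r 1) (r 2)).indicator f x - (Set.Iio (r 0)).indicator f x -
        (Set.Ioo (r 3) (r 4)).indicator f x := by
    filter_upwards [hG, hae] with x hx hx'
    have hne : ∀ j, x ≠ r j := fun j h => hx' ⟨j, h.symm⟩
    rw [hx, Complex.im_ofReal_mul, Fin.prod_univ_five]
    simp only [Set.indicator_apply, Set.mem_Ioo, Set.mem_Iio]
    have n0 := hne 0
    have n1 := hne 1
    have n2 := hne 2
    have n3 := hne 3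
    have n4 := hne 4
    rcases n0.lt_or_gt with l0 | l0
    · have l1 := l0.trans h01
      have l2 := l1.trans h12
      have l3 := l2.trans h23
      have l4 := l3.trans h34
      simp [l0, l1, l2, l3, l4, l1.not_gt, l3.not_gt]
    rcases n1.lt_or_gt with l1 | l1
    · have l2 := l1.trans h12
      have l3 := l2.trans h23
      have l4 := l3.trans h34
      simp [l0.not_gt, l1, l2, l3, l4, l1.not_gt, l3.not_gt]
    rcases n2.lt_or_gt with l2 | l2
    · have l3 := l2.trans h23
      have l4 := l3.trans h34
      simp [l0.not_gt, l1, l2, l3, l4, l1.not_gt, l3.not_gt]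
    rcases n3.lt_or_gt with l3 | l3
    · have l4 := l3.trans h34
      simp [l0.not_gt, l1, l2.not_gt, l3, l4, l1.not_gt, l3.not_gt]
    rcases n4.lt_or_gt with l4 | l4
    · simp [l0.not_gt, l1, l2.not_gt, l3, l4, l1.not_gt, l3.not_gt]
    · simp [l0.not_gt, l1, l2.not_gt, l4.not_gt, l1.not_gt, l3.not_gt]
  have hGint : MeasureTheory.Integrable fun x : ℝ => ∏ j, upperInvSqrt ((x - r j : ℝ) : ℂ) := by
    refine (hint.mono' (f := fun x => (f x : ℂ) * ∏ j, (if x < r j then -Complex.I else 1))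
      ?_ ?_).congr (hG.mono fun x hx => hx.symm)
    · refine (Complex.continuous_ofReal.comp_aestronglyMeasurable
        hint.aestronglyMeasurable).mul (Measurable.aestronglyMeasurable ?_)
      exact Finset.measurable_prod _ fun j _ =>
        Measurable.ite measurableSet_Iio measurable_const measurable_const
    · refine Filter.Eventually.of_forall fun x => ?_
      rw [norm_mul, norm_prod, Complex.norm_real,
        Real.norm_of_nonneg (by simp only [hf]; positivity)]
      refine mul_le_of_le_one_right (by simp only [hf]; positivity)
        (Finset.prod_le_one (fun _ _ => norm_nonneg _) fun j _ => ?_)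
      split_ifs <;> simp
  have h := integral_upperInvSqrt_eq_zero hr.injective
  have h2 := congrArg Complex.im h
  have h3 : ∫ x : ℝ, (∏ j, upperInvSqrt ((x - r j : ℝ) : ℂ)).im = 0 := by
    have h4 := Complex.imCLM.integral_comp_comm hGint
    simp only [Complex.imCLM_apply] at h4
    rw [h4, h2, Complex.zero_im]
  have iA := hint.indicator (measurableSet_Ioo (a := r 1) (b := r 2))
  have iB := hint.indicator (measurableSet_Iio (a := r 0))
  have iC := hint.indicator (measurableSet_Ioo (a := r 3) (b := r 4))
  have e₁ := MeasureTheory.integral_sub (iA.sub iB) iC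
  simp only [Pi.sub_apply] at e₁
  rw [MeasureTheory.integral_congr_ae him, e₁, MeasureTheory.integral_sub iA iB,
    MeasureTheory.integral_indicator measurableSet_Ioo,
    MeasureTheory.integral_indicator measurableSet_Iio,
    MeasureTheory.integral_indicator measurableSet_Ioo] at h3
  linarith

end Contour

/-! ### Reduction to integrals with a fixed weight and the kernel `1 / √(1 - κ x²)`. -/

/-- The weight `√x / √((5 x - 3 ε) (1 - x²))`; it vanishes for `ε = 1` and `x ≤ 3/5`. -/
noncomputable def ellipticWeight (ε x : ℝ) : ℝ := √x / √((5 * x - 3 * ε) * (1 - x ^ 2))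

/-- The kernel `1 / √(1 - κ x²)`. -/
noncomputable def ellipticKernel (κ x : ℝ) : ℝ := (√(1 - κ * x ^ 2))⁻¹

/-- The period integrals as functions of the modulus `κ`. -/
noncomputable def ellipticPeriod (ε κ : ℝ) : ℝ :=
  ∫ x in Set.Ioo (0 : ℝ) 1, ellipticWeight ε x * ellipticKernel κ x

theorem one_sub_mul_sq_pos {κ x : ℝ} (hκ : κ < 1) (hx : x ∈ Set.Ioo (0 : ℝ) 1) :
    0 < 1 - κ * x ^ 2 := by
  have h1 : x ^ 2 < 1 := by nlinarith [hx.1, hx.2]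
  have h0 : 0 < x ^ 2 := pow_pos hx.1 2
  nlinarith

/-- The five roots of the quintic. -/
noncomputable def quinticRoots (δ : ℝ) : Fin 5 → ℝ := ![-3 / 2, -3 / 4 - δ, -3 / 4 + δ, 0, 1 / 2]

theorem strictMono_quinticRoots {δ : ℝ} (h0 : 0 < δ) (h1 : δ < 3 / 4) :
    StrictMono (quinticRoots δ) := by
  rw [Fin.strictMono_iff_lt_succ]
  intro i
  fin_cases i <;> simp [quinticRoots] <;> linarith

theorem prod_sub_quinticRoots (δ s : ℝ) : ∏ j, (s - quinticRoots δ j) =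
    (s + 3 / 2) * ((s + 3 / 4) ^ 2 - δ ^ 2) * s * (s - 1 / 2) := by
  rw [Fin.prod_univ_five]
  change (s - -3 / 2) * (s - (-3 / 4 - δ)) * (s - (-3 / 4 + δ)) * (s - 0) * (s - 1 / 2) = _
  ring

/-- The roots `-3/4 ± δ` and the roots `-3/2`, `0` are both symmetric about `-3/4`. Inversion about
that point turns these pairs into the factors `1 - κ x²` and `1 - x²`, while the root `1/2` gives `5
x - 3 ε`. The whole dependence on `δ` sits in `κ`. -/
theorem abs_deriv_mul_inv_sqrt {ε δ x : ℝ} (hε : ε = 1 ∨ ε = -1) (h1 : |δ| < 3 / 4)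
    (hx : x ∈ Set.Ioo (0 : ℝ) 1) (hxε : 0 < 5 * x - 3 * ε) :
    |-(ε * (3 / 4) / x ^ 2)| *
        (√|∏ j, (ε * (3 / 4) / x - 3 / 4 - quinticRoots δ j)|)⁻¹ =
      8 / 3 * (ellipticWeight ε x * ellipticKernel ((4 / 3 * δ) ^ 2) x) := by
  obtain ⟨hx0, hx1⟩ := hx
  have hκ : (4 / 3 * δ) ^ 2 < 1 := by
    have := abs_lt.1 h1
    nlinarith
  have hk := one_sub_mul_sq_pos hκ ⟨hx0, hx1⟩
  have hx2 : 0 < 1 - x ^ 2 := by nlinarith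
  have hε2 : ε ^ 2 = 1 := by rcases hε with rfl | rfl <;> norm_num
  have habs : |ε| = 1 := by rcases hε with rfl | rfl <;> simp
  have hprod : ∏ j, (ε * (3 / 4) / x - 3 / 4 - quinticRoots δ j) =
      -((9 / 32 / x ^ 3) ^ 2 * (x * ((5 * x - 3 * ε) * (1 - x ^ 2)) *
        (1 - (4 / 3 * δ) ^ 2 * x ^ 2))) := by
    rw [prod_sub_quinticRoots]
    rcases hε with rfl | rfl
    · field_simp
      ring
    · field_simp
      ring
  have hA : 0 < (5 * x - 3 * ε) * (1 - x ^ 2) := by positivity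
  have hder : |-(ε * (3 / 4) / x ^ 2)| = 3 / 4 / x ^ 2 := by
    rw [abs_neg, abs_div, abs_mul, habs, one_mul, abs_of_pos (by positivity : 0 < x ^ 2),
      abs_of_pos (by norm_num : (0 : ℝ) < 3 / 4)]
  rw [hprod, hder, abs_neg, abs_of_pos (by positivity), Real.sqrt_mul (by positivity),
    Real.sqrt_sq (by positivity), Real.sqrt_mul (by positivity), Real.sqrt_mul hx0.le,
    ellipticWeight, ellipticKernel]
  have s1 : √x ^ 2 = x := Real.sq_sqrt hx0.le
  have s2 := Real.sqrt_pos.2 hx0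
  have s3 := Real.sqrt_pos.2 hA
  have s4 := Real.sqrt_pos.2 hk
  field_simp
  rw [s1]
  ring

section EllipticPeriods

open MeasureTheory

theorem image_inv_sub {a ε : ℝ} (hε : ε = 1) (ha : 0 < a) (ha1 : a < 1) :
    (fun x => ε * (3 / 4) / x - 3 / 4) '' Set.Ioo a 1 = Set.Ioo 0 (3 / 4 / a - 3 / 4) := by
  subst hε
  ext s
  simp only [Set.mem_image, Set.mem_Ioo, one_mul]
  constructor
  · rintro ⟨x, ⟨h1, h2⟩, rfl⟩
    have hx : 0 < x := ha.trans h1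
    refine ⟨?_, ?_⟩
    · rw [sub_pos, lt_div_iff₀ hx]
      linarith
    · gcongr
  · rintro ⟨h1, h2⟩
    have hs : 0 < s + 3 / 4 := by linarith
    refine ⟨3 / 4 / (s + 3 / 4), ⟨?_, ?_⟩, by field_simp; ring⟩
    · rw [lt_div_iff₀ hs, ← lt_div_iff₀' ha]
      linarith
    · rw [div_lt_one hs]
      linarith

theorem image_neg_inv_sub {ε : ℝ} (hε : ε = -1) :
    (fun x => ε * (3 / 4) / x - 3 / 4) '' Set.Ioo 0 1 = Set.Iio (-3 / 2) := by
  subst hε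
  ext s
  simp only [Set.mem_image, Set.mem_Ioo, Set.mem_Iio]
  constructor
  · rintro ⟨x, ⟨h1, h2⟩, rfl⟩
    have : 3 / 4 < 3 / 4 / x := by
      rw [lt_div_iff₀ h1]
      linarith
    have e : -1 * (3 / 4) / x = -(3 / 4 / x) := by ring
    linarith
  · intro h
    have hs : 0 < -(s + 3 / 4) := by linarith
    have hs' : s + 3 / 4 ≠ 0 := by linarith
    refine ⟨3 / 4 / -(s + 3 / 4), ⟨by positivity, ?_⟩, by field_simp; ring⟩
    rw [div_lt_one hs]
    linarith

/-- The substitution `s + 3/4 = ε (3/4) / x`. -/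
theorem integral_image_inv_sub {ε δ : ℝ} {S : Set ℝ} (hε : ε = 1 ∨ ε = -1) (h1 : |δ| < 3 / 4)
    (hS : MeasurableSet S) (hS1 : S ⊆ Set.Ioo 0 1) (hSε : ∀ x ∈ S, 0 < 5 * x - 3 * ε) :
    (∫ s in (fun x => ε * (3 / 4) / x - 3 / 4) '' S, (√|∏ j, (s - quinticRoots δ j)|)⁻¹ =
      8 / 3 * ∫ x in S, ellipticWeight ε x * ellipticKernel ((4 / 3 * δ) ^ 2) x) ∧
    (IntegrableOn (fun s => (√|∏ j, (s - quinticRoots δ j)|)⁻¹)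
        ((fun x => ε * (3 / 4) / x - 3 / 4) '' S) →
      IntegrableOn (fun x => ellipticWeight ε x * ellipticKernel ((4 / 3 * δ) ^ 2) x) S) := by
  have hε0 : ε ≠ 0 := by rcases hε with rfl | rfl <;> norm_num
  have hd : ∀ x ∈ S, HasDerivWithinAt (fun x => ε * (3 / 4) / x - 3 / 4)
      (-(ε * (3 / 4) / x ^ 2)) S x := fun x hx => by
    have hx0 := (hS1 hx).1.ne'
    refine ((((hasDerivAt_inv hx0).const_mul (ε * (3 / 4))).sub_const (3 / 4)).congr_deriv
      ?_).hasDerivWithinAt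
    ring
  have hinj : Set.InjOn (fun x => ε * (3 / 4) / x - 3 / 4) S := fun x hx y hy h => by
    have hx0 := (hS1 hx).1.ne'
    have hy0 := (hS1 hy).1.ne'
    simp only [sub_left_inj] at h
    rw [div_eq_div_iff hx0 hy0] at h
    exact (mul_left_cancel₀ (mul_ne_zero hε0 (by norm_num)) h).symm
  have hcongr : ∀ x ∈ S, |-(ε * (3 / 4) / x ^ 2)| •
      (√|∏ j, (ε * (3 / 4) / x - 3 / 4 - quinticRoots δ j)|)⁻¹ =
        8 / 3 * (ellipticWeight ε x * ellipticKernel ((4 / 3 * δ) ^ 2) x) := fun x hx => by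
    rw [smul_eq_mul, abs_deriv_mul_inv_sqrt hε h1 (hS1 hx) (hSε x hx)]
  constructor
  · rw [integral_image_eq_integral_abs_deriv_smul hS hd hinj, ← integral_const_mul]
    exact setIntegral_congr_fun hS hcongr
  · intro h
    rw [integrableOn_image_iff_integrableOn_abs_deriv_smul hS hd hinj] at h
    have h2 := (integrableOn_congr_fun hcongr hS).1 h
    have h3 := h2.const_mul (3 / 8)
    refine h3.congr (Filter.Eventually.of_forall fun x => ?_)
    simp only
    ring

theorem ellipticWeight_one_eq_zero {x : ℝ} (h0 : 0 < x) (hx : x ≤ 3 / 5) : ellipticWeight 1 x = 0 := by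
  have h : √((5 * x - 3 * 1) * (1 - x ^ 2)) = 0 := Real.sqrt_eq_zero_of_nonpos
    (mul_nonpos_of_nonpos_of_nonneg (by linarith) (by nlinarith))
  rw [ellipticWeight, h, div_zero]

theorem integrableOn_weight_mul_kernel {δ : ℝ} (h0 : 0 < δ) (h1 : δ < 3 / 4) :
    IntegrableOn (fun x => ellipticWeight 1 x * ellipticKernel ((4 / 3 * δ) ^ 2) x) (Set.Ioo 0 1) ∧
    IntegrableOn (fun x => ellipticWeight (-1) x * ellipticKernel ((4 / 3 * δ) ^ 2) x)
      (Set.Ioo 0 1) := by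
  have hint := integrable_inv_sqrt_abs_prod (strictMono_quinticRoots h0 h1).injective
  have hδ : |δ| < 3 / 4 := by rwa [abs_of_pos h0]
  constructor
  · have h := (integral_image_inv_sub (ε := 1) (S := Set.Ioo (3 / 5) 1) (Or.inl rfl) hδ
      measurableSet_Ioo (Set.Ioo_subset_Ioo_left (by norm_num))
      (fun x hx => by linarith [hx.1])).2 hint.integrableOn
    have h2 : IntegrableOn (fun x => ellipticWeight 1 x * ellipticKernel ((4 / 3 * δ) ^ 2) x)
        (Set.Ioc 0 (3 / 5)) := by
      refine IntegrableOn.congr_fun (f := fun _ => (0 : ℝ)) integrableOn_zero (fun x hx => ?_) measurableSet_Ioc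
      simp only [ellipticWeight_one_eq_zero hx.1 hx.2, zero_mul]
    have := h2.union h
    rwa [Set.Ioc_union_Ioo_eq_Ioo (by norm_num) (by norm_num)] at this
  · exact (integral_image_inv_sub (ε := -1) (S := Set.Ioo 0 1) (Or.inr rfl) hδ measurableSet_Ioo
      subset_rfl (fun x hx => by linarith [hx.1])).2 hint.integrableOn

/-- For `0 ≤ κ < 1` the kernel is at least `1`, so the weight is dominated by a product already
known to be integrable. Any `δ` in `(0, 3/4)` serves, and `1/2` is a convenient choice. -/
theorem integrableOn_ellipticWeight {ε : ℝ} (hε : ε = 1 ∨ ε = -1) :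
    IntegrableOn (ellipticWeight ε) (Set.Ioo 0 1) := by
  have h : IntegrableOn (fun x => ellipticWeight ε x * ellipticKernel ((4 / 3 * (1 / 2)) ^ 2) x)
      (Set.Ioo 0 1) := by
    obtain ⟨h1, h2⟩ := integrableOn_weight_mul_kernel (δ := 1 / 2) (by norm_num) (by norm_num)
    rcases hε with rfl | rfl
    exacts [h1, h2]
  refine Integrable.mono' h (Measurable.aestronglyMeasurable
    (by unfold ellipticWeight; fun_prop)) ?_
  filter_upwards [ae_restrict_mem measurableSet_Ioo] with x hx
  have hpos : 0 ≤ ellipticWeight ε x := by unfold ellipticWeight; positivity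
  rw [Real.norm_of_nonneg hpos]
  refine le_mul_of_one_le_right hpos ?_
  have := one_sub_mul_sq_pos (κ := (4 / 3 * (1 / 2)) ^ 2) (by norm_num) hx
  rw [ellipticKernel]
  refine (one_le_inv₀ (Real.sqrt_pos.2 this)).2 (Real.sqrt_le_one.2 ?_)
  have := sq_nonneg x
  linarith

theorem quintic_eq (p s : ℝ) :
    quintic p s = -8 * ∏ j, (s - quinticRoots |2 * p ^ 2 - 3 / 4| j) := by
  rw [prod_sub_quinticRoots, sq_abs, quintic]
  ring

theorem abs_two_mul_sq_sub {p : ℝ} (hp : 0 < p) (hp' : p ^ 2 < 3 / 4) (hne : p ^ 2 ≠ 3 / 8) :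
    0 < |2 * p ^ 2 - 3 / 4| ∧ |2 * p ^ 2 - 3 / 4| < 3 / 4 := by
  have : 0 < p ^ 2 := by positivity
  exact ⟨abs_pos.2 fun h => hne (by linarith), by rw [abs_lt]; constructor <;> linarith⟩

theorem one_div_sqrt_quintic {p s : ℝ} (h : 0 ≤ quintic p s) : 1 / √(quintic p s) =
    (√8)⁻¹ * (√|∏ j, (s - quinticRoots |2 * p ^ 2 - 3 / 4| j)|)⁻¹ := by
  have : quintic p s = 8 * |∏ j, (s - quinticRoots |2 * p ^ 2 - 3 / 4| j)| := by
    rw [← abs_of_nonneg h, quintic_eq, abs_mul]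
    norm_num
  rw [this, Real.sqrt_mul (by norm_num), one_div, mul_inv]

theorem quintic_nonneg_of_mem_Icc {p s : ℝ} (hp : 0 < p) (hp' : p ^ 2 < 3 / 4)
    (hs : s ∈ Set.Icc 0 (1 / 2)) : 0 ≤ quintic p s := by
  obtain ⟨h0, h1⟩ := hs
  have := sq_nonneg p
  have h2 : 0 ≤ 1 - 2 * s := by linarith
  have h3 : 0 ≤ 3 - 4 * p ^ 2 + 2 * s := by linarith
  rw [quintic]
  positivity

theorem lowerRoot_le_upperRoot (p : ℝ) : lowerRoot p ≤ upperRoot p := min_le_max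

theorem quintic_nonneg_of_mem_roots {p s : ℝ} (hp : 0 < p) (hp' : p ^ 2 < 3 / 4)
    (hs : s ∈ Set.Icc (lowerRoot p) (upperRoot p)) : 0 ≤ quintic p s := by
  rw [lowerRoot_eq, upperRoot_eq] at hs
  have h0 : |2 * p ^ 2 - 3 / 4| < 3 / 4 := by
    have : 0 < p ^ 2 := by positivity
    rw [abs_lt]; constructor <;> linarith
  have h1 : (s + 3 / 4) ^ 2 ≤ (2 * p ^ 2 - 3 / 4) ^ 2 := by
    rw [← sq_abs (2 * p ^ 2 - 3 / 4)]
    exact sq_le_sq' (by linarith [hs.1]) (by linarith [hs.2])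
  have h2 : 0 ≤ -s := by linarith [hs.2]
  have h3 : 0 ≤ 1 - 2 * s := by linarith
  have h4 : 0 ≤ 3 + 2 * s := by linarith [hs.1]
  have e : quintic p s =
      (-s) * (1 - 2 * s) * (3 + 2 * s) * (2 * ((2 * p ^ 2 - 3 / 4) ^ 2 - (s + 3 / 4) ^ 2)) := by
    rw [quintic]
    ring
  rw [e]
  have h5 : 0 ≤ 2 * ((2 * p ^ 2 - 3 / 4) ^ 2 - (s + 3 / 4) ^ 2) := by linarith
  positivity

theorem intervalIntegrable_quintic_of_ne {p : ℝ} (hp : 0 < p) (hp' : p ^ 2 < 3 / 4)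
    (hne : p ^ 2 ≠ 3 / 8) :
    IntervalIntegrable (fun s => 1 / √(quintic p s)) volume 0 (1 / 2) ∧
      IntervalIntegrable (fun s => 1 / √(quintic p s)) volume (lowerRoot p) (upperRoot p) := by
  obtain ⟨h0, h1⟩ := abs_two_mul_sq_sub hp hp' hne
  have hint := (integrable_inv_sqrt_abs_prod (strictMono_quinticRoots h0 h1).injective).const_mul
    (√8)⁻¹
  constructor
  · refine (hint.intervalIntegrable (a := 0) (b := 1 / 2)).congr fun s hs => ?_
    rw [Set.uIoc_of_le (by norm_num)] at hs
    exact (one_div_sqrt_quintic (quintic_nonneg_of_mem_Icc hp hp' ⟨hs.1.le, hs.2⟩)).symm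
  · refine (hint.intervalIntegrable (a := lowerRoot p) (b := upperRoot p)).congr fun s hs => ?_
    rw [Set.uIoc_of_le (lowerRoot_le_upperRoot p)] at hs
    exact (one_div_sqrt_quintic (quintic_nonneg_of_mem_roots hp hp' ⟨hs.1.le, hs.2⟩)).symm

/-- The two hyperelliptic periods in terms of the integrals `ellipticPeriod`. -/
theorem periods_eq {p : ℝ} (hp : 0 < p) (hp' : p ^ 2 < 3 / 4) (hne : p ^ 2 ≠ 3 / 8) :
    periodU p = 2 * (√8)⁻¹ * (8 / 3 * ellipticPeriod 1 (((8 * p ^ 2 - 3) / 3) ^ 2)) ∧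
    periodV p = periodU p +
      2 * (√8)⁻¹ * (8 / 3 * ellipticPeriod (-1) (((8 * p ^ 2 - 3) / 3) ^ 2)) := by
  obtain ⟨h0, h1⟩ := abs_two_mul_sq_sub hp hp' hne
  have hκ : (4 / 3 * |2 * p ^ 2 - 3 / 4|) ^ 2 = ((8 * p ^ 2 - 3) / 3) ^ 2 := by
    rw [mul_pow, sq_abs]
    ring
  have hrel := integral_inv_sqrt_quintic_relation (strictMono_quinticRoots h0 h1)
  have hδ : |(|2 * p ^ 2 - 3 / 4|)| < 3 / 4 := by rwa [abs_abs]
  have hU := (integral_image_inv_sub (ε := 1) (S := Set.Ioo (3 / 5) 1) (Or.inl rfl) hδ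
      measurableSet_Ioo (Set.Ioo_subset_Ioo_left (by norm_num))
      (fun x hx => by linarith [hx.1])).1
  have hW := (integral_image_inv_sub (ε := -1) (S := Set.Ioo 0 1) (Or.inr rfl) hδ measurableSet_Ioo
      subset_rfl (fun x hx => by linarith [hx.1])).1
  rw [image_inv_sub rfl (by norm_num) (by norm_num),
    show (3 / 4 / (3 / 5) - 3 / 4 : ℝ) = 1 / 2 by norm_num, hκ] at hU
  rw [image_neg_inv_sub rfl, hκ] at hW
  have hU' : ∫ x in Set.Ioo (3 / 5 : ℝ) 1,
      ellipticWeight 1 x * ellipticKernel (((8 * p ^ 2 - 3) / 3) ^ 2) x =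
        ellipticPeriod 1 (((8 * p ^ 2 - 3) / 3) ^ 2) := by
    refine (setIntegral_eq_of_subset_of_forall_sdiff_eq_zero measurableSet_Ioo
      (Set.Ioo_subset_Ioo_left (by norm_num)) fun x hx => ?_).symm
    have : x ≤ 3 / 5 := by
      by_contra h
      exact hx.2 ⟨not_le.1 h, hx.1.2⟩
    rw [ellipticWeight_one_eq_zero hx.1.1 this, zero_mul]
  have eU : periodU p = 2 * (√8)⁻¹ * (8 / 3 * ellipticPeriod 1 (((8 * p ^ 2 - 3) / 3) ^ 2)) := by
    rw [← hU', ← hU, periodU, intervalIntegral.integral_of_le (by norm_num),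
      integral_Ioc_eq_integral_Ioo, mul_assoc]
    congr 1
    rw [← integral_const_mul]
    exact setIntegral_congr_fun measurableSet_Ioo fun s hs =>
      one_div_sqrt_quintic (quintic_nonneg_of_mem_Icc hp hp' ⟨hs.1.le, hs.2.le⟩)
  have eV : periodV p = 2 * (√8)⁻¹ * ∫ x in Set.Ioo (lowerRoot p) (upperRoot p),
      (√|∏ j, (x - quinticRoots |2 * p ^ 2 - 3 / 4| j)|)⁻¹ := by
    rw [periodV, intervalIntegral.integral_of_le (lowerRoot_le_upperRoot p),
      integral_Ioc_eq_integral_Ioo, mul_assoc]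
    congr 1
    rw [← integral_const_mul]
    exact setIntegral_congr_fun measurableSet_Ioo fun s hs =>
      one_div_sqrt_quintic (quintic_nonneg_of_mem_roots hp hp' ⟨hs.1.le, hs.2.le⟩)
  refine ⟨eU, ?_⟩
  rw [eU, eV, lowerRoot_eq, upperRoot_eq]
  change ∫ x in Set.Ioo (-3 / 4 - |2 * p ^ 2 - 3 / 4|) (-3 / 4 + |2 * p ^ 2 - 3 / 4|), _ =
    (∫ x in Set.Iio (-3 / 2), _) + ∫ x in Set.Ioo 0 (1 / 2), _ at hrel
  rw [hrel, hU, hW, hU', ellipticPeriod, ellipticPeriod]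
  ring

/-- At `p² = 3/8` two roots coincide, but outside the interval. There `(2p² + s)(3 - 4p² + 2s)` is
largest as a function of `p`, so the integrand is dominated by the one for `p = 1/2`, which has
distinct roots. -/
theorem intervalIntegrable_quintic {p : ℝ} (hp : 0 < p) (hp' : p ^ 2 < 3 / 4) :
    IntervalIntegrable (fun s => 1 / √(quintic p s)) volume 0 (1 / 2) := by
  by_cases hne : p ^ 2 = 3 / 8
  · refine (intervalIntegrable_quintic_of_ne (p := 1 / 2) (by norm_num) (by norm_num)
      (by norm_num)).1.mono_fun' (Measurable.aestronglyMeasurable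
        (by unfold quintic; fun_prop)) ?_
    rw [Filter.EventuallyLE, ae_restrict_iff' measurableSet_uIoc]
    refine Filter.Eventually.of_forall fun s hs => ?_
    rw [Set.uIoc_of_le (by norm_num)] at hs
    have hs0 := hs.1
    rw [Real.norm_of_nonneg (by positivity)]
    rcases hs.2.lt_or_eq with hs1 | rfl
    · have h2 : 0 < 1 - 2 * s := by linarith
      refine one_div_le_one_div_of_le (Real.sqrt_pos.2 ?_) (Real.sqrt_le_sqrt ?_)
      · norm_num [quintic]
        positivity
      · have e : quintic p s = quintic (1 / 2) s + s * (1 - 2 * s) * (3 + 2 * s) * (1 / 8) := by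
          have : quintic p s = s * (1 - 2 * s) * (3 + 2 * s) * (2 * p ^ 2 + s) *
            (3 - 4 * p ^ 2 + 2 * s) := rfl
          rw [this, hne, quintic]
          ring
        rw [e]
        have : 0 ≤ s * (1 - 2 * s) * (3 + 2 * s) * (1 / 8) := by positivity
        linarith
    · norm_num [quintic]
  · exact (intervalIntegrable_quintic_of_ne hp hp' hne).1

end EllipticPeriods

/-! ### Bounds for the ratio of the periods. -/

section PeriodComparison

open MeasureTheory Set

theorem integrableOn_and_integral_eq_of_hasDerivAt_nonneg {F f : ℝ → ℝ} {a b : ℝ} (hab : a ≤ b)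
    (hc : ContinuousOn F (Icc a b)) (hd : ∀ x ∈ Ioo a b, HasDerivAt F (f x) x)
    (hf : ∀ x ∈ Ioo a b, 0 ≤ f x) :
    IntegrableOn f (Ioo a b) ∧ ∫ x in Ioo a b, f x = F b - F a := by
  have h := intervalIntegral.integrableOn_deriv_of_nonneg hc hd hf
  refine ⟨h.mono_set Ioo_subset_Ioc_self, ?_⟩
  rw [← integral_Ioc_eq_integral_Ioo, ← intervalIntegral.integral_of_le hab]
  exact intervalIntegral.integral_eq_sub_of_hasDerivAt_of_le hab hc hd
    ((intervalIntegrable_iff_integrableOn_Ioc_of_le hab).2 h)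

theorem hasDerivAt_linear_arcsin (α β : ℝ) {x : ℝ} (hx : 0 < 1 - x ^ 2) :
    HasDerivAt (fun x => α * Real.arcsin x - β * √(1 - x ^ 2)) ((α + β * x) / √(1 - x ^ 2)) x := by
  have h1 : x ≠ -1 := by rintro rfl; norm_num at hx
  have h2 : x ≠ 1 := by rintro rfl; norm_num at hx
  have h3 : HasDerivAt (fun x : ℝ => 1 - x ^ 2) (-(2 * x)) x := by
    simpa using (hasDerivAt_pow 2 x).const_sub 1
  refine (((Real.hasDerivAt_arcsin h1 h2).const_mul α).sub
    ((h3.sqrt hx.ne').const_mul β)).congr_deriv ?_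
  have := (Real.sqrt_pos.2 hx).ne'
  field_simp
  ring

/-- Integrals of `(α + β x) / √(1 - x²)` up to the singular end point `1`. -/
theorem integral_linear_div_sqrt {α β a : ℝ} (ha : 0 ≤ a) (ha1 : a ≤ 1) (hα : 0 ≤ α)
    (hβ : 0 ≤ β) :
    IntegrableOn (fun x => (α + β * x) / √(1 - x ^ 2)) (Ioo a 1) ∧
    ∫ x in Ioo a 1, (α + β * x) / √(1 - x ^ 2) =
      α * (Real.pi / 2 - Real.arcsin a) + β * √(1 - a ^ 2) := by
  have h := integrableOn_and_integral_eq_of_hasDerivAt_nonneg (a := a) (b := 1) ha1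
    (F := fun x => α * Real.arcsin x - β * √(1 - x ^ 2))
    (f := fun x => (α + β * x) / √(1 - x ^ 2)) ?_
    (fun x hx => hasDerivAt_linear_arcsin α β (by nlinarith [hx.1, hx.2]))
    (fun x hx => by
      have := ha.trans hx.1.le
      positivity)
  · refine ⟨h.1, h.2.trans ?_⟩
    simp only [Real.arcsin_one]
    norm_num
    ring
  · exact ((continuous_const.mul Real.continuous_arcsin).sub
      (continuous_const.mul (by fun_prop))).continuousOn

theorem ellipticWeight_nonneg (ε x : ℝ) : 0 ≤ ellipticWeight ε x := by
  unfold ellipticWeight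
  positivity

theorem ellipticWeight_eq {ε x : ℝ} (hx : 0 ≤ 5 * x - 3 * ε) :
    ellipticWeight ε x = √(x / (5 * x - 3 * ε)) / √(1 - x ^ 2) := by
  rw [ellipticWeight, Real.sqrt_mul hx, Real.sqrt_div' _ hx, div_div]

theorem ellipticKernel_pos {κ x : ℝ} (hκ : κ < 1) (hx : x ∈ Ioo (0 : ℝ) 1) :
    0 < ellipticKernel κ x :=
  inv_pos.2 (Real.sqrt_pos.2 (one_sub_mul_sq_pos hκ hx))

theorem ellipticKernel_le {κ x y : ℝ} (hκ0 : 0 ≤ κ) (hκ : κ < 1) (hx : 0 ≤ x)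
    (hy : y ∈ Ioo (0 : ℝ) 1) (hxy : x ≤ y) : ellipticKernel κ x ≤ ellipticKernel κ y := by
  refine inv_anti₀ (Real.sqrt_pos.2 (one_sub_mul_sq_pos hκ hy)) (Real.sqrt_le_sqrt ?_)
  have : x ^ 2 ≤ y ^ 2 := by gcongr
  nlinarith

theorem integrableOn_mul_ellipticKernel {D : ℝ → ℝ} (hD : IntegrableOn D (Ioo 0 1)) {κ : ℝ}
    (hκ0 : 0 ≤ κ) (hκ : κ < 1) :
    IntegrableOn (fun x => D x * ellipticKernel κ x) (Ioo 0 1) := by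
  refine Integrable.mul_bdd (c := (√(1 - κ))⁻¹) hD
    (Measurable.aestronglyMeasurable (by unfold ellipticKernel; fun_prop)) ?_
  filter_upwards [ae_restrict_mem measurableSet_Ioo] with x hx
  rw [Real.norm_of_nonneg (ellipticKernel_pos hκ hx).le]
  refine inv_anti₀ (Real.sqrt_pos.2 (by linarith)) (Real.sqrt_le_sqrt ?_)
  have : x ^ 2 ≤ 1 := by nlinarith [hx.1, hx.2]
  nlinarith

/-- On `(0, 1)` one has `x / (5 x + 3) ≤ 1/8`, the value at `x = 1`, which leaves an arcsine
integral. -/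
theorem integral_weight_neg_one_le :
    ∫ x in Ioo (0 : ℝ) 1, ellipticWeight (-1) x ≤ (√8)⁻¹ * (Real.pi / 2) := by
  obtain ⟨h1, h2⟩ := integral_linear_div_sqrt (α := (√8)⁻¹) (β := 0) (a := 0) le_rfl zero_le_one
    (by positivity) le_rfl
  simp only [Real.arcsin_zero, sub_zero, zero_mul, add_zero] at h1 h2
  rw [← h2]
  refine setIntegral_mono_on (integrableOn_ellipticWeight (Or.inr rfl)) h1 measurableSet_Ioo
    fun x hx => ?_
  have hx0 := hx.1
  have hx1 := hx.2
  rw [ellipticWeight_eq (by linarith), ← Real.sqrt_inv]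
  gcongr
  rw [div_le_iff₀ (by linarith)]
  linarith

theorem arcsin_three_fifths_lt : Real.arcsin (3 / 5) < Real.pi / 4 := by
  have hpi := Real.pi_pos
  rw [Real.arcsin_lt_iff_lt_sin' ⟨by linarith, by linarith⟩, Real.sin_pi_div_four]
  have := Real.sqrt_nonneg 2
  have h2 := Real.sq_sqrt (zero_le_two (α := ℝ))
  nlinarith

/-- On `(3/5, 1)` one has `x / (5 x - 3) ≥ 1/2`. Since `arcsin (3/5) < π/4`, the resulting bound
strictly exceeds the one for the other weight, because `(√8)⁻¹ * (π / 2) = (√2)⁻¹ * (π / 4)`. -/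
theorem lt_integral_weight_one :
    (√2)⁻¹ * (Real.pi / 4) < ∫ x in Ioo (3 / 5 : ℝ) 1, ellipticWeight 1 x := by
  obtain ⟨h1, h2⟩ := integral_linear_div_sqrt (α := (√2)⁻¹) (β := 0) (a := 3 / 5) (by norm_num)
    (by norm_num) (by positivity) le_rfl
  simp only [zero_mul, add_zero] at h1 h2
  calc (√2)⁻¹ * (Real.pi / 4) < (√2)⁻¹ * (Real.pi / 2 - Real.arcsin (3 / 5)) := by
        gcongr
        linarith [arcsin_three_fifths_lt]
    _ ≤ _ := by
        rw [← h2]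
        refine setIntegral_mono_on h1 ((integrableOn_ellipticWeight (Or.inl rfl)).mono_set
          (Ioo_subset_Ioo_left (by norm_num))) measurableSet_Ioo fun x hx => ?_
        have hx0 := hx.1
        have hx1 := hx.2
        rw [ellipticWeight_eq (by linarith), ← Real.sqrt_inv]
        gcongr
        rw [le_div_iff₀ (by linarith)]
        linarith

theorem setIntegral_weight_one_mul (g : ℝ → ℝ) :
    ∫ x in Ioo (0 : ℝ) 1, ellipticWeight 1 x * g x =
      ∫ x in Ioo (3 / 5 : ℝ) 1, ellipticWeight 1 x * g x := by
  refine setIntegral_eq_of_subset_of_forall_sdiff_eq_zero measurableSet_Ioo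
    (Ioo_subset_Ioo_left (by norm_num)) fun x hx => ?_
  have : x ≤ 3 / 5 := by
    by_contra h
    exact hx.2 ⟨not_le.1 h, hx.1.2⟩
  rw [ellipticWeight_one_eq_zero hx.1.1 this, zero_mul]

theorem integral_weight_neg_one_lt :
    ∫ x in Ioo (0 : ℝ) 1, ellipticWeight (-1) x < ∫ x in Ioo (0 : ℝ) 1, ellipticWeight 1 x := by
  have h := setIntegral_weight_one_mul fun _ => 1
  simp only [mul_one] at h
  rw [h]
  refine integral_weight_neg_one_le.trans_lt (lt_of_eq_of_lt ?_ lt_integral_weight_one)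
  rw [show (8 : ℝ) = 2 ^ 2 * 2 by norm_num, Real.sqrt_mul (by norm_num),
    Real.sqrt_sq (by norm_num), mul_inv]
  ring

/-- The difference of the weights is nonnegative left of `3/5` and nonpositive right of it, while
the kernel increases. Replacing the kernel by its value at `3/5` can only raise the integral of the
difference, which reduces the claim to `κ = 0`. -/
theorem ellipticPeriod_neg_one_lt {κ : ℝ} (hκ0 : 0 ≤ κ) (hκ : κ < 1) :
    ellipticPeriod (-1) κ < ellipticPeriod 1 κ := by
  have i1 := integrableOn_ellipticWeight (ε := 1) (Or.inl rfl)
  have i2 := integrableOn_ellipticWeight (ε := -1) (Or.inr rfl)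
  have hc : 0 < ellipticKernel κ (3 / 5) := ellipticKernel_pos hκ (by norm_num)
  have key : (∫ x in Ioo (0 : ℝ) 1, (ellipticWeight (-1) x * ellipticKernel κ x -
        ellipticWeight 1 x * ellipticKernel κ x)) ≤
      ∫ x in Ioo (0 : ℝ) 1, (ellipticWeight (-1) x - ellipticWeight 1 x) *
        ellipticKernel κ (3 / 5) := by
    refine setIntegral_mono_on ((integrableOn_mul_ellipticKernel i2 hκ0 hκ).sub
      (integrableOn_mul_ellipticKernel i1 hκ0 hκ)) ((i2.sub i1).mul_const _) measurableSet_Ioo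
      fun x hx => ?_
    rw [← sub_mul]
    have hx0 := hx.1
    rcases le_or_gt x (3 / 5) with h | h
    · rw [ellipticWeight_one_eq_zero hx.1 h, sub_zero]
      exact mul_le_mul_of_nonneg_left (ellipticKernel_le hκ0 hκ hx.1.le (by norm_num) h)
        (ellipticWeight_nonneg _ _)
    · refine mul_le_mul_of_nonpos_left (ellipticKernel_le hκ0 hκ (by norm_num) hx h.le) ?_
      rw [ellipticWeight_eq (by linarith), ellipticWeight_eq (by linarith), sub_nonpos]
      gcongr ?_ / _
      refine Real.sqrt_le_sqrt (div_le_div_of_nonneg_left hx0.le (by linarith) (by linarith))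
  rw [integral_sub (integrableOn_mul_ellipticKernel i2 hκ0 hκ)
    (integrableOn_mul_ellipticKernel i1 hκ0 hκ), integral_mul_const, integral_sub i2 i1] at key
  have := mul_neg_of_neg_of_pos (sub_neg.2 integral_weight_neg_one_lt) hc
  change ellipticPeriod (-1) κ - ellipticPeriod 1 κ ≤ _ at key
  linarith

/-- The concave function `√(x / (1 + x))` is bounded by its tangent at `4/5`, which is `2/3 + 5/108
(5 x - 4)`. Since `4/5` is the midpoint of the interval, the linear term integrates to zero and only
`2/3` contributes. -/
theorem integral_weight_one_le :
    ∫ x in Ioo (3 / 5 : ℝ) 1, ellipticWeight 1 x ≤ (√5)⁻¹ * (2 / 3 * Real.pi) := by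
  obtain ⟨h1, h2⟩ := integrableOn_and_integral_eq_of_hasDerivAt_nonneg (a := 3 / 5) (b := 1)
    (F := fun x => 2 / 3 * Real.arcsin (5 * x - 4) - 5 / 108 * √(1 - (5 * x - 4) ^ 2))
    (f := fun x => (2 / 3 + 5 / 108 * (5 * x - 4)) / √(1 - (5 * x - 4) ^ 2) * 5) (by norm_num)
    ((((Real.continuous_arcsin.comp (by fun_prop : Continuous fun x : ℝ => 5 * x - 4)).const_mul
      _).sub (by fun_prop)).continuousOn)
    (fun x hx => by
      have := (hasDerivAt_linear_arcsin (2 / 3) (5 / 108) (x := 5 * x - 4)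
        (by nlinarith [hx.1, hx.2])).comp x
          (((hasDerivAt_id x).const_mul 5).sub_const 4)
      rw [mul_one] at this
      exact this)
    (fun x hx => by
      have : 0 ≤ 2 / 3 + 5 / 108 * (5 * x - 4) := by linarith [hx.1]
      positivity)
  have h3 : ∫ x in Ioo (3 / 5 : ℝ) 1,
      (√5)⁻¹ * ((2 / 3 + 5 / 108 * (5 * x - 4)) / √(1 - (5 * x - 4) ^ 2) * 5) =
        (√5)⁻¹ * (2 / 3 * Real.pi) := by
    rw [integral_const_mul, h2]
    norm_num [Real.arcsin_one, Real.arcsin_neg_one]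
    ring
  rw [← h3]
  refine setIntegral_mono_on ((integrableOn_ellipticWeight (Or.inl rfl)).mono_set
    (Ioo_subset_Ioo_left (by norm_num))) (h1.const_mul _) measurableSet_Ioo fun x hx => ?_
  have hx0 : 0 < x := by linarith [hx.1]
  have ha : 0 < 5 * x - 3 := by linarith [hx.1]
  have hb : 0 < 1 - x := by linarith [hx.2]
  have e1 : ellipticWeight 1 x = √(x / (1 + x)) / √((5 * x - 3) * (1 - x)) := by
    rw [ellipticWeight, show (5 * x - 3 * 1) * (1 - x ^ 2) = (1 + x) * ((5 * x - 3) * (1 - x)) by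
      ring, Real.sqrt_mul (by positivity), Real.sqrt_div' _ (by positivity), div_div]
  have e2 : (√5)⁻¹ * ((2 / 3 + 5 / 108 * (5 * x - 4)) / √(1 - (5 * x - 4) ^ 2) * 5) =
      (2 / 3 + 5 / 108 * (5 * x - 4)) / √((5 * x - 3) * (1 - x)) := by
    rw [show 1 - (5 * x - 4) ^ 2 = 5 * ((5 * x - 3) * (1 - x)) by ring,
      Real.sqrt_mul (by norm_num)]
    have h5 := Real.sq_sqrt (show (0 : ℝ) ≤ 5 by norm_num)
    have := Real.sqrt_pos.2 (show (0 : ℝ) < 5 by norm_num)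
    have := Real.sqrt_pos.2 (mul_pos ha hb)
    field_simp
    rw [h5]
  rw [e1, e2]
  gcongr
  refine Real.sqrt_le_iff.2 ⟨by linarith, ?_⟩
  rw [div_le_iff₀ (by linarith)]
  have : 0 ≤ (x - 4 / 5) ^ 2 * (100 / 324 + 125 / 1296 + 625 / 11664 * (x - 4 / 5)) :=
    mul_nonneg (sq_nonneg _) (by linarith)
  nlinarith

/-- Equivalent to `3/5 ≤ cos 0.92`. The double-angle formula passes to `sin 0.46`, where the Taylor
bound is sharp enough. -/
theorem le_pi_sub_arcsin : 0.92 ≤ Real.pi / 2 - Real.arcsin (3 / 5) := by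
  have hpi := Real.pi_gt_three
  have hpi' := Real.pi_lt_four
  have : Real.arcsin (3 / 5) ≤ Real.pi / 2 - 0.92 := by
    rw [Real.arcsin_le_iff_le_sin' ⟨by linarith, by linarith⟩, Real.sin_pi_div_two_sub,
      show (0.92 : ℝ) = 2 * 0.46 by norm_num, Real.cos_two_mul, Real.cos_sq']
    have hs := abs_le.1 (Real.sin_bound (x := 0.46) (by norm_num [abs_of_pos]))
    have h0 : 0 ≤ Real.sin 0.46 := Real.sin_nonneg_of_nonneg_of_le_pi (by norm_num) (by linarith)
    have h1 : Real.sin 0.46 ≤ 0.4462 := by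
      have := hs.2
      norm_num [abs_of_pos] at this ⊢
      linarith
    nlinarith
  linarith

/-- The function `√(x / (5 x + 3))` is concave, so it lies above its chord over `[3/5, 1]`. The line
`0.2602 + 0.0933 x` is this chord with its coefficients rounded so that it stays below. -/
theorem le_integral_weight_neg_one :
    0.314 ≤ ∫ x in Ioo (3 / 5 : ℝ) 1, ellipticWeight (-1) x := by
  obtain ⟨h1, h2⟩ := integral_linear_div_sqrt (α := 0.2602) (β := 0.0933) (a := 3 / 5)
    (by norm_num) (by norm_num) (by norm_num) (by norm_num)
  have h3 : √(1 - (3 / 5) ^ 2) = 4 / 5 := by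
    rw [show (1 - (3 / 5) ^ 2 : ℝ) = (4 / 5) ^ 2 by norm_num, Real.sqrt_sq (by norm_num)]
  rw [h3] at h2
  calc (0.314 : ℝ) ≤ 0.2602 * (Real.pi / 2 - Real.arcsin (3 / 5)) + 0.0933 * (4 / 5) := by
        linarith [le_pi_sub_arcsin]
    _ ≤ _ := by
        rw [← h2]
        refine setIntegral_mono_on h1 ((integrableOn_ellipticWeight (Or.inr rfl)).mono_set
          (Ioo_subset_Ioo_left (by norm_num))) measurableSet_Ioo fun x hx => ?_
        have hx0 := hx.1
        have hx1 := hx.2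
        rw [ellipticWeight_eq (by linarith)]
        gcongr
        refine Real.le_sqrt_of_sq_le ?_
        rw [le_div_iff₀ (by linarith)]
        nlinarith [mul_pos (sub_pos.2 hx0) (sub_pos.2 hx1),
          mul_pos (mul_pos (sub_pos.2 hx0) (sub_pos.2 hx1)) (by linarith : 0 < x)]

theorem integral_weight_one_lt : ∫ x in Ioo (3 / 5 : ℝ) 1, ellipticWeight 1 x <
    3 * ∫ x in Ioo (3 / 5 : ℝ) 1, ellipticWeight (-1) x := by
  have h1 := integral_weight_one_le
  have h2 := le_integral_weight_neg_one
  have h3 : (√5)⁻¹ ≤ 0.448 := by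
    rw [inv_le_comm₀ (by positivity) (by norm_num)]
    exact Real.le_sqrt_of_sq_le (by norm_num)
  have h4 := Real.pi_lt_d4
  have h5 : (√5)⁻¹ * (2 / 3 * Real.pi) ≤ 0.448 * (2 / 3 * Real.pi) := by
    have := Real.pi_pos
    gcongr
  linarith

/-- The part of the weight for `ε = -1` on `(0, 3/5)` is discarded. On the rest, three times this
weight minus the other one changes sign once, from negative to positive, at the solution `3/4` of `9
(5 x - 3) = 5 x + 3`. Freezing the increasing kernel at `3/4` gives a lower bound and reduces the
claim to `κ = 0`. -/
theorem ellipticPeriod_one_lt {κ : ℝ} (hκ0 : 0 ≤ κ) (hκ : κ < 1) :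
    ellipticPeriod 1 κ < 3 * ellipticPeriod (-1) κ := by
  have i1 := integrableOn_ellipticWeight (ε := 1) (Or.inl rfl)
  have i2 := integrableOn_ellipticWeight (ε := -1) (Or.inr rfl)
  have k1 := integrableOn_mul_ellipticKernel i1 hκ0 hκ
  have k2 := integrableOn_mul_ellipticKernel i2 hκ0 hκ
  have hs : Ioo (3 / 5 : ℝ) 1 ⊆ Ioo 0 1 := Ioo_subset_Ioo_left (by norm_num)
  have j1 := i1.mono_set hs
  have j2 := i2.mono_set hs
  have l1 := k1.mono_set hs
  have l2 := k2.mono_set hs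
  have hc : 0 < ellipticKernel κ (3 / 4) := ellipticKernel_pos hκ (by norm_num)
  have key : ∫ x in Ioo (3 / 5 : ℝ) 1, (3 * ellipticWeight (-1) x - ellipticWeight 1 x) *
        ellipticKernel κ (3 / 4) ≤
      ∫ x in Ioo (3 / 5 : ℝ) 1, (3 * (ellipticWeight (-1) x * ellipticKernel κ x) -
        ellipticWeight 1 x * ellipticKernel κ x) := by
    refine setIntegral_mono_on (((j2.const_mul 3).sub j1).mul_const _)
      ((l2.const_mul 3).sub l1) measurableSet_Ioo fun x hx => ?_
    rw [← mul_assoc, ← sub_mul]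
    have hx0 := hx.1
    have hx1 := hx.2
    have e : (3 : ℝ) = √9 := by
      rw [show (9 : ℝ) = 3 ^ 2 by norm_num, Real.sqrt_sq (by norm_num)]
    have e3 : 3 * ellipticWeight (-1) x = √(9 * (x / (5 * x - 3 * -1))) / √(1 - x ^ 2) := by
      rw [ellipticWeight_eq (by linarith), Real.sqrt_mul (by norm_num), ← e, mul_div_assoc]
    rw [e3, ellipticWeight_eq (by linarith)]
    rcases le_or_gt x (3 / 4) with h | h
    · refine mul_le_mul_of_nonpos_left (ellipticKernel_le hκ0 hκ (by linarith) (by norm_num) h) ?_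
      rw [sub_nonpos]
      gcongr ?_ / _
      refine Real.sqrt_le_sqrt ?_
      rw [← mul_div_assoc, div_le_div_iff₀ (by linarith) (by linarith)]
      nlinarith
    · refine mul_le_mul_of_nonneg_left (ellipticKernel_le hκ0 hκ (by norm_num) (hs hx) h.le) ?_
      rw [sub_nonneg]
      gcongr ?_ / _
      refine Real.sqrt_le_sqrt ?_
      rw [← mul_div_assoc, div_le_div_iff₀ (by linarith) (by linarith)]
      nlinarith
  rw [integral_sub (l2.const_mul 3) l1, integral_mul_const,
    integral_sub (j2.const_mul 3) j1, integral_const_mul,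
    integral_const_mul, ← setIntegral_weight_one_mul] at key
  have h2 : ∫ x in Ioo (3 / 5 : ℝ) 1, ellipticWeight (-1) x * ellipticKernel κ x ≤
      ellipticPeriod (-1) κ := by
    refine setIntegral_mono_set k2 ?_ hs.eventuallyLE
    filter_upwards [ae_restrict_mem measurableSet_Ioo] with x hx
    exact mul_nonneg (ellipticWeight_nonneg _ _) (ellipticKernel_pos hκ hx).le
  have := mul_pos (sub_pos.2 integral_weight_one_lt) hc
  change _ ≤ _ - ellipticPeriod 1 κ at key
  linarith

theorem ellipticPeriod_one_pos {κ : ℝ} (hκ0 : 0 ≤ κ) (hκ : κ < 1) : 0 < ellipticPeriod 1 κ := by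
  linarith [ellipticPeriod_neg_one_lt hκ0 hκ, ellipticPeriod_one_lt hκ0 hκ]

/-- The ratio of the two periods lies strictly between `4/3` and `2`. -/
theorem period_bounds {p : ℝ} (hp : 0 < p) (hp' : p ^ 2 < 3 / 4) (hne : p ^ 2 ≠ 3 / 8) :
    0 < periodU p ∧ 4 * periodU p < 3 * periodV p ∧ periodV p < 2 * periodU p := by
  obtain ⟨hU, hV⟩ := periods_eq hp hp' hne
  have h0 : 0 < p ^ 2 := by positivity
  have hκ0 : 0 ≤ ((8 * p ^ 2 - 3) / 3) ^ 2 := sq_nonneg _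
  have hκ : ((8 * p ^ 2 - 3) / 3) ^ 2 < 1 := by nlinarith
  have h1 := ellipticPeriod_neg_one_lt hκ0 hκ
  have h2 := ellipticPeriod_one_lt hκ0 hκ
  have h3 := ellipticPeriod_one_pos hκ0 hκ
  have hc : 0 < 2 * (√8)⁻¹ * (8 / 3) := by positivity
  rw [← mul_assoc] at hU hV
  have h4 := mul_lt_mul_of_pos_left h1 hc
  have h5 := mul_lt_mul_of_pos_left h2 hc
  refine ⟨hU ▸ mul_pos hc h3, by linarith, by linarith⟩

end PeriodComparison

/-! ### Analyticity in the modulus and countability of level sets. -/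

section KernelTransform

open MeasureTheory Set

/-- The Taylor coefficients of `1 / √(1 - x)`. -/
noncomputable def invSqrtCoeff (n : ℕ) : ℝ := Ring.choose ((1 / 2 : ℝ) + n - 1) n

theorem invSqrtCoeff_zero : invSqrtCoeff 0 = 1 := Ring.choose_zero_right _

theorem invSqrtCoeff_one : invSqrtCoeff 1 = 1 / 2 := by
  rw [invSqrtCoeff, Ring.choose_one_right]
  norm_num

theorem invSqrtCoeff_two : invSqrtCoeff 2 = 3 / 8 := by
  rw [invSqrtCoeff, Ring.choose_eq_smul]
  simp [descPochhammer, Nat.factorial, Polynomial.smeval_mul, Polynomial.smeval_sub]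
  norm_num

theorem hasFPowerSeriesOnBall_invSqrt :
    HasFPowerSeriesOnBall (fun x : ℝ => 1 / (1 - x) ^ (1 / 2 : ℝ))
      (.ofScalars ℝ invSqrtCoeff) 0 1 :=
  Real.one_div_one_sub_rpow_hasFPowerSeriesOnBall_zero (1 / 2)

theorem summable_invSqrtCoeff {κ : ℝ} (hκ : |κ| < 1) :
    Summable fun n => |invSqrtCoeff n| * |κ| ^ n := by
  have h := FormalMultilinearSeries.summable_norm_mul_pow
    (.ofScalars ℝ invSqrtCoeff : FormalMultilinearSeries ℝ ℝ ℝ) (r := ‖κ‖₊)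
    (lt_of_lt_of_le ?_ hasFPowerSeriesOnBall_invSqrt.r_le)
  · simpa only [FormalMultilinearSeries.ofScalars_norm, Real.norm_eq_abs, coe_nnnorm] using h
  · rw [ENNReal.coe_lt_one_iff, ← NNReal.coe_lt_one, coe_nnnorm]
    exact hκ

theorem mem_eball_zero_one {y : ℝ} : y ∈ Metric.eball (0 : ℝ) 1 ↔ |y| < 1 := by
  rw [← ENNReal.ofReal_one, Metric.eball_ofReal, mem_ball_zero_iff, Real.norm_eq_abs]

theorem hasSum_ellipticKernel {κ x : ℝ} (hκ : |κ| < 1) (hx : x ∈ Ioo (0 : ℝ) 1) :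
    HasSum (fun n => invSqrtCoeff n * κ ^ n * x ^ (2 * n)) (ellipticKernel κ x) := by
  have hx2 : x ^ 2 ≤ 1 := by nlinarith [hx.1, hx.2]
  have hx0 := sq_nonneg x
  have h1 : |κ * x ^ 2| < 1 := by
    rw [abs_mul, abs_of_nonneg hx0]
    nlinarith [abs_nonneg κ]
  have h := hasFPowerSeriesOnBall_invSqrt.hasSum (mem_eball_zero_one.2 h1)
  simp only [FormalMultilinearSeries.ofScalars_apply_eq, zero_add, smul_eq_mul, mul_pow, ← pow_mul, ← mul_assoc] at h
  rwa [← Real.sqrt_eq_rpow, one_div] at h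

theorem integrableOn_mul_pow {D : ℝ → ℝ} (hD : IntegrableOn D (Ioo 0 1)) (n : ℕ) :
    IntegrableOn (fun x => D x * x ^ n) (Ioo 0 1) := by
  refine Integrable.mul_bdd (c := 1) hD (by fun_prop) ?_
  filter_upwards [ae_restrict_mem measurableSet_Ioo] with x hx
  rw [Real.norm_of_nonneg (pow_nonneg hx.1.le n)]
  exact pow_le_one₀ hx.1.le hx.2.le

theorem norm_integral_mul_pow_le {D : ℝ → ℝ} (hD : IntegrableOn D (Ioo 0 1)) (n : ℕ) :
    ∫ x in Ioo (0 : ℝ) 1, ‖D x * x ^ n‖ ≤ ∫ x in Ioo (0 : ℝ) 1, ‖D x‖ := by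
  refine setIntegral_mono_on (integrableOn_mul_pow hD n).norm hD.norm measurableSet_Ioo
    fun x hx => ?_
  rw [norm_mul, Real.norm_of_nonneg (pow_nonneg hx.1.le n)]
  exact mul_le_of_le_one_right (norm_nonneg _) (pow_le_one₀ hx.1.le hx.2.le)

theorem hasSum_integral_mul_ellipticKernel {D : ℝ → ℝ} (hD : IntegrableOn D (Ioo 0 1)) {κ : ℝ}
    (hκ : |κ| < 1) :
    HasSum (fun n => (invSqrtCoeff n * ∫ x in Ioo (0 : ℝ) 1, D x * x ^ (2 * n)) * κ ^ n)
      (∫ x in Ioo (0 : ℝ) 1, D x * ellipticKernel κ x) := by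
  have h := hasSum_integral_of_summable_integral_norm (μ := volume.restrict (Ioo (0 : ℝ) 1))
    (F := fun n x => invSqrtCoeff n * κ ^ n * (D x * x ^ (2 * n)))
    (fun n => (integrableOn_mul_pow hD (2 * n)).const_mul _) ?_
  · have e1 : ∫ x in Ioo (0 : ℝ) 1, D x * ellipticKernel κ x =
        ∫ x in Ioo (0 : ℝ) 1, ∑' n, invSqrtCoeff n * κ ^ n * (D x * x ^ (2 * n)) := by
      refine setIntegral_congr_fun measurableSet_Ioo fun x hx => ?_
      have := (hasSum_ellipticKernel hκ hx).mul_left (D x)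
      rw [← this.tsum_eq]
      congr 1
      ext n
      ring
    rw [e1]
    refine h.congr_fun fun n => ?_
    rw [integral_const_mul]
    ring
  · refine Summable.of_nonneg_of_le (fun n => integral_nonneg fun x => norm_nonneg _)
      (fun n => ?_) ((summable_invSqrtCoeff hκ).mul_right (∫ x in Ioo (0 : ℝ) 1, ‖D x‖))
    simp_rw [norm_mul (invSqrtCoeff n * κ ^ n)]
    rw [integral_const_mul, norm_mul, norm_pow, Real.norm_eq_abs, Real.norm_eq_abs]
    exact mul_le_mul_of_nonneg_left (norm_integral_mul_pow_le hD _) (by positivity)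

/-- The integral transform with kernel `1 / √(1 - κ x²)` is analytic for `|κ| < 1`. -/
theorem hasFPowerSeriesOnBall_integral_mul_ellipticKernel {D : ℝ → ℝ}
    (hD : IntegrableOn D (Ioo 0 1)) :
    HasFPowerSeriesOnBall (fun κ => ∫ x in Ioo (0 : ℝ) 1, D x * ellipticKernel κ x)
      (.ofScalars ℝ fun n => invSqrtCoeff n * ∫ x in Ioo (0 : ℝ) 1, D x * x ^ (2 * n)) 0 1 where
  r_le := by
    refine ENNReal.le_of_forall_nnreal_lt fun r hr => ?_
    have hr1 : |(r : ℝ)| < 1 := by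
      rw [abs_of_nonneg r.coe_nonneg]
      exact_mod_cast hr
    have h := summable_invSqrtCoeff hr1
    rw [abs_of_nonneg r.coe_nonneg] at h
    refine FormalMultilinearSeries.le_radius_of_bound _
      ((∑' n, |invSqrtCoeff n| * (r : ℝ) ^ n) * ∫ x in Ioo (0 : ℝ) 1, ‖D x‖) fun n => ?_
    rw [FormalMultilinearSeries.ofScalars_norm, norm_mul, Real.norm_eq_abs, mul_right_comm]
    refine mul_le_mul (h.le_tsum n fun _ _ => by positivity)
      ((norm_integral_le_integral_norm _).trans (norm_integral_mul_pow_le hD _))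
      (norm_nonneg _) (tsum_nonneg fun _ => by positivity)
  r_pos := one_pos
  hasSum := fun {y} hy => by
    have h := hasSum_integral_mul_ellipticKernel hD (mem_eball_zero_one.1 hy)
    simpa only [FormalMultilinearSeries.ofScalars_apply_eq, zero_add, smul_eq_mul] using h

/-- If zeros accumulated at a point of the disc, the power series would vanish identically, and with
it the moments, since the coefficients of `1 / √(1 - x)` used here are nonzero. Otherwise the zeros
are isolated, and a Lindelöf argument makes them countable. -/
theorem countable_zeros_integral_mul_ellipticKernel {D : ℝ → ℝ} (hD : IntegrableOn D (Ioo 0 1))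
    (hm : ¬ ∀ n ≤ 2, ∫ x in Ioo (0 : ℝ) 1, D x * x ^ (2 * n) = 0) :
    {κ : ℝ | |κ| < 1 ∧ ∫ x in Ioo (0 : ℝ) 1, D x * ellipticKernel κ x = 0}.Countable := by
  have hF := hasFPowerSeriesOnBall_integral_mul_ellipticKernel hD
  have hball : Metric.eball (0 : ℝ) 1 = Metric.ball 0 1 := by
    rw [← ENNReal.ofReal_one, Metric.eball_ofReal]
  have hpre : IsPreconnected (Metric.eball (0 : ℝ) 1) := by
    rw [hball]
    exact (convex_ball _ _).isPreconnected
  obtain ⟨t, ht, htc, hcov⟩ := TopologicalSpace.countable_cover_nhdsWithin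
    (f := fun x : ℝ => ({x} : Set ℝ))
    (s := {κ : ℝ | |κ| < 1 ∧ ∫ x in Ioo (0 : ℝ) 1, D x * ellipticKernel κ x = 0}) (by
      rintro κ ⟨hκ, hκ0⟩
      rcases (hF.analyticOnNhd κ (mem_eball_zero_one.2 hκ)).eventually_eq_zero_or_eventually_ne_zero
        with h | h
      · exfalso
        refine hm fun n hn => ?_
        have h0 := hF.analyticOnNhd.eqOn_zero_of_preconnected_of_eventuallyEq_zero hpre
          (mem_eball_zero_one.2 hκ) h
        have h1 := hF.hasFPowerSeriesAt.eq_zero_of_eventually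
          (h0.eventuallyEq_of_mem (Metric.eball_mem_nhds _ one_pos))
        rw [FormalMultilinearSeries.ofScalars_series_eq_zero] at h1
        have h2 := congrFun h1 n
        refine (mul_eq_zero.1 h2).resolve_left ?_
        interval_cases n
        · rw [invSqrtCoeff_zero]; norm_num
        · rw [invSqrtCoeff_one]; norm_num
        · rw [invSqrtCoeff_two]; norm_num
      · rw [mem_nhdsWithin_iff_eventually]
        rw [eventually_nhdsWithin_iff] at h
        filter_upwards [h] with z hz hz'
        by_contra hne
        exact hz hne hz'.2)
  rw [biUnion_of_singleton] at hcov
  exact htc.mono hcov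

theorem continuousOn_ellipticPeriod {ε : ℝ} (hε : ε = 1 ∨ ε = -1) :
    ContinuousOn (ellipticPeriod ε) {κ | |κ| < 1} := by
  have h := (hasFPowerSeriesOnBall_integral_mul_ellipticKernel
    (integrableOn_ellipticWeight hε)).analyticOnNhd.continuousOn
  exact h.mono fun κ hκ => mem_eball_zero_one.2 hκ

/-- The function `D` is positive on `(0, 3/5)`, nonpositive between `3/5` and `b`, and nonnegative
beyond `b`. The even quartic `(x² - 9/25)(x² - b²)` has the same sign pattern, so its integral
against `D` is positive. That integral is a combination of the moments of order `0`, `2` and `4`. -/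
theorem exists_moment_ne_zero {r : ℝ} (h0 : 0 < r) (h1 : r < 1) :
    ¬ ∀ n ≤ 2, ∫ x in Ioo (0 : ℝ) 1,
      (ellipticWeight (-1) x - r * ellipticWeight 1 x) * x ^ (2 * n) = 0 := by
  intro hm
  set D : ℝ → ℝ := fun x => ellipticWeight (-1) x - r * ellipticWeight 1 x with hDdef
  have hD : IntegrableOn D (Ioo 0 1) := (integrableOn_ellipticWeight (Or.inr rfl)).sub
    ((integrableOn_ellipticWeight (Or.inl rfl)).const_mul r)
  have hr : 0 < 1 - r ^ 2 := by nlinarith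
  -- The solution of `r² (5 x + 3) = 5 x - 3`, where the two weights balance. It may exceed `1`, in
  -- which case the last sign change does not occur.
  set b : ℝ := 3 * (1 + r ^ 2) / (5 * (1 - r ^ 2)) with hb
  have hb1 : 3 / 5 < b := by
    rw [hb, div_lt_div_iff₀ (by norm_num) (by positivity)]
    nlinarith [sq_pos_of_pos h0]
  have hbr : b * (5 * (1 - r ^ 2)) = 3 * (1 + r ^ 2) := by
    rw [hb]
    field_simp
  have hsign : ∀ x ∈ Ioo (3 / 5 : ℝ) 1, 0 ≤ D x * (x - b) := by
    intro x hx
    have hx0 := hx.1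
    have hx1 := hx.2
    have e : r * ellipticWeight 1 x = √(r ^ 2 * (x / (5 * x - 3 * 1))) / √(1 - x ^ 2) := by
      rw [ellipticWeight_eq (by linarith), Real.sqrt_mul (sq_nonneg r), Real.sqrt_sq h0.le,
        mul_div_assoc]
    simp only [hDdef]
    rw [e, ellipticWeight_eq (by linarith)]
    have hp1 : 0 < 5 * x - 3 * 1 := by linarith
    have hp2 : 0 < 5 * x - 3 * -1 := by linarith
    rcases le_total x b with h | h
    · refine mul_nonneg_of_nonpos_of_nonpos ?_ (sub_nonpos.2 h)
      rw [sub_nonpos]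
      gcongr ?_ / _
      refine Real.sqrt_le_sqrt ?_
      rw [← mul_div_assoc, div_le_div_iff₀ hp2 hp1]
      have : x * (5 * (1 - r ^ 2)) ≤ b * (5 * (1 - r ^ 2)) := by gcongr
      nlinarith
    · refine mul_nonneg ?_ (sub_nonneg.2 h)
      rw [sub_nonneg]
      gcongr ?_ / _
      refine Real.sqrt_le_sqrt ?_
      rw [← mul_div_assoc, div_le_div_iff₀ hp1 hp2]
      have : b * (5 * (1 - r ^ 2)) ≤ x * (5 * (1 - r ^ 2)) := by gcongr
      nlinarith
  have hlow : ∀ x ∈ Ioo (0 : ℝ) (3 / 5),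
      0 < D x * ((x ^ 2 - 9 / 25) * (x ^ 2 - b ^ 2)) := by
    intro x hx
    obtain ⟨hx0, hx1⟩ := hx
    have e1 : x ^ 2 - 9 / 25 < 0 := by nlinarith
    have e2 : x ^ 2 - b ^ 2 < 0 := by nlinarith
    refine mul_pos ?_ (mul_pos_of_neg_of_neg e1 e2)
    have : 0 < (5 * x - 3 * -1) * (1 - x ^ 2) := mul_pos (by linarith) (by nlinarith)
    simp only [hDdef]
    rw [ellipticWeight_one_eq_zero hx0 hx1.le, ellipticWeight, mul_zero, sub_zero]
    positivity
  have hint : ∀ n, IntegrableOn (fun x => D x * x ^ (2 * n)) (Ioo 0 1) := fun n =>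
    integrableOn_mul_pow hD _
  have hsum : IntegrableOn (fun x => D x * x ^ (2 * 2) - (9 / 25 + b ^ 2) * (D x * x ^ (2 * 1)) +
      9 / 25 * b ^ 2 * (D x * x ^ (2 * 0))) (Ioo 0 1) :=
    ((hint 2).sub ((hint 1).const_mul _)).add ((hint 0).const_mul _)
  have hzero : ∫ x in Ioo (0 : ℝ) 1, (D x * x ^ (2 * 2) -
      (9 / 25 + b ^ 2) * (D x * x ^ (2 * 1)) + 9 / 25 * b ^ 2 * (D x * x ^ (2 * 0))) = 0 := by
    have j2 := hint 2
    have j1 := (hint 1).const_mul (9 / 25 + b ^ 2)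
    have a1 := integral_add (j2.sub j1) ((hint 0).const_mul (9 / 25 * b ^ 2))
    simp only [Pi.sub_apply] at a1
    rw [a1, integral_sub j2 j1, integral_const_mul,
      integral_const_mul, hm 2 le_rfl, hm 1 (by norm_num), hm 0 (by norm_num)]
    ring
  have hexp : ∀ x, D x * x ^ (2 * 2) - (9 / 25 + b ^ 2) * (D x * x ^ (2 * 1)) +
      9 / 25 * b ^ 2 * (D x * x ^ (2 * 0)) = D x * ((x ^ 2 - 9 / 25) * (x ^ 2 - b ^ 2)) :=
    fun x => by ring
  simp_rw [hexp] at hsum hzero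
  have hpos := (setIntegral_pos_iff_support_of_nonneg_ae (μ := volume) (s := Ioo (0 : ℝ) 1)
    (f := fun x => D x * ((x ^ 2 - 9 / 25) * (x ^ 2 - b ^ 2))) (by
      filter_upwards [ae_restrict_mem measurableSet_Ioo] with x hx
      rcases lt_trichotomy x (3 / 5) with h | rfl | h
      · exact (hlow x ⟨hx.1, h⟩).le
      · norm_num
      · have e1 : 0 ≤ x ^ 2 - 9 / 25 := by nlinarith
        have e2 : 0 ≤ x + b := by linarith [hx.1]
        have := mul_nonneg (mul_nonneg (hsign x ⟨h, hx.2⟩) e1) e2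
        simp only [Pi.zero_apply]
        linarith) hsum).2 (lt_of_lt_of_le (b := volume (Ioo (0 : ℝ) (3 / 5))) (by simp)
      (measure_mono fun x hx => ⟨(hlow x hx).ne', hx.1, hx.2.trans (by norm_num)⟩))
  exact hpos.ne' hzero

/-- The ratio of the two elliptic periods takes each value at most countably often. -/
theorem countable_ellipticPeriod_ratio {r : ℝ} (h0 : 0 < r) (h1 : r < 1) :
    {κ : ℝ | 0 ≤ κ ∧ κ < 1 ∧ ellipticPeriod (-1) κ = r * ellipticPeriod 1 κ}.Countable := by
  have i1 := integrableOn_ellipticWeight (ε := 1) (Or.inl rfl)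
  have i2 := integrableOn_ellipticWeight (ε := -1) (Or.inr rfl)
  refine (countable_zeros_integral_mul_ellipticKernel (i2.sub (i1.const_mul r))
    (exists_moment_ne_zero h0 h1)).mono ?_
  rintro κ ⟨hκ0, hκ1, hκ⟩
  refine ⟨by rwa [abs_of_nonneg hκ0], ?_⟩
  have k1 := integrableOn_mul_ellipticKernel i1 hκ0 hκ1
  have k2 := integrableOn_mul_ellipticKernel i2 hκ0 hκ1
  simp only [Pi.sub_apply, sub_mul, mul_assoc]
  rw [integral_sub k2 (k1.const_mul r), integral_const_mul]
  exact sub_eq_zero.2 hκ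

end KernelTransform

/-! ### Parameters with a rational period ratio. -/

section PeriodRatio

open MeasureTheory Set

theorem modulus_mem {p : ℝ} (hp : 0 < p) (hp' : p ^ 2 < 3 / 4) :
    0 ≤ ((8 * p ^ 2 - 3) / 3) ^ 2 ∧ ((8 * p ^ 2 - 3) / 3) ^ 2 < 1 := by
  have : 0 < p ^ 2 := by positivity
  exact ⟨sq_nonneg _, by nlinarith⟩

theorem periodV_div_periodU {p : ℝ} (hp : 0 < p) (hp' : p ^ 2 < 3 / 4) (hne : p ^ 2 ≠ 3 / 8) :
    periodV p / periodU p = 1 + ellipticPeriod (-1) (((8 * p ^ 2 - 3) / 3) ^ 2) /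
      ellipticPeriod 1 (((8 * p ^ 2 - 3) / 3) ^ 2) := by
  obtain ⟨hκ0, hκ1⟩ := modulus_mem hp hp'
  obtain ⟨hU, hV⟩ := periods_eq hp hp' hne
  have h1 := ellipticPeriod_one_pos hκ0 hκ1
  have hU0 : periodU p ≠ 0 := (period_bounds hp hp' hne).1.ne'
  rw [hV, add_div, div_self hU0, hU, mul_div_mul_left _ _ (by positivity),
    mul_div_mul_left _ _ (by positivity)]

/-- Only `1 < c < 2` can occur. The modulus `κ` is injective in `p` on each side of `p² = 3/8`, so a
countable set of moduli pulls back to a countable set of parameters. -/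
theorem countable_periodV_div_periodU_eq (c : ℝ) :
    {p : ℝ | 0 < p ∧ p ^ 2 < 3 / 4 ∧ p ^ 2 ≠ 3 / 8 ∧ periodV p / periodU p = c}.Countable := by
  set S : Set ℝ := {p | 0 < p ∧ p ^ 2 < 3 / 4 ∧ p ^ 2 ≠ 3 / 8 ∧ periodV p / periodU p = c}
  by_cases hc : 0 < c - 1 ∧ c - 1 < 1
  · have hmaps : MapsTo (fun p : ℝ => ((8 * p ^ 2 - 3) / 3) ^ 2) S
        {κ : ℝ | 0 ≤ κ ∧ κ < 1 ∧ ellipticPeriod (-1) κ = (c - 1) * ellipticPeriod 1 κ} := by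
      rintro p ⟨hp, hp', hne, hpc⟩
      obtain ⟨hκ0, hκ1⟩ := modulus_mem hp hp'
      refine ⟨hκ0, hκ1, ?_⟩
      have h1 := ellipticPeriod_one_pos hκ0 hκ1
      rw [← hpc, periodV_div_periodU hp hp' hne, add_sub_cancel_left,
        div_mul_cancel₀ _ h1.ne']
    have hcount := countable_ellipticPeriod_ratio hc.1 hc.2
    have hS : S = (S ∩ {p | p ^ 2 ≤ 3 / 8}) ∪ (S ∩ {p | 3 / 8 ≤ p ^ 2}) := by
      rw [← inter_union_distrib_left]
      refine (inter_eq_left.2 fun p _ => ?_).symm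
      exact le_total (p ^ 2) (3 / 8)
    rw [hS]
    have hinj : ∀ p ∈ S, ∀ q ∈ S, p ^ 2 = q ^ 2 → p = q := fun p hp q hq h =>
      (pow_left_inj₀ hp.1.le hq.1.le two_ne_zero).1 h
    refine (MapsTo.countable_of_injOn (hmaps.mono_left inter_subset_left)
      (fun p hp q hq h => hinj p hp.1 q hq.1 ?_) hcount).union
      (MapsTo.countable_of_injOn (hmaps.mono_left inter_subset_left)
      (fun p hp q hq h => hinj p hp.1 q hq.1 ?_) hcount)
    · have h1 : p ^ 2 ≤ 3 / 8 := hp.2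
      have h2 : q ^ 2 ≤ 3 / 8 := hq.2
      have h3 : (3 - 8 * p ^ 2) ^ 2 = (3 - 8 * q ^ 2) ^ 2 := by
        linarith [h]
      have := (pow_left_inj₀ (by linarith) (by linarith) two_ne_zero).1 h3
      linarith
    · have h1 : 3 / 8 ≤ p ^ 2 := hp.2
      have h2 : 3 / 8 ≤ q ^ 2 := hq.2
      have h3 : (8 * p ^ 2 - 3) ^ 2 = (8 * q ^ 2 - 3) ^ 2 := by
        linarith [h]
      have := (pow_left_inj₀ (by linarith) (by linarith) two_ne_zero).1 h3
      linarith
  · convert countable_empty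
    refine eq_empty_of_forall_notMem ?_
    rintro p ⟨hp, hp', hne, hpc⟩
    obtain ⟨h0, h1, h2⟩ := period_bounds hp hp' hne
    refine hc ⟨?_, ?_⟩
    · have : 1 < c := by
        rw [← hpc, lt_div_iff₀ h0]
        linarith
      linarith
    · have : c < 2 := by
        rw [← hpc, div_lt_iff₀ h0]
        linarith
      linarith

theorem continuousOn_periodV_div_periodU :
    ContinuousOn (fun p => periodV p / periodU p)
      {p | 0 < p ∧ p ^ 2 < 3 / 4 ∧ p ^ 2 ≠ 3 / 8} := by
  have hm : MapsTo (fun p : ℝ => ((8 * p ^ 2 - 3) / 3) ^ 2)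
      {p | 0 < p ∧ p ^ 2 < 3 / 4 ∧ p ^ 2 ≠ 3 / 8} {κ | |κ| < 1} := by
    rintro p ⟨hp, hp', -⟩
    obtain ⟨hκ0, hκ1⟩ := modulus_mem hp hp'
    rwa [mem_ofPred_eq, abs_of_nonneg hκ0]
  have hc : ContinuousOn (fun p : ℝ => ((8 * p ^ 2 - 3) / 3) ^ 2)
      {p | 0 < p ∧ p ^ 2 < 3 / 4 ∧ p ^ 2 ≠ 3 / 8} := by fun_prop
  refine ContinuousOn.congr (f := fun p => 1 + ellipticPeriod (-1) (((8 * p ^ 2 - 3) / 3) ^ 2) /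
      ellipticPeriod 1 (((8 * p ^ 2 - 3) / 3) ^ 2)) ?_
    fun p hp => periodV_div_periodU hp.1 hp.2.1 hp.2.2
  refine continuousOn_const.add (((continuousOn_ellipticPeriod (Or.inr rfl)).comp hc hm).div
    ((continuousOn_ellipticPeriod (Or.inl rfl)).comp hc hm) fun p hp => ?_)
  obtain ⟨hκ0, hκ1⟩ := modulus_mem hp.1 hp.2.1
  exact (ellipticPeriod_one_pos hκ0 hκ1).ne'

/-- An interval is uncountable, so the ratio is not constant on it. By continuity it then takes
every value between two distinct ones, among them a rational number. -/
theorem exists_rational_ratio {a b : ℝ} (hab : a < b)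
    (hs : Icc a b ⊆ {p | 0 < p ∧ p ^ 2 < 3 / 4 ∧ p ^ 2 ≠ 3 / 8}) :
    ∃ p ∈ Icc a b, ∃ r : ℚ, periodV p / periodU p = r := by
  have hne : ∃ x ∈ Icc a b, periodV x / periodU x ≠ periodV a / periodU a := by
    by_contra! h
    have h1 : (Icc a b).Countable :=
      (countable_periodV_div_periodU_eq (periodV a / periodU a)).mono fun x hx => by
        obtain ⟨h1, h2, h3⟩ := hs hx
        exact ⟨h1, h2, h3, h x hx⟩
    have h2 := h1.measure_zero volume
    rw [Real.volume_Icc, ENNReal.ofReal_eq_zero] at h2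
    linarith
  obtain ⟨x, hx, hxa⟩ := hne
  have hsub : uIcc a x ⊆ Icc a b := by
    rw [uIcc_of_le hx.1]
    exact Icc_subset_Icc_right hx.2
  have hivt := intermediate_value_uIcc (continuousOn_periodV_div_periodU.mono (hsub.trans hs))
  have hr : ∃ r : ℚ, (r : ℝ) ∈ uIcc (periodV a / periodU a) (periodV x / periodU x) := by
    rcases lt_or_gt_of_ne hxa with h | h
    · obtain ⟨r, h1, h2⟩ := exists_rat_btwn h
      exact ⟨r, mem_uIcc.2 (Or.inr ⟨h1.le, h2.le⟩)⟩
    · obtain ⟨r, h1, h2⟩ := exists_rat_btwn h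
      exact ⟨r, mem_uIcc.2 (Or.inl ⟨h1.le, h2.le⟩)⟩
  obtain ⟨r, hr⟩ := hr
  obtain ⟨p, hp, hpr⟩ := hivt hr
  exact ⟨p, hsub hp, r, hpr⟩

theorem mem_Ioo_sqrt_three_iff {p : ℝ} :
    p ∈ Ioo (0 : ℝ) (√3 / 2) ↔ 0 < p ∧ p ^ 2 < 3 / 4 := by
  rw [mem_Ioo, and_congr_right_iff]
  intro hp
  rw [← pow_lt_pow_iff_left₀ hp.le (by positivity) two_ne_zero, div_pow,
    Real.sq_sqrt (by norm_num)]
  norm_num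

theorem eq_sqrt_three_eighths_iff {p : ℝ} (hp : 0 < p) : p = √(3 / 8) ↔ p ^ 2 = 3 / 8 := by
  rw [← Real.sqrt_sq hp.le, Real.sqrt_inj (sq_nonneg p) (by norm_num), Real.sqrt_sq hp.le]

/-- The parameters for which the frequency ratio is rational, with the value `√(3/8)`, at which
one of the angles is constant, added. -/
noncomputable def periodicParameters : Set ℝ :=
  {p | p ∈ Ioo (0 : ℝ) (√3 / 2) ∧ (p = √(3 / 8) ∨ ∃ r : ℚ, periodV p / periodU p = r)}

theorem countable_periodicParameters : periodicParameters.Countable := by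
  refine ((countable_singleton (√(3 / 8))).union (countable_iUnion fun r : ℚ =>
    countable_periodV_div_periodU_eq r)).mono ?_
  rintro p ⟨hp, h⟩
  by_cases h0 : p = √(3 / 8)
  · exact Or.inl h0
  · obtain ⟨r, hr⟩ := h.resolve_left h0
    obtain ⟨hp0, hp1⟩ := mem_Ioo_sqrt_three_iff.1 hp
    exact Or.inr (mem_iUnion.2 ⟨r, hp0, hp1, fun h => h0 ((eq_sqrt_three_eighths_iff hp0).2 h), hr⟩)

theorem Ioo_subset_closure_periodicParameters :
    Ioo 0 (√3 / 2) ⊆ closure periodicParameters := by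
  intro p hp
  rw [mem_closure_iff]
  intro U hU hpU
  have hU' := (hU.inter isOpen_Ioo).mem_nhds ⟨hpU, hp⟩
  obtain ⟨ε, hε, hball⟩ := Metric.mem_nhds_iff.1 hU'
  -- The ratio formula fails at the exceptional parameter, so the small interval is placed on the
  -- side of `p` facing away from it.
  have hex : ∃ a b, a < b ∧ Icc a b ⊆ Metric.ball p ε ∧ √(3 / 8) ∉ Icc a b := by
    rcases le_or_gt p √(3 / 8) with h | h
    · refine ⟨p - ε / 2, p - ε / 4, by linarith, fun x hx => ?_, fun hx => ?_⟩
      · rw [Metric.mem_ball, Real.dist_eq, abs_lt]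
        constructor <;> linarith [hx.1, hx.2]
      · linarith [hx.2]
    · refine ⟨p + ε / 4, p + ε / 2, by linarith, fun x hx => ?_, fun hx => ?_⟩
      · rw [Metric.mem_ball, Real.dist_eq, abs_lt]
        constructor <;> linarith [hx.1, hx.2]
      · linarith [hx.1]
  obtain ⟨a, b, hab, hsub, hnot⟩ := hex
  have hgood : Icc a b ⊆ {p | 0 < p ∧ p ^ 2 < 3 / 4 ∧ p ^ 2 ≠ 3 / 8} := fun x hx => by
    obtain ⟨h1, h2⟩ := mem_Ioo_sqrt_three_iff.1 (hball (hsub hx)).2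
    exact ⟨h1, h2, fun h => hnot ((eq_sqrt_three_eighths_iff h1).2 h ▸ hx)⟩
  obtain ⟨q, hq, hr⟩ := exists_rational_ratio hab hgood
  exact ⟨q, (hball (hsub hq)).1, (hball (hsub hq)).2, Or.inr hr⟩

end PeriodRatio

/-! ### Transfer to arbitrary solutions and the final statement. -/

theorem eq_sqrt_three_half {p : ℝ} (hp : 0 < p) (h : p ^ 2 = 3 / 4) : p = √3 / 2 := by
  rw [← pow_left_inj₀ hp.le (by positivity) two_ne_zero, h, div_pow, Real.sq_sqrt (by norm_num)]
  norm_num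

/-- Existence of the solution, for all parameters. -/
theorem exists_isSolution {p : ℝ} (hp : p ∈ Set.Ioc (0 : ℝ) 1) :
    ∃ φ₁ φ₂, IsSolution p φ₁ φ₂ := by
  rcases lt_trichotomy (p ^ 2) (3 / 4) with h | h | h
  · obtain ⟨-, -, φ₁, φ₂, hφ, -⟩ := exists_solution_of_lt hp.1 h
    exact ⟨φ₁, φ₂, hφ⟩
  · rw [eq_sqrt_three_half hp.1 h]
    exact ⟨_, _, isSolution_soliton⟩
  · obtain ⟨φ₁, φ₂, hφ, -⟩ := exists_solution_of_gt hp.1 h hp.2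
    exact ⟨φ₁, φ₂, hφ⟩

theorem existsUnique_isSolution {p : ℝ} (hp : p ∈ Set.Ioc (0 : ℝ) 1) :
    ∃! φ : (ℝ → ℝ) × (ℝ → ℝ), IsSolution p φ.1 φ.2 := by
  obtain ⟨φ₁, φ₂, hφ⟩ := exists_isSolution hp
  exact ⟨(φ₁, φ₂), hφ, fun ψ hψ => Prod.ext (hψ.unique hφ).1 (hψ.unique hφ).2⟩

theorem isPeriodic_or_isQuasiPeriodic {p : ℝ} (hp : p ∈ Set.Ioc (0 : ℝ) 1) (hne : p ≠ √3 / 2)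
    {φ₁ φ₂ : ℝ → ℝ} (hφ : IsSolution p φ₁ φ₂) :
    IsPeriodic (pairFun φ₁ φ₂) ∨ IsQuasiPeriodic (pairFun φ₁ φ₂) := by
  rcases lt_trichotomy (p ^ 2) (3 / 4) with h | h | h
  · obtain ⟨-, -, ψ₁, ψ₂, hψ, h1, h2, -⟩ := exists_solution_of_lt hp.1 h
    obtain ⟨rfl, rfl⟩ := hφ.unique hψ
    by_cases hr : ∃ r : ℚ, angleTimeV p / angleTimeU p = r
    · exact Or.inl (h1 hr)
    · exact Or.inr (h2 hr)
  · exact absurd (eq_sqrt_three_half hp.1 h) hne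
  · obtain ⟨ψ₁, ψ₂, hψ, h1, -⟩ := exists_solution_of_gt hp.1 h hp.2
    obtain ⟨rfl, rfl⟩ := hφ.unique hψ
    exact h1

theorem homoclinic_solution {φ₁ φ₂ : ℝ → ℝ} (hφ : IsSolution (√3 / 2) φ₁ φ₂) :
    Filter.Tendsto (pairFun φ₁ φ₂) Filter.atTop (nhds (0, 0)) ∧ ¬ IsPeriodic (pairFun φ₁ φ₂) := by
  have hlim : Filter.Tendsto (pairFun φ₁ φ₂) Filter.atTop (nhds (0, 0)) := by
    obtain ⟨rfl, rfl⟩ := hφ.unique isSolution_soliton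
    exact soliton_tendsto
  refine ⟨hlim, fun hper => ?_⟩
  have h := congrArg Prod.snd (eq_of_isPeriodic_of_tendsto hper hlim 0)
  have h3 : 0 < √(3 : ℝ) / 2 := by positivity
  rw [← hφ.snd_zero] at h3
  exact h3.ne' h

theorem zeros_snd_of_gt {p : ℝ} (hp : p ∈ Set.Ioc (√3 / 2) 1) {φ₁ φ₂ : ℝ → ℝ}
    (hφ : IsSolution p φ₁ φ₂) : (∃ y, φ₂ y = 0) ∧
      (∀ T, IsPeriod φ₂ T → ∀ a, (zerosIn φ₂ a T).Nonempty) ∧ ¬ ZeroCondition φ₁ φ₂ := by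
  have hp0 : 0 < p := lt_of_le_of_lt (by positivity) hp.1
  have hp1 : 3 / 4 < p ^ 2 := by
    have := pow_lt_pow_left₀ hp.1 (by positivity) two_ne_zero
    rw [div_pow, Real.sq_sqrt (by norm_num)] at this
    linarith
  obtain ⟨ψ₁, ψ₂, hψ, -, y, hy⟩ := exists_solution_of_gt hp0 hp1 hp.2
  obtain ⟨rfl, rfl⟩ := hφ.unique hψ
  refine ⟨⟨y, hy⟩, fun T hT a => ?_, fun h => (h.2 y).ne' hy⟩
  obtain ⟨z, hz, hyz⟩ := hT.2.exists_mem_Ico hT.1 y a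
  exact ⟨z, hz, hyz ▸ hy⟩

theorem angleTime_ratio {p : ℝ} (hp : 0 < p) (hp' : p ^ 2 < 3 / 4) (hne : p ^ 2 ≠ 3 / 8) :
    periodV p / periodU p = angleTimeV p / angleTimeU p := by
  rw [periodU_eq hp hp', periodV_eq hp hp' hne, mul_div_mul_left _ _ two_ne_zero]

theorem zeroCondition_of_eq {p : ℝ} (hp : 0 < p) (hp' : p ^ 2 = 3 / 8) {φ₁ φ₂ : ℝ → ℝ}
    (hφ : IsSolution p φ₁ φ₂) : ZeroCondition φ₁ φ₂ := by
  obtain ⟨-, -, ψ₁, ψ₂, hψ, -, -, -, h⟩ := exists_solution_of_lt hp (by rw [hp']; norm_num)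
  obtain ⟨rfl, rfl⟩ := hφ.unique hψ
  exact h hp'

theorem isPeriodic_iff_mem_periodicParameters {p : ℝ} (hp : p ∈ Set.Ioo (0 : ℝ) (√3 / 2))
    {φ₁ φ₂ : ℝ → ℝ} (hφ : IsSolution p φ₁ φ₂) :
    IsPeriodic (pairFun φ₁ φ₂) ↔ p ∈ periodicParameters := by
  obtain ⟨hp0, hp'⟩ := mem_Ioo_sqrt_three_iff.1 hp
  by_cases he : p ^ 2 = 3 / 8
  · refine iff_of_true ?_ ⟨hp, Or.inl ((eq_sqrt_three_eighths_iff hp0).2 he)⟩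
    obtain ⟨⟨T, hT, -⟩, -⟩ := zeroCondition_of_eq hp0 he hφ
    exact ⟨T, hT.1⟩
  · obtain ⟨hU, hV, ψ₁, ψ₂, hψ, h1, -, h2, -⟩ := exists_solution_of_lt hp0 hp'
    obtain ⟨rfl, rfl⟩ := hφ.unique hψ
    constructor
    · rintro ⟨T, hT⟩
      obtain ⟨n, m, hn, hm, hnm, -⟩ := h2 he T hT
      refine ⟨hp, Or.inr ⟨(2 * n : ℚ) / m, ?_⟩⟩
      have hm' : (m : ℝ) ≠ 0 := by positivity
      rw [angleTime_ratio hp0 hp' he]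
      push_cast
      rw [div_eq_div_iff hU.ne' hm', hnm]
      ring
    · rintro ⟨-, h | h⟩
      · exact absurd ((eq_sqrt_three_eighths_iff hp0).1 h) he
      · rw [angleTime_ratio hp0 hp' he] at h
        exact h1 h

/-- A period gives `T_v / T_u = 2 n / m` with `2 n` zeros of `φ₁`, and this ratio lies strictly
between `4/3` and `2`. -/
theorem six_le_encard_zerosIn {p : ℝ} (hp : p ∈ Set.Ioo (0 : ℝ) (√3 / 2)) (hne : p ≠ √(3 / 8))
    {φ₁ φ₂ : ℝ → ℝ} (hφ : IsSolution p φ₁ φ₂) {T : ℝ} (hT : IsPeriod (pairFun φ₁ φ₂) T) (a : ℝ) :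
    6 ≤ (zerosIn φ₁ a T).encard := by
  obtain ⟨hp0, hp'⟩ := mem_Ioo_sqrt_three_iff.1 hp
  have he : p ^ 2 ≠ 3 / 8 := fun h => hne ((eq_sqrt_three_eighths_iff hp0).2 h)
  obtain ⟨hU, hV, ψ₁, ψ₂, hψ, -, -, h2, -⟩ := exists_solution_of_lt hp0 hp'
  obtain ⟨rfl, rfl⟩ := hφ.unique hψ
  obtain ⟨n, m, hn, hm, hnm, hz⟩ := h2 he T hT
  obtain ⟨-, hb1, hb2⟩ := period_bounds hp0 hp' he
  rw [periodU_eq hp0 hp', periodV_eq hp0 hp' he] at hb1 hb2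
  have hm' : (0 : ℝ) < m := by positivity
  have h3 : 2 * m < 3 * n := by
    have h4 : (2 * m : ℝ) * angleTimeU p < (3 * n) * angleTimeU p := by
      have := mul_lt_mul_of_pos_left hb1 hm'
      linarith
    exact_mod_cast lt_of_mul_lt_mul_right h4 hU.le
  have h5 : n < m := by
    have h6 : (n : ℝ) * angleTimeU p < m * angleTimeU p := by
      have := mul_lt_mul_of_pos_left hb2 hm'
      linarith
    exact_mod_cast lt_of_mul_lt_mul_right h6 hU.le
  rw [hz a]
  -- The inequalities `n < m` and `2 m < 3 n` have no integer solution with `n = 1` or `n = 2`; the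
  -- first is `n = 3`, `m = 4`.
  have : 6 ≤ 2 * n := by lia
  exact_mod_cast this

theorem mainTheorem5 :
    -- for every `p ∈ (0, 1]` there is exactly one solution on the real line
    (∀ p ∈ Set.Ioc (0 : ℝ) 1, ∃! φ : (ℝ → ℝ) × (ℝ → ℝ), IsSolution p φ.1 φ.2) ∧
    -- periodic or quasi-periodic away from the homoclinic value
    (∀ p ∈ Set.Ioc (0 : ℝ) 1, p ≠ Real.sqrt 3 / 2 → ∀ φ₁ φ₂ : ℝ → ℝ, IsSolution p φ₁ φ₂ →
      IsPeriodic (pairFun φ₁ φ₂) ∨ IsQuasiPeriodic (pairFun φ₁ φ₂)) ∧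
    -- the homoclinic value
    (∀ φ₁ φ₂ : ℝ → ℝ, IsSolution (Real.sqrt 3 / 2) φ₁ φ₂ →
      Filter.Tendsto (pairFun φ₁ φ₂) Filter.atTop (nhds (0, 0)) ∧
      ¬ IsPeriodic (pairFun φ₁ φ₂)) ∧
    -- zeros of `φ₂` above the homoclinic value
    (∀ p ∈ Set.Ioc (Real.sqrt 3 / 2) 1, ∀ φ₁ φ₂ : ℝ → ℝ, IsSolution p φ₁ φ₂ →
      (∃ y, φ₂ y = 0) ∧
      (∀ T, IsPeriod φ₂ T → ∀ a, (zerosIn φ₂ a T).Nonempty) ∧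
      ¬ ZeroCondition φ₁ φ₂) ∧
    -- the integrals defining the hyperelliptic periods converge
    (∀ p ∈ Set.Ioo (0 : ℝ) (Real.sqrt 3 / 2),
      IntervalIntegrable (fun s => 1 / Real.sqrt (quintic p s)) MeasureTheory.volume
        0 (1 / 2) ∧
      (p ≠ Real.sqrt (3 / 8) →
        IntervalIntegrable (fun s => 1 / Real.sqrt (quintic p s)) MeasureTheory.volume
          (lowerRoot p) (upperRoot p))) ∧
    -- the parameters of the periodic solutions
    (∃ P : Set ℝ, P ⊆ Set.Ioo 0 (Real.sqrt 3 / 2) ∧ P.Countable ∧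
      Set.Ioo 0 (Real.sqrt 3 / 2) ⊆ closure P ∧
      Real.sqrt (3 / 8) ∈ P ∧
      (∀ p ∈ Set.Ioo (0 : ℝ) (Real.sqrt 3 / 2), p ≠ Real.sqrt (3 / 8) →
        (p ∈ P ↔ ∃ r : ℚ, periodV p / periodU p = (r : ℝ))) ∧
      (∀ p ∈ Set.Ioo (0 : ℝ) (Real.sqrt 3 / 2), ∀ φ₁ φ₂ : ℝ → ℝ, IsSolution p φ₁ φ₂ →
        (IsPeriodic (pairFun φ₁ φ₂) ↔ p ∈ P)) ∧
      -- zeros of `φ₁` for the periodic solutions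
      (∀ φ₁ φ₂ : ℝ → ℝ, IsSolution (Real.sqrt (3 / 8)) φ₁ φ₂ → ZeroCondition φ₁ φ₂) ∧
      (∀ p ∈ P, p ≠ Real.sqrt (3 / 8) → ∀ φ₁ φ₂ : ℝ → ℝ, IsSolution p φ₁ φ₂ →
        ∀ T, IsPeriod (pairFun φ₁ φ₂) T → ∀ a, 6 ≤ (zerosIn φ₁ a T).encard)) := by
  have hmem : √(3 / 8) ∈ Set.Ioo (0 : ℝ) (√3 / 2) := by
    rw [mem_Ioo_sqrt_three_iff, Real.sq_sqrt (by norm_num)]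
    exact ⟨by positivity, by norm_num⟩
  refine ⟨fun p hp => existsUnique_isSolution hp,
    fun p hp hne _ _ hφ => isPeriodic_or_isQuasiPeriodic hp hne hφ,
    fun _ _ hφ => homoclinic_solution hφ, fun p hp _ _ hφ => zeros_snd_of_gt hp hφ,
    fun p hp => ?_, periodicParameters, fun p hp => hp.1, countable_periodicParameters,
    Ioo_subset_closure_periodicParameters, ⟨hmem, Or.inl rfl⟩,
    fun p hp hne => ⟨fun h => h.2.resolve_left hne, fun h => ⟨hp, Or.inr h⟩⟩,
    fun p hp _ _ hφ => isPeriodic_iff_mem_periodicParameters hp hφ,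
    fun _ _ hφ => zeroCondition_of_eq hmem.1 (Real.sq_sqrt (by norm_num)) hφ,
    fun p hp hne _ _ hφ T hT a => six_le_encard_zerosIn hp.1 hne hφ hT a⟩
  obtain ⟨hp0, hp'⟩ := mem_Ioo_sqrt_three_iff.1 hp
  exact ⟨intervalIntegrable_quintic hp0 hp', fun hne => (intervalIntegrable_quintic_of_ne hp0 hp'
    fun h => hne ((eq_sqrt_three_eighths_iff hp0).2 h)).2⟩
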